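/- **Setting.** For a probability distribution $G$ on $\mathbb{R}$ (also its distribution function) let $Q(p;G)=\inf\{x: G(x)\ge p\}$, $\mu(G)=\int x\,dG$, $\mu^p(G)=\int|x|\,dG$, and $M(G)=\mathbb{E}|Y_1-Y_2|$ with $Y_1,Y_2$ independent with distribution $G$. For a distribution $F$, the law of $X$, let $F^{\oplus}$, $F^{\ominus}$ be the conditional laws of $X$ given $X>0$, resp. $X<0$. Put $$L^{\oplus}(p)=\frac{\int_0^pQ(u;F^\oplus)du}{\mu(F^\oplus)},\quad L^{\ominus}(p)=\frac{\int_0^pQ(u;F^\ominus)du}{\mu(F^\ominus)},\quad L^{s}(p)=\frac{\int_0^pQ(u;F)du}{\mu^p(F)},$$ $$I^\oplus=\frac{M(F^\oplus)}{2\mu(F^\oplus)},\quad I^\ominus=\frac{M(F^\ominus)}{2|\mu(F^\ominus)|},\quad I^p=\frac{M(F)}{2\mu^p(F)} .$$ Below, $\dagger$ stands for one of $\oplus,\ominus$ or "whole" (the case of $L^s$ and $I^p$); correspondingly $S^\dagger=(0,\infty),(-\infty,0),\mathbb{R}$ and $F^\dagger=F^\oplus,F^\ominus,F$. Estimators $\hat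 L^\dagger,\hat I^\dagger$ are obtained by replacing $F$ by the empirical distribution of the sample. Define $$W^{\oplus}(x;p)=\frac{[x-Q(p;F^\oplus)]\mathbf 1(x\le Q(p;F^\oplus))-xL^\oplus(p)}{\mu(F^\oplus)},\quad W^{\ominus}(x;p)=\frac{[x-Q(p;F^\ominus)]\mathbf 1(x\le Q(p;F^\ominus))-xL^\ominus(p)}{\mu(F^\ominus)},$$ $$W^{s}(x;p)=\frac{[x-Q(p;F)]\mathbf 1(x\le Q(p;F))-|x|L^s(p)}{\mu^p(F)},$$ $$K^\oplus(x)=\frac{2xF^\oplus(x)-2\int_{(-\infty,x]}t\,dF^\oplus-(I^\oplus+1)x}{\mu(F^\oplus)},\quad K^\ominus(x)=\frac{2xF^\ominus(x)-2\int_{(-\infty,x]}t\,dF^\ominus+(I^\ominus-1)x}{|\mu(F^\ominus)|},$$ $$K^p(x)=\frac{2xF(x)-2\int_{(-\infty,x]}t\,dF-I^p|x|-x}{\mu^p(F)} .$$ **Overlapping samples.** Let $\widetilde F$ be the joint law of $(X_1,X_2)$, with marginals $F_1,F_2$ of finite variance. Along a sequence of sizes $n_1,n_2\to\infty$ and $0\le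 m\le\min(n_1,n_2)$ we observe $X_{k1},\dots,X_{kn_k}\sim F_k$, $k=1,2$, such that $(X_{1i},X_{2i})$, $i\le m$, are iid $\sim\widetilde F$, the unmatched observations $(X_{ki})_{m<i\le n_k}$ of each sample are iid, and they are independent of all the remaining observations. Assume $m/n_1\to\lambda_1$, $m/n_2\to\lambda_2$, $n_1/(n_1+n_2)\to\eta_1$, and put $N=n_1n_2/(n_1+n_2)$. Assume $\Pr(X_k\in S^\dagger\setminus\{0\})>0$ for $k=1,2$. Subscripts $k$ refer to $F=F_k$, and $\Delta\theta=\theta_1-\theta_2$. For $H_k=W_k^\dagger(\cdot\,;p)$ or $H_k=K_k^\dagger$ let $$\psi_k(x)=\frac{\mathbf 1(x\in S^\dagger)}{\Pr(X_k\in S^\dagger)}\Big(H_k(x)-\int H_k\,dF_k^\dagger\Big),$$ $$\Sigma(H_1,H_2)=(1-\eta_1)\mathrm{Var}[\psi_1(X_1)]+\eta_1\mathrm{Var}[\psi_2(X_2)]-2\sqrt{\eta_1(1-\eta_1)\lambda_1\lambda_2}\,\mathrm{Cov}[\psi_1(X_1),\psi_2(X_2)] .$$ **Claim.** (1) Let $0<p<1$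 and suppose that, for $k=1,2$, $F_k^\dagger$ is differentiable at its $p$-th quantile and this quantile is unique, i.e. $F_k^\dagger(x)>p$ for all $x>Q(p;F_k^\dagger)$. Then $\Sigma(W_1^\dagger(\cdot;p),W_2^\dagger(\cdot;p))\ge 0$ and $$\sqrt N\big(\Delta\hat L^\dagger(p)-\Delta L^\dagger(p)\big)\overset{d}{\longrightarrow}\mathrm N\big(0,\Sigma(W_1^\dagger(\cdot;p),W_2^\dagger(\cdot;p))\big).$$ (2) Suppose that $F_1$ and $F_2$ are continuous, with a possible jump at zero. Then $\Sigma(K_1^\dagger,K_2^\dagger)\ge0$ and $$\sqrt N\big(\Delta\hat I^\dagger-\Delta I^\dagger\big)\overset{d}{\longrightarrow}\mathrm N\big(0,\Sigma(K_1^\dagger,K_2^\dagger)\big).$$ In both parts, if $\Pr(X_1\in S^\dagger)=\Pr(X_2\in S^\dagger)=1$ (always so for $L^s$ and $I^p$; for $\oplus,\ominus$ it says that the samples are drawn from $F_1^\dagger,F_2^\dagger$ themselves), then $$\Sigma(H_1,H_2)=(1-\eta_1)\mathrm{Var}[H_1(X_1)]+\eta_1\mathrm{Var}[H_2(X_2)]-2\sqrt{\eta_1(1-\eta_1)\lambda_1\lambda_2}\,\mathrm{Cov}[H_1(X_1),H_2(X_2)].$$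 -/

import Mathlib

open MeasureTheory ProbabilityTheory Filter Topology

noncomputable section

/-! ### Distributions, quantiles and empirical distributions

A distribution on the line is represented by its probability measure; its distribution function
is `cdf`. -/

/-- The quantile `Q(p; G) = inf {x | G(x) ≥ p}`. -/
def quantile (G : Measure ℝ) (p : ℝ) : ℝ := sInf {x : ℝ | p ≤ cdf G x}

/-- The mean `μ(G)`. -/
def mean (G : Measure ℝ) : ℝ := ∫ x, x ∂G

/-- The absolute mean `μ^p(G)`. -/
def absMean (G : Measure ℝ) : ℝ := ∫ x, |x| ∂G

/-- `∫_0^p Q(u; G) du`. -/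
def cumulQuantile (G : Measure ℝ) (p : ℝ) : ℝ := ∫ u in (0 : ℝ)..p, quantile G u

/-- `E |X - Y|` for independent `X` and `Y` with distribution `G`. -/
def meanAbsDiff (G : Measure ℝ) : ℝ := ∫ z : ℝ × ℝ, |z.1 - z.2| ∂(G.prod G)

/-- The empirical distribution of the sample `x 0, …, x (n - 1)`. -/
def empirical (n : ℕ) (x : ℕ → ℝ) : Measure ℝ :=
  (n : ENNReal)⁻¹ • ∑ i ∈ Finset.range n, Measure.dirac (x i)

/-! ### Extended inequality measures -/

/-- The part of a distribution to which an extended inequality measure refers: the positive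
values, the negative values, or the whole distribution. -/
inductive SignPart where
  | positive
  | negative
  | whole

/-- The values which belong to the given part. -/
def SignPart.region : SignPart → Set ℝ
  | .positive => Set.Ioi 0
  | .negative => Set.Iio 0
  | .whole => Set.univ

/-- The conditional distribution: that of `X` given `X > 0`, that of `X` given `X < 0`, or that
of `X` itself, where `X` has distribution `F`. -/
def SignPart.law (s : SignPart) (F : Measure ℝ) : Measure ℝ := ProbabilityTheory.cond F s.region

/-- The extended Lorenz curves as functionals of the distribution `G = s.law F`: the two
sign-conditional Lorenz curves and the signed Lorenz curve. -/
def extLorenz : SignPart → Measure ℝ → ℝ → ℝ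
  | .positive, G, p => cumulQuantile G p / mean G
  | .negative, G, p => cumulQuantile G p / mean G
  | .whole, G, p => cumulQuantile G p / absMean G

/-- The extended Gini indices as functionals of the distribution `G = s.law F`: the two
sign-conditional Gini indices and the positive Gini index. -/
def extGini : SignPart → Measure ℝ → ℝ
  | .positive, G => meanAbsDiff G / (2 * mean G)
  | .negative, G => meanAbsDiff G / (2 * |mean G|)
  | .whole, G => meanAbsDiff G / (2 * absMean G)

open Classical in
/-- The uncentred influence functions `W` of the extended Lorenz ordinates at `p`. -/
def lorenzW : SignPart → Measure ℝ → ℝ → ℝ → ℝ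
  | .positive, G, p, x =>
      ((x - quantile G p) * (if x ≤ quantile G p then 1 else 0)
        - x * extLorenz .positive G p) / mean G
  | .negative, G, p, x =>
      ((x - quantile G p) * (if x ≤ quantile G p then 1 else 0)
        - x * extLorenz .negative G p) / mean G
  | .whole, G, p, x =>
      ((x - quantile G p) * (if x ≤ quantile G p then 1 else 0)
        - |x| * extLorenz .whole G p) / absMean G

/-- The uncentred influence functions `K` of the extended Gini indices. -/
def giniK : SignPart → Measure ℝ → ℝ → ℝ
  | .positive, G, x =>
      (2 * x * cdf G x - 2 * (∫ t in Set.Iic x, t ∂G)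
        - (extGini .positive G + 1) * x) / mean G
  | .negative, G, x =>
      (2 * x * cdf G x - 2 * (∫ t in Set.Iic x, t ∂G)
        + (extGini .negative G - 1) * x) / |mean G|
  | .whole, G, x =>
      (2 * x * cdf G x - 2 * (∫ t in Set.Iic x, t ∂G)
        - extGini .whole G * |x| - x) / absMean G

/-- If `h` is the uncentred influence function of a functional at `s.law F`, this is the influence
function, at `F`, of the functional that is composed with conditioning on the part `s`: the
function `h`, centred under `s.law F`, times `1(x ∈ s) / F(s)`. For the whole distribution it is
just `h - E h`. -/
def fullInfluence (s : SignPart) (F : Measure ℝ) (h : ℝ → ℝ) (x : ℝ) : ℝ :=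
  s.region.indicator (fun _ => (F.real s.region)⁻¹) x * (h x - ∫ t, h t ∂(s.law F))

/-! ### Overlapping samples -/

/-- Two overlapping samples `X₁ 0, …, X₁ (n₁ - 1)` and `X₂ 0, …, X₂ (n₂ - 1)`, whose first `m`
observations are matched pairs with joint distribution `F`. The overlap is the only source of
dependence: the unmatched observations of one sample are independent of all the others. -/
structure IsOverlappingSample {Ω : Type*} [MeasurableSpace Ω] (P : Measure Ω)
    (F : Measure (ℝ × ℝ)) (n₁ n₂ m : ℕ) (X₁ X₂ : ℕ → Ω → ℝ) : Prop where
  measurable₁ : ∀ i, Measurable (X₁ i)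
  measurable₂ : ∀ i, Measurable (X₂ i)
  overlap_le₁ : m ≤ n₁
  overlap_le₂ : m ≤ n₂
  pairs_law : ∀ i < m, P.map (fun ω => (X₁ i ω, X₂ i ω)) = F
  pairs_indep : iIndepFun (fun (i : Fin m) ω => (X₁ i ω, X₂ i ω)) P
  law₁ : ∀ i < n₁, P.map (X₁ i) = F.fst
  law₂ : ∀ i < n₂, P.map (X₂ i) = F.snd
  unmatched_indep₁ : iIndepFun (fun (i : Finset.Ico m n₁) => X₁ i) P
  unmatched_indep₂ : iIndepFun (fun (i : Finset.Ico m n₂) => X₂ i) P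
  unmatched₁_indep_rest : IndepFun (fun ω (i : Finset.Ico m n₁) => X₁ i ω)
    (fun ω => ((fun i : Fin m => X₁ i ω), (fun i : Fin n₂ => X₂ i ω))) P
  unmatched₂_indep_rest : IndepFun (fun ω (i : Finset.Ico m n₂) => X₂ i ω)
    (fun ω => ((fun i : Fin n₁ => X₁ i ω), (fun i : Fin m => X₂ i ω))) P

/-- `√N` with `N = n₁ n₂ / (n₁ + n₂)`. -/
def rootN (n₁ n₂ : ℕ) : ℝ := Real.sqrt ((n₁ : ℝ) * n₂ / (n₁ + n₂))

/-- The asymptotic variance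
`(1 - η) Var[ψ₁(X₁)] + η Var[ψ₂(X₂)] - 2 √(η (1 - η) l₁ l₂) Cov[ψ₁(X₁), ψ₂(X₂)]`
for a pair `(X₁, X₂)` with joint distribution `F`. -/
def asympVar (F : Measure (ℝ × ℝ)) (η l₁ l₂ : ℝ) (ψ₁ ψ₂ : ℝ → ℝ) : ℝ :=
  (1 - η) * Var[ψ₁; F.fst] + η * Var[ψ₂; F.snd]
    - 2 * Real.sqrt (η * (1 - η) * l₁ * l₂) * cov[fun z => ψ₁ z.1, fun z => ψ₂ z.2; F]

end

/-!
Both estimators are asymptotically linear, that is, up to an error `o(1 / √n)` in probability they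
are sample means of their influence functions (`IsAsymptoticallyLinear`); the theorem then follows
from a central limit theorem for differences of sample means over overlapping samples.

*Conditioning.* A conditional distribution is a restricted measure divided by its total mass, so
that each estimator is a ratio whose numerator and denominator are functionals of the unconditional
empirical distribution. `isAsymptoticallyLinear_of_ratio` linearizes such a ratio: only the
numerator of its error has to be known up to `o(1 / √n)`.

*Lorenz curves.* The cumulated quantile `∫₀ᵖ Q(u; G) du` is the value at `t = Q(p; G)` of
`p t - ∫ (t - x)⁺ dG(x)` (`cumulQuantile_eq`), which is concave in `t` and maximal there. Evaluating
this function of the empirical distribution at the population quantile instead of at the empirical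
one costs at most the integral of the deviation of the empirical distribution function from the
true one over an interval about the population quantile that reaches the empirical one
(`abs_cumulQuantile_sub_le`). The deviation at each point is `O(1 / √n)` in mean, and as the
population quantile is unique the length of the interval may be taken to be arbitrarily small, so
that the cost is `o(1 / √n)` (`tendstoZeroInProb_lorenz_remainder`). What is left is a sample mean.

*Gini indices.* Let `g x` be `x` on the region and `0` off it, and let `π` be the probability of the
region. The mean absolute difference of the conditional distribution, times `π²`, is
`E |g X - g Y| - 2 (1 - π) E |g X|` (`meanAbsDiff_law`). The first term is a quadratic functional of
the distribution, and its second order remainder at the empirical distribution is minus an energy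
distance. The energy distance is nonnegative (`crossAbsDiff_self_add_self_le`), so its `L¹` norm is
its expectation, which is `E |g X - g Y| / n`; hence the remainder is `O(1 / n)`
(`IsSample.integral_abs_energy_remainder`).

*Central limit theorem.* The scaled difference of the sample means splits into the independent sums
over the matched pairs and over the unmatched observations of each sample, so its characteristic
function factorizes. A second order expansion of each factor yields the limit
(`tendstoInDistribution_of_overlapping`), and its variance is a limit of variances, hence
nonnegative.
-/

/-! ### Convergence and boundedness in probability along a sequence of probability spaces -/

/-- Convergence to zero in probability of real functions on varying probability spaces. The
functions are not required to be measurable. -/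
def TendstoZeroInProb {Ω : ℕ → Type*} [∀ r, MeasurableSpace (Ω r)]
    (P : ∀ r, Measure (Ω r)) (Z : ∀ r, Ω r → ℝ) : Prop :=
  ∀ ε : ℝ, 0 < ε → Tendsto (fun r => P r {ω | ε ≤ |Z r ω|}) atTop (𝓝 0)

/-- Boundedness in probability (tightness) of real functions on varying probability spaces. -/
def BoundedInProb {Ω : ℕ → Type*} [∀ r, MeasurableSpace (Ω r)]
    (P : ∀ r, Measure (Ω r)) (Z : ∀ r, Ω r → ℝ) : Prop :=
  ∀ ε : ENNReal, 0 < ε → ∃ C : ℝ, 0 < C ∧ ∀ᶠ r in atTop, P r {ω | C ≤ |Z r ω|} ≤ ε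

section InProbability

variable {Ω : ℕ → Type*} [∀ r, MeasurableSpace (Ω r)] {P : ∀ r, Measure (Ω r)}
  {Y Z : ∀ r, Ω r → ℝ}

/-- It is enough to control the functions outside events of vanishing probability. -/
lemma TendstoZeroInProb.mono_of_event (A : ∀ r, Set (Ω r))
    (hA : Tendsto (fun r => P r (A r)) atTop (𝓝 0)) (hZ : TendstoZeroInProb P Z)
    (h : ∀ᶠ r in atTop, ∀ ω, ω ∉ A r → |Y r ω| ≤ |Z r ω|) : TendstoZeroInProb P Y := by
  intro ε hε
  have h2 := (hZ ε hε).add hA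
  rw [add_zero] at h2
  refine tendsto_of_tendsto_of_tendsto_of_le_of_le' tendsto_const_nhds h2
    (Eventually.of_forall fun _ => zero_le) ?_
  filter_upwards [h] with r hr
  refine (measure_mono fun ω hω => ?_).trans (measure_union_le _ _)
  by_cases hωA : ω ∈ A r
  · exact Or.inr hωA
  · exact Or.inl (le_trans hω (hr ω hωA))

lemma TendstoZeroInProb.mono (hZ : TendstoZeroInProb P Z)
    (h : ∀ᶠ r in atTop, ∀ ω, |Y r ω| ≤ |Z r ω|) : TendstoZeroInProb P Y :=
  hZ.mono_of_event (fun _ => ∅) (by simp) (h.mono fun r hr ω _ => hr ω)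

lemma TendstoZeroInProb.add (hY : TendstoZeroInProb P Y) (hZ : TendstoZeroInProb P Z) :
    TendstoZeroInProb P (fun r ω => Y r ω + Z r ω) := by
  intro ε hε
  have h2 := (hY (ε / 2) (by positivity)).add (hZ (ε / 2) (by positivity))
  rw [add_zero] at h2
  refine tendsto_of_tendsto_of_tendsto_of_le_of_le tendsto_const_nhds h2 (fun _ => zero_le)
    fun r => (measure_mono fun ω hω => ?_).trans (measure_union_le _ _)
  by_contra hc
  simp only [Set.mem_union, Set.mem_ofPred_eq, not_or, not_le] at hc hω
  linarith [abs_add_le (Y r ω) (Z r ω)]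

lemma TendstoZeroInProb.boundedInProb (hZ : TendstoZeroInProb P Z) : BoundedInProb P Z :=
  fun _ hε => ⟨1, one_pos, (hZ 1 one_pos).eventually_le_const hε⟩

lemma BoundedInProb.mul_tendstoZero (hY : BoundedInProb P Y) (hZ : TendstoZeroInProb P Z) :
    TendstoZeroInProb P (fun r ω => Y r ω * Z r ω) := by
  intro ε hε
  rw [ENNReal.tendsto_nhds_zero]
  intro δ hδ
  obtain ⟨C, hC, hev⟩ := hY (δ / 2) (ENNReal.half_pos hδ.ne')
  have hZ' := (hZ (ε / C) (by positivity)).eventually_le_const (ENNReal.half_pos hδ.ne')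
  filter_upwards [hev, hZ'] with r h1 h2
  refine le_trans ((measure_mono fun ω hω => ?_).trans (measure_union_le _ _))
    ((add_le_add h1 h2).trans_eq (ENNReal.add_halves δ))
  by_contra hc
  simp only [Set.mem_union, Set.mem_ofPred_eq, not_or, not_le] at hc hω
  rw [abs_mul] at hω
  have := mul_lt_mul'' hc.1 hc.2 (abs_nonneg _) (abs_nonneg _)
  rw [mul_div_cancel₀ _ hC.ne'] at this
  linarith

lemma BoundedInProb.add (hY : BoundedInProb P Y) (hZ : BoundedInProb P Z) :
    BoundedInProb P (fun r ω => Y r ω + Z r ω) := by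
  intro ε hε
  obtain ⟨C, hC, h1⟩ := hY (ε / 2) (ENNReal.half_pos hε.ne')
  obtain ⟨D, hD, h2⟩ := hZ (ε / 2) (ENNReal.half_pos hε.ne')
  refine ⟨C + D, by positivity, ?_⟩
  filter_upwards [h1, h2] with r h1 h2
  refine le_trans ((measure_mono fun ω hω => ?_).trans (measure_union_le _ _))
    ((add_le_add h1 h2).trans_eq (ENNReal.add_halves ε))
  by_contra hc
  simp only [Set.mem_union, Set.mem_ofPred_eq, not_or, not_le] at hc hω
  linarith [abs_add_le (Y r ω) (Z r ω)]

variable (P) in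
lemma boundedInProb_const [∀ r, IsProbabilityMeasure (P r)] (c : ℝ) :
    BoundedInProb P (fun _ _ => c) := by
  intro ε _
  refine ⟨|c| + 1, by positivity, Eventually.of_forall fun r => ?_⟩
  have : {ω : Ω r | |c| + 1 ≤ |c|} = ∅ := by ext; simp
  rw [this]; simp

lemma TendstoZeroInProb.const_mul [∀ r, IsProbabilityMeasure (P r)]
    (hZ : TendstoZeroInProb P Z) (c : ℝ) : TendstoZeroInProb P (fun r ω => c * Z r ω) :=
  (boundedInProb_const P c).mul_tendstoZero hZ

/-- Convergence to zero in mean implies convergence to zero in probability. -/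
lemma tendstoZeroInProb_of_integral (hZ : ∀ r, Integrable (Z r) (P r)) {c : ℕ → ℝ}
    (hc : Tendsto c atTop (𝓝 0)) (h : ∀ᶠ r in atTop, ∫ ω, |Z r ω| ∂(P r) ≤ c r) :
    TendstoZeroInProb P Z := by
  intro ε hε
  have h2 : Tendsto (fun r => ENNReal.ofReal (c r / ε)) atTop (𝓝 0) := by
    have := ENNReal.tendsto_ofReal (hc.div_const ε)
    simpa using this
  refine tendsto_of_tendsto_of_tendsto_of_le_of_le' tendsto_const_nhds h2
    (Eventually.of_forall fun _ => zero_le) ?_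
  filter_upwards [h] with r hr
  have h3 := meas_ge_le_lintegral_div (μ := P r) (f := fun ω => ENNReal.ofReal |Z r ω|)
    (hZ r).abs.aestronglyMeasurable.aemeasurable.ennreal_ofReal
    (ε := ENNReal.ofReal ε) (by simpa using hε) ENNReal.ofReal_ne_top
  rw [← ofReal_integral_eq_lintegral_ofReal (hZ r).abs (ae_of_all _ fun _ => abs_nonneg _),
    ← ENNReal.ofReal_div_of_pos hε] at h3
  refine (measure_mono fun ω hω => ?_).trans (h3.trans (ENNReal.ofReal_le_ofReal ?_))
  · exact ENNReal.ofReal_le_ofReal hω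
  · gcongr

/-- It is enough to dominate the functions, up to events of vanishing probability, by functions
of arbitrarily small mean. -/
lemma tendstoZeroInProb_of_forall_approx
    (h : ∀ δ : ℝ, 0 < δ → ∃ Y : ∀ r, Ω r → ℝ, (∀ r, Integrable (Y r) (P r)) ∧
      (∀ᶠ r in atTop, ∫ ω, |Y r ω| ∂(P r) ≤ δ) ∧
      Tendsto (fun r => P r {ω | |Y r ω| < |Z r ω|}) atTop (𝓝 0)) :
    TendstoZeroInProb P Z := by
  intro ε hε
  rw [ENNReal.tendsto_nhds_zero]
  intro κ hκ
  obtain ⟨δ, hδ, hδκ⟩ : ∃ δ : ℝ, 0 < δ ∧ ENNReal.ofReal (δ / ε) ≤ κ / 2 := by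
    by_cases ht : κ = ⊤
    · exact ⟨1, one_pos, by rw [ht, ENNReal.top_div_of_ne_top (by simp)]; exact le_top⟩
    · have hκ2 : κ / 2 ≠ ⊤ := (ENNReal.div_lt_top ht (by simp)).ne
      refine ⟨ε * (κ / 2).toReal,
        mul_pos hε (ENNReal.toReal_pos (ENNReal.half_pos hκ.ne').ne' hκ2), ?_⟩
      rw [mul_div_cancel_left₀ _ hε.ne']
      exact ENNReal.ofReal_toReal_le
  obtain ⟨Y, hY, hYδ, hYZ⟩ := h δ hδ
  filter_upwards [hYδ, hYZ.eventually_le_const (ENNReal.half_pos hκ.ne')] with r h1 h2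
  have h3 := meas_ge_le_lintegral_div (μ := P r) (f := fun ω => ENNReal.ofReal |Y r ω|)
    (hY r).abs.aestronglyMeasurable.aemeasurable.ennreal_ofReal
    (ε := ENNReal.ofReal ε) (by simpa using hε) ENNReal.ofReal_ne_top
  rw [← ofReal_integral_eq_lintegral_ofReal (hY r).abs (ae_of_all _ fun _ => abs_nonneg _),
    ← ENNReal.ofReal_div_of_pos hε] at h3
  have h4 : P r {ω | ENNReal.ofReal ε ≤ ENNReal.ofReal |Y r ω|} ≤ κ / 2 :=
    h3.trans ((ENNReal.ofReal_le_ofReal (by gcongr)).trans hδκ)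
  refine le_trans ((measure_mono fun ω hω => ?_).trans (measure_union_le _ _))
    ((add_le_add h2 h4).trans_eq (ENNReal.add_halves κ))
  rcases lt_or_ge |Y r ω| |Z r ω| with hlt | hge
  · exact Or.inl hlt
  · exact Or.inr (ENNReal.ofReal_le_ofReal (le_trans hω hge))

/-- Boundedness in mean implies boundedness in probability. -/
lemma boundedInProb_of_integral (hZ : ∀ r, Integrable (Z r) (P r)) {c : ℝ}
    (h : ∀ᶠ r in atTop, ∫ ω, |Z r ω| ∂(P r) ≤ c) : BoundedInProb P Z := by
  intro ε hε
  obtain ⟨δ, hδ, hδε⟩ : ∃ δ : ℝ, 0 < δ ∧ ENNReal.ofReal δ ≤ ε := by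
    by_cases ht : ε = ⊤
    · exact ⟨1, one_pos, ht ▸ le_top⟩
    · exact ⟨ε.toReal, ENNReal.toReal_pos hε.ne' ht, ENNReal.ofReal_toReal_le⟩
  refine ⟨(|c| + 1) / δ, by positivity, ?_⟩
  filter_upwards [h] with r hr
  have hC : 0 < (|c| + 1) / δ := by positivity
  have h3 := meas_ge_le_lintegral_div (μ := P r) (f := fun ω => ENNReal.ofReal |Z r ω|)
    (hZ r).abs.aestronglyMeasurable.aemeasurable.ennreal_ofReal
    (ε := ENNReal.ofReal ((|c| + 1) / δ)) (by simpa using hC) ENNReal.ofReal_ne_top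
  rw [← ofReal_integral_eq_lintegral_ofReal (hZ r).abs (ae_of_all _ fun _ => abs_nonneg _),
    ← ENNReal.ofReal_div_of_pos hC] at h3
  refine (measure_mono fun ω hω => ?_).trans (h3.trans
    (le_trans (ENNReal.ofReal_le_ofReal ?_) hδε))
  · exact ENNReal.ofReal_le_ofReal hω
  · rw [div_le_iff₀ hC, mul_div_cancel₀ _ hδ.ne']
    linarith [le_abs_self c]

lemma TendstoZeroInProb.inv {D : ℝ} (hD : D ≠ 0)
    (h : TendstoZeroInProb P (fun r ω => Z r ω - D)) :
    TendstoZeroInProb P (fun r ω => (Z r ω)⁻¹ - D⁻¹) := by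
  have hD' : 0 < |D| := abs_pos.2 hD
  refine TendstoZeroInProb.mono_of_event (Z := fun r ω => 2 / |D| ^ 2 * (Z r ω - D))
    (fun r => {ω | |D| / 2 ≤ |Z r ω - D|}) (h _ (by positivity)) ?_ ?_
  · intro ε hε
    have := h (ε / (2 / |D| ^ 2)) (by positivity)
    refine this.congr fun r => ?_
    congr 1
    ext ω
    simp only [Set.mem_ofPred_eq]
    rw [abs_mul, abs_of_pos (show 0 < 2 / |D| ^ 2 by positivity), div_le_iff₀' (by positivity)]
  · refine Eventually.of_forall fun r ω hω => ?_
    simp only [Set.mem_ofPred_eq, not_le] at hω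
    have h1 : |D| / 2 ≤ |Z r ω| := by
      have := abs_sub_abs_le_abs_sub D (Z r ω)
      rw [abs_sub_comm] at this
      linarith
    have hZ0 : Z r ω ≠ 0 := by
      intro h0; rw [h0, abs_zero] at h1; linarith
    have h2 : (Z r ω)⁻¹ - D⁻¹ = -(Z r ω - D) / (Z r ω * D) := by
      field_simp; ring
    rw [h2, abs_div, abs_neg, abs_mul, abs_mul, abs_of_pos (show 0 < 2 / |D| ^ 2 by positivity),
      mul_comm, div_eq_mul_inv]
    rw [mul_comm]
    gcongr
    rw [inv_le_comm₀ (by positivity) (by positivity), inv_div]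
    nlinarith

/-- A sequence that converges in probability to a positive constant is positive with probability
tending to one. -/
lemma TendstoZeroInProb.tendsto_measure_nonpos {D : ℝ} (hD : 0 < D)
    (h : TendstoZeroInProb P (fun r ω => Z r ω - D)) :
    Tendsto (fun r => P r {ω | Z r ω ≤ 0}) atTop (𝓝 0) := by
  refine tendsto_of_tendsto_of_tendsto_of_le_of_le tendsto_const_nhds (h D hD)
    (fun _ => zero_le) fun r => measure_mono fun ω hω => ?_
  simp only [Set.mem_ofPred_eq] at hω ⊢
  rw [abs_sub_comm]
  exact le_trans (by linarith) (le_abs_self _)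

lemma TendstoZeroInProb.tendsto_measure_eq_zero {D : ℝ} (hD : D ≠ 0)
    (h : TendstoZeroInProb P (fun r ω => Z r ω - D)) :
    Tendsto (fun r => P r {ω | Z r ω = 0}) atTop (𝓝 0) := by
  refine tendsto_of_tendsto_of_tendsto_of_le_of_le tendsto_const_nhds (h |D| (abs_pos.2 hD))
    (fun _ => zero_le) fun r => measure_mono fun ω hω => ?_
  simp only [Set.mem_ofPred_eq] at hω ⊢
  simp [hω]

end InProbability

/-! ### Second order expansion of characteristic functions -/

/-- Taylor's bound for `exp (i y)`, which is of third order for small `y` and of second order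
otherwise, so that second moments are enough to integrate it. -/
lemma norm_exp_mul_I_sub_le (y : ℝ) :
    ‖Complex.exp (y * Complex.I) - (1 + y * Complex.I - y ^ 2 / 2)‖ ≤ 4 * (y ^ 2 * min 1 |y|) := by
  rcases le_or_gt |y| 1 with h | h
  · have hn : ‖(y : ℂ) * Complex.I‖ = |y| := by simp
    have h1 := Complex.exp_bound (x := (y : ℂ) * Complex.I) (by rw [hn]; exact h)
      (n := 3) (by norm_num)
    simp only [Finset.sum_range_succ, Finset.sum_range_zero, hn] at h1
    have h2 : (0 : ℂ) + (y * Complex.I) ^ 0 / (Nat.factorial 0 : ℂ)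
        + (y * Complex.I) ^ 1 / (Nat.factorial 1 : ℂ)
        + (y * Complex.I) ^ 2 / (Nat.factorial 2 : ℂ) = 1 + y * Complex.I - y ^ 2 / 2 := by
      rw [mul_pow _ _ 2, Complex.I_sq]; simp; ring
    rw [h2] at h1
    rw [min_eq_right h]
    refine h1.trans ?_
    norm_num [Nat.factorial]
    have : |y| ^ 3 = y ^ 2 * |y| := by rw [pow_succ, sq_abs]
    rw [this]
    nlinarith [mul_nonneg (sq_nonneg y) (abs_nonneg y)]
  · rw [min_eq_left h.le]
    have hy2 : |y| ≤ y ^ 2 := by rw [← sq_abs]; nlinarith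
    have h1 : ‖Complex.exp (y * Complex.I)‖ = 1 := Complex.norm_exp_ofReal_mul_I y
    calc _ ≤ ‖Complex.exp (y * Complex.I)‖ + (‖(1 : ℂ)‖ + ‖(y : ℂ) * Complex.I‖
            + ‖(y : ℂ) ^ 2 / 2‖) := by
          refine (norm_sub_le _ _).trans ?_
          gcongr
          exact (norm_sub_le _ _).trans (by gcongr; exact norm_add_le _ _)
      _ = 1 + (1 + |y| + y ^ 2 / 2) := by simp
      _ ≤ _ := by nlinarith

lemma abs_exp_neg_sub_le {x : ℝ} (hx : 0 ≤ x) : |Real.exp (-x) - (1 - x)| ≤ x ^ 2 := by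
  rcases le_or_gt x 1 with h | h
  · have := Real.abs_exp_sub_one_sub_id_le (x := -x) (by rwa [abs_neg, abs_of_nonneg hx])
    rw [neg_sq] at this
    convert! this using 2
    ring
  · rw [abs_of_nonneg (by linarith [Real.exp_pos (-x)])]
    nlinarith [Real.exp_le_one_iff.2 (neg_nonpos.2 hx)]

section Expansion

variable {E : Type*} [MeasurableSpace E] {μ : Measure E} [IsProbabilityMeasure μ] {f g : E → ℝ}

/-- For centred square integrable `f` and `g` the characteristic function of `(f, g)` differs from
the Gaussian one with the same covariance by `o(u² + v²)`, uniformly in the direction. -/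
lemma exists_charFun_expansion (hf : MemLp f 2 μ) (hg : MemLp g 2 μ)
    (hf0 : ∫ z, f z ∂μ = 0) (hg0 : ∫ z, g z ∂μ = 0) :
    ∃ δ : ℝ → ℝ, Tendsto δ (𝓝 0) (𝓝 0) ∧ ∀ a u v : ℝ, |u| ≤ a → |v| ≤ a →
      ‖(∫ z, Complex.exp ((u * f z + v * g z : ℝ) * Complex.I) ∂μ)
        - Real.exp (-((∫ z, (u * f z + v * g z) ^ 2 ∂μ) / 2))‖ ≤ a ^ 2 * δ a := by
  -- `G` dominates `u f + v g` up to the factor `a`, in every direction `(u, v)`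
  set G : E → ℝ := fun z => |f z| + |g z| with hG
  have hGm : MemLp G 2 μ := hf.abs.add hg.abs
  have hG2 : Integrable (fun z => G z ^ 2) μ := hGm.integrable_sq
  have hG0 : ∀ z, 0 ≤ G z := fun z => by positivity
  set κ := ∫ z, G z ^ 2 ∂μ with hκ
  have hκ0 : 0 ≤ κ := integral_nonneg fun z => by positivity
  have hmeas : ∀ a : ℝ, AEStronglyMeasurable (fun z => G z ^ 2 * min 1 (|a| * G z)) μ := fun a =>
    hG2.aestronglyMeasurable.mul
      (aestronglyMeasurable_const.inf (hGm.aestronglyMeasurable.const_mul _))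
  have hbound : ∀ a z, ‖G z ^ 2 * min 1 (|a| * G z)‖ ≤ G z ^ 2 := fun a z => by
    have h0 : 0 ≤ min 1 (|a| * G z) := le_min zero_le_one (mul_nonneg (abs_nonneg _) (hG0 z))
    rw [Real.norm_of_nonneg (mul_nonneg (sq_nonneg _) h0)]
    exact mul_le_of_le_one_right (sq_nonneg _) (min_le_left _ _)
  refine ⟨fun a => 4 * (∫ z, G z ^ 2 * min 1 (|a| * G z) ∂μ) + a ^ 2 * κ ^ 2, ?_, ?_⟩
  · have h1 : Tendsto (fun a : ℝ => ∫ z, G z ^ 2 * min 1 (|a| * G z) ∂μ) (𝓝 0)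
        (𝓝 (∫ _, (0 : ℝ) ∂μ)) := by
      refine tendsto_integral_filter_of_dominated_convergence (fun z => G z ^ 2)
        (Eventually.of_forall hmeas) (Eventually.of_forall fun a => ae_of_all _ (hbound a)) hG2
        (ae_of_all _ fun z => ?_)
      have : Continuous fun a : ℝ => G z ^ 2 * min 1 (|a| * G z) := by fun_prop
      simpa using this.tendsto 0
    have h2 : Tendsto (fun a : ℝ => a ^ 2 * κ ^ 2) (𝓝 0) (𝓝 0) := by
      have : Continuous fun a : ℝ => a ^ 2 * κ ^ 2 := by fun_prop
      simpa using this.tendsto 0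
    simpa using (h1.const_mul 4).add h2
  · intro a u v hu hv
    have ha : 0 ≤ a := (abs_nonneg u).trans hu
    set y : E → ℝ := fun z => u * f z + v * g z with hy
    have hyG : ∀ z, |y z| ≤ a * G z := fun z => by
      calc |y z| ≤ |u * f z| + |v * g z| := abs_add_le _ _
        _ ≤ a * |f z| + a * |g z| := by rw [abs_mul, abs_mul]; gcongr
        _ = _ := by rw [hG]; ring
    have hyL : MemLp y 2 μ := (hf.const_mul u).add (hg.const_mul v)
    have hyi : Integrable y μ := hyL.integrable one_le_two
    have hy2i : Integrable (fun z => y z ^ 2) μ := hyL.integrable_sq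
    have hy0 : ∫ z, y z ∂μ = 0 := by
      rw [hy, integral_add ((hf.integrable one_le_two).const_mul u)
        ((hg.integrable one_le_two).const_mul v), integral_const_mul, integral_const_mul, hf0, hg0]
      simp
    have hy2 : ∫ z, y z ^ 2 ∂μ ≤ a ^ 2 * κ := by
      rw [hκ, ← integral_const_mul]
      refine integral_mono hy2i (hG2.const_mul _) fun z => ?_
      simp only
      rw [← mul_pow, ← sq_abs (y z)]
      exact pow_le_pow_left₀ (abs_nonneg _) (hyG z) 2
    have hy20 : 0 ≤ ∫ z, y z ^ 2 ∂μ := integral_nonneg fun z => by positivity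
    have hexp : Integrable (fun z => Complex.exp (y z * Complex.I)) μ := by
      refine (integrable_const (1 : ℝ)).mono' ?_
        (ae_of_all _ fun z => (Complex.norm_exp_ofReal_mul_I _).le)
      exact (by fun_prop : Continuous fun x : ℝ => Complex.exp (x * Complex.I))
        |>.comp_aestronglyMeasurable hyL.aestronglyMeasurable
    have hpoly : Integrable (fun z => 1 + (y z : ℂ) * Complex.I - (y z : ℂ) ^ 2 / 2) μ := by
      refine ((integrable_const _).add (hyi.ofReal.mul_const _)).sub ?_
      have : Integrable (fun z => ((y z ^ 2 : ℝ) : ℂ) / 2) μ := hy2i.ofReal.div_const 2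
      simpa using this
    have hpolyI : ∫ z, (1 + (y z : ℂ) * Complex.I - (y z : ℂ) ^ 2 / 2) ∂μ
        = ((1 - (∫ z, y z ^ 2 ∂μ) / 2 : ℝ) : ℂ) := by
      have e1 : Integrable (fun z => (y z : ℂ) * Complex.I) μ := hyi.ofReal.mul_const _
      have e2 : Integrable (fun z => (y z : ℂ) ^ 2 / 2) μ := by
        have : Integrable (fun z => ((y z ^ 2 : ℝ) : ℂ) / 2) μ := hy2i.ofReal.div_const 2
        simpa using this
      have e3 : Integrable (fun z => 1 + (y z : ℂ) * Complex.I) μ := (integrable_const _).add e1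
      rw [integral_sub e3 e2, integral_add (integrable_const _) e1,
        integral_mul_const, integral_div, integral_complex_ofReal, hy0]
      have : ∫ z, (y z : ℂ) ^ 2 ∂μ = ((∫ z, y z ^ 2 ∂μ : ℝ) : ℂ) := by
        rw [← integral_complex_ofReal]; simp
      rw [this]
      simp
    have hmain : ‖(∫ z, Complex.exp (y z * Complex.I) ∂μ)
        - ((1 - (∫ z, y z ^ 2 ∂μ) / 2 : ℝ) : ℂ)‖
        ≤ a ^ 2 * (4 * ∫ z, G z ^ 2 * min 1 (|a| * G z) ∂μ) := by
      rw [← hpolyI, ← integral_sub hexp hpoly, ← integral_const_mul, ← integral_const_mul]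
      refine norm_integral_le_of_norm_le
        ((((hG2.mono' (hmeas a) (ae_of_all _ (hbound a))).const_mul 4).const_mul _))
        (ae_of_all _ fun z => (norm_exp_mul_I_sub_le (y z)).trans ?_)
      have h1 : y z ^ 2 ≤ (a * G z) ^ 2 := by
        rw [← sq_abs (y z)]; exact pow_le_pow_left₀ (abs_nonneg _) (hyG z) 2
      have h2 : min 1 |y z| ≤ min 1 (|a| * G z) :=
        min_le_min_left _ ((hyG z).trans_eq (by rw [abs_of_nonneg ha]))
      calc 4 * (y z ^ 2 * min 1 |y z|) ≤ 4 * ((a * G z) ^ 2 * min 1 (|a| * G z)) := by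
            gcongr
        _ = _ := by ring
    have hsnd := abs_exp_neg_sub_le (x := (∫ z, y z ^ 2 ∂μ) / 2) (by positivity)
    have hsnd' : ((∫ z, y z ^ 2 ∂μ) / 2) ^ 2 ≤ a ^ 2 * (a ^ 2 * κ ^ 2) := by
      have : (∫ z, y z ^ 2 ∂μ) / 2 ≤ a ^ 2 * κ := by linarith
      calc _ ≤ (a ^ 2 * κ) ^ 2 := pow_le_pow_left₀ (by positivity) this 2
        _ = _ := by ring
    calc _ ≤ ‖(∫ z, Complex.exp (y z * Complex.I) ∂μ)
          - ((1 - (∫ z, y z ^ 2 ∂μ) / 2 : ℝ) : ℂ)‖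
          + ‖((1 - (∫ z, y z ^ 2 ∂μ) / 2 : ℝ) : ℂ)
            - Real.exp (-((∫ z, y z ^ 2 ∂μ) / 2))‖ := norm_sub_le_norm_sub_add_norm_sub _ _ _
      _ ≤ a ^ 2 * (4 * ∫ z, G z ^ 2 * min 1 (|a| * G z) ∂μ) + a ^ 2 * (a ^ 2 * κ ^ 2) := by
          refine add_le_add hmain ?_
          rw [← Complex.ofReal_sub, Complex.norm_real, Real.norm_eq_abs, abs_sub_comm]
          exact hsnd.trans hsnd'
      _ = _ := by ring

lemma norm_integral_exp_mul_I_le_one (y : E → ℝ) :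
    ‖∫ z, Complex.exp (y z * Complex.I) ∂μ‖ ≤ 1 := by
  refine (norm_integral_le_integral_norm _).trans ?_
  simp [Complex.norm_exp_ofReal_mul_I]

end Expansion

lemma norm_mul_sub_mul_le_of_norm_le_one {a b c d : ℂ} (ha : ‖a‖ ≤ 1) (hd : ‖d‖ ≤ 1) :
    ‖a * b - c * d‖ ≤ ‖a - c‖ + ‖b - d‖ := by
  have : a * b - c * d = a * (b - d) + (a - c) * d := by ring
  rw [this]
  refine (norm_add_le _ _).trans ?_
  rw [norm_mul, norm_mul]
  nlinarith [norm_nonneg (b - d), norm_nonneg (a - c)]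

lemma norm_pow_sub_pow_le_of_norm_le_one {a c : ℂ} (ha : ‖a‖ ≤ 1) (hc : ‖c‖ ≤ 1) (n : ℕ) :
    ‖a ^ n - c ^ n‖ ≤ n * ‖a - c‖ := by
  induction n with
  | zero => simp
  | succ n ih =>
    rw [pow_succ', pow_succ']
    refine (norm_mul_sub_mul_le_of_norm_le_one ha ?_).trans ?_
    · rw [norm_pow]; exact pow_le_one₀ (norm_nonneg _) hc
    · push_cast; linarith

/-! ### Structure of overlapping samples -/

section Overlap

variable {Ω : Type*} [MeasurableSpace Ω] {P : Measure Ω} {F : Measure (ℝ × ℝ)}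
  {n₁ n₂ m : ℕ} {X₁ X₂ : ℕ → Ω → ℝ}

/-- The characteristic function of a sum over two overlapping samples factors into those of the
matched pairs and of the unmatched observations of each sample. -/
lemma IsOverlappingSample.integral_exp_sum [IsProbabilityMeasure P]
    (h : IsOverlappingSample P F n₁ n₂ m X₁ X₂) {f g : ℝ → ℝ} (hf : Measurable f)
    (hg : Measurable g) :
    ∫ ω, Complex.exp ((∑ i ∈ Finset.range n₁, f (X₁ i ω) + ∑ i ∈ Finset.range n₂, g (X₂ i ω) : ℝ)
        * Complex.I) ∂P
      = (∫ z, Complex.exp ((f z.1 + g z.2 : ℝ) * Complex.I) ∂F) ^ m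
        * (∫ z, Complex.exp ((f z.1 : ℝ) * Complex.I) ∂F) ^ (n₁ - m)
        * (∫ z, Complex.exp ((g z.2 : ℝ) * Complex.I) ∂F) ^ (n₂ - m) := by
  have hX₁ := h.measurable₁
  have hX₂ := h.measurable₂
  -- the three independent blocks
  set A : Ω → ℝ := fun ω => ∑ i : Fin m, (f (X₁ i ω) + g (X₂ i ω)) with hA
  set B : Ω → ℝ := fun ω => ∑ i : Finset.Ico m n₁, f (X₁ i ω) with hB
  set C : Ω → ℝ := fun ω => ∑ i : Finset.Ico m n₂, g (X₂ i ω) with hC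
  have hAm : Measurable A := by fun_prop
  have hBm : Measurable B := by fun_prop
  have hCm : Measurable C := by fun_prop
  have hexp : ∀ T : Ω → ℝ, Measurable T →
      ∫ ω, Complex.exp ((T ω : ℝ) * Complex.I) ∂P = charFun (P.map T) 1 := fun T hT => by
    rw [charFun_apply_real, integral_map hT.aemeasurable (by fun_prop)]
    simp
  have hsplit : ∀ ω, ∑ i ∈ Finset.range n₁, f (X₁ i ω) + ∑ i ∈ Finset.range n₂, g (X₂ i ω)
      = B ω + (C ω + A ω) := fun ω => by
    simp only [hA, hB, hC]
    rw [Finset.sum_add_distrib, ← Finset.sum_range (fun i => f (X₁ i ω)),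
      ← Finset.sum_range (fun i => g (X₂ i ω)),
      Finset.sum_coe_sort (Finset.Ico m n₁) (fun i => f (X₁ i ω)),
      Finset.sum_coe_sort (Finset.Ico m n₂) (fun i => g (X₂ i ω)),
      ← Finset.sum_range_add_sum_Ico _ h.overlap_le₁,
      ← Finset.sum_range_add_sum_Ico (fun i => g (X₂ i ω)) h.overlap_le₂]
    ring
  have hBCA : IndepFun B (fun ω => C ω + A ω) P := by
    have hC' : ∀ ω, C ω = ∑ i : Fin n₂, if m ≤ (i : ℕ) then g (X₂ i ω) else 0 := fun ω => by
      rw [hC, ← Finset.sum_range (fun i => if m ≤ i then g (X₂ i ω) else 0)]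
      simp only
      rw [Finset.sum_coe_sort (Finset.Ico m n₂) (fun i => g (X₂ i ω)), ← Finset.sum_filter]
      congr 1
      ext i
      simp [and_comm]
    have e1 : B = (fun x : Finset.Ico m n₁ → ℝ => ∑ i, f (x i)) ∘
        (fun ω (i : Finset.Ico m n₁) => X₁ i ω) := rfl
    have e2 : (fun ω => C ω + A ω) = (fun x : (Fin m → ℝ) × (Fin n₂ → ℝ) =>
        (∑ i : Fin n₂, if m ≤ (i : ℕ) then g (x.2 i) else 0)
          + ∑ i : Fin m, (f (x.1 i) + g (x.2 (Fin.castLE h.overlap_le₂ i)))) ∘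
        (fun ω => ((fun i : Fin m => X₁ i ω), (fun i : Fin n₂ => X₂ i ω))) := by
      funext ω
      simp [hC', hA]
    rw [e1, e2]
    refine h.unmatched₁_indep_rest.comp (by fun_prop) (Measurable.add ?_ (by fun_prop))
    refine Finset.measurable_fun_sum _ fun i _ => ?_
    split_ifs <;> fun_prop
  have hCA : IndepFun C A P := by
    have e1 : C = (fun x : Finset.Ico m n₂ → ℝ => ∑ i, g (x i)) ∘
        (fun ω (i : Finset.Ico m n₂) => X₂ i ω) := rfl
    have e2 : A = (fun x : (Fin n₁ → ℝ) × (Fin m → ℝ) =>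
        ∑ i : Fin m, (f (x.1 (Fin.castLE h.overlap_le₁ i)) + g (x.2 i))) ∘
        (fun ω => ((fun i : Fin n₁ => X₁ i ω), (fun i : Fin m => X₂ i ω))) := by
      funext ω
      simp [hA]
    rw [e1, e2]
    exact h.unmatched₂_indep_rest.comp (by fun_prop) (by fun_prop)
  have hcA : charFun (P.map A) 1 = (∫ z, Complex.exp ((f z.1 + g z.2 : ℝ) * Complex.I) ∂F) ^ m := by
    have hind : iIndepFun (fun (i : Fin m) ω => f (X₁ i ω) + g (X₂ i ω)) P :=
      h.pairs_indep.comp (fun _ z => f z.1 + g z.2) (fun _ => by fun_prop)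
    rw [hA, hind.charFun_map_fun_sum_eq_prod (fun i => by fun_prop), Finset.prod_apply,
      Finset.prod_eq_pow_card (b := ∫ z, Complex.exp ((f z.1 + g z.2 : ℝ) * Complex.I) ∂F)]
    · simp
    · intro i _
      rw [← hexp _ (by fun_prop), ← h.pairs_law i i.2, integral_map (by fun_prop) (by fun_prop)]
  have hcB : charFun (P.map B) 1 = (∫ z, Complex.exp ((f z.1 : ℝ) * Complex.I) ∂F) ^ (n₁ - m) := by
    have hind : iIndepFun (fun (i : Finset.Ico m n₁) ω => f (X₁ i ω)) P :=
      h.unmatched_indep₁.comp (fun _ => f) (fun _ => hf)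
    rw [hB, hind.charFun_map_fun_sum_eq_prod (fun i => by fun_prop), Finset.prod_apply,
      Finset.prod_eq_pow_card (b := ∫ z, Complex.exp ((f z.1 : ℝ) * Complex.I) ∂F)]
    · simp
    · intro i _
      rw [← hexp _ (by fun_prop)]
      have := h.law₁ i (Finset.mem_Ico.1 i.2).2
      rw [Measure.fst] at this
      rw [← integral_map (φ := X₁ i) (f := fun x => Complex.exp ((f x : ℝ) * Complex.I))
        (by fun_prop) (by fun_prop), this, integral_map (by fun_prop) (by fun_prop)]
  have hcC : charFun (P.map C) 1 = (∫ z, Complex.exp ((g z.2 : ℝ) * Complex.I) ∂F) ^ (n₂ - m) := by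
    have hind : iIndepFun (fun (i : Finset.Ico m n₂) ω => g (X₂ i ω)) P :=
      h.unmatched_indep₂.comp (fun _ => g) (fun _ => hg)
    rw [hC, hind.charFun_map_fun_sum_eq_prod (fun i => by fun_prop), Finset.prod_apply,
      Finset.prod_eq_pow_card (b := ∫ z, Complex.exp ((g z.2 : ℝ) * Complex.I) ∂F)]
    · simp
    · intro i _
      rw [← hexp _ (by fun_prop)]
      have := h.law₂ i (Finset.mem_Ico.1 i.2).2
      rw [Measure.snd] at this
      rw [← integral_map (φ := X₂ i) (f := fun x => Complex.exp ((g x : ℝ) * Complex.I))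
        (by fun_prop) (by fun_prop), this, integral_map (by fun_prop) (by fun_prop)]
  simp_rw [hsplit]
  rw [hexp (fun ω => B ω + (C ω + A ω)) (by fun_prop),
    hBCA.charFun_map_fun_add_eq_mul hBm.aemeasurable (by fun_prop), Pi.mul_apply,
    hCA.charFun_map_fun_add_eq_mul hCm.aemeasurable hAm.aemeasurable, Pi.mul_apply, hcA, hcB, hcC]
  ring

end Overlap

/-! ### Central limit theorem for overlapping samples -/

section OverlapCLT

lemma rootN_sq_div_left {a b : ℕ} (ha : 0 < a) (hb : 0 < b) :
    (a : ℝ) * (rootN a b / a) ^ 2 = 1 - (a : ℝ) / (a + b) := by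
  have ha' : (0 : ℝ) < a := by exact_mod_cast ha
  have hb' : (0 : ℝ) < b := by exact_mod_cast hb
  rw [div_pow, rootN, Real.sq_sqrt (by positivity)]
  field_simp
  ring

lemma rootN_sq_div_right {a b : ℕ} (ha : 0 < a) (hb : 0 < b) :
    (b : ℝ) * (rootN a b / b) ^ 2 = (a : ℝ) / (a + b) := by
  have ha' : (0 : ℝ) < a := by exact_mod_cast ha
  have hb' : (0 : ℝ) < b := by exact_mod_cast hb
  rw [div_pow, rootN, Real.sq_sqrt (by positivity)]
  field_simp

lemma rootN_div_mul_rootN_div {a b : ℕ} (k : ℕ) (ha : 0 < a) (hb : 0 < b) :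
    (k : ℝ) * ((rootN a b / a) * (rootN a b / b))
      = Real.sqrt (a / (a + b) * (1 - a / (a + b)) * (k / a) * (k / b)) := by
  have ha' : (0 : ℝ) < a := by exact_mod_cast ha
  have hb' : (0 : ℝ) < b := by exact_mod_cast hb
  have h1 : (k : ℝ) * ((rootN a b / a) * (rootN a b / b)) = k / (a + b) := by
    rw [div_mul_div_comm, ← sq, rootN, Real.sq_sqrt (by positivity)]
    field_simp
  rw [h1, ← Real.sqrt_sq (show (0 : ℝ) ≤ k / (a + b) by positivity)]
  congr 1
  field_simp
  ring

/-- A characteristic function is stable under perturbations that vanish in probability. -/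
lemma TendstoZeroInProb.tendsto_integral_exp_sub {Ω : ℕ → Type*} [∀ r, MeasurableSpace (Ω r)]
    {P : ∀ r, Measure (Ω r)} [∀ r, IsProbabilityMeasure (P r)] {S T : ∀ r, Ω r → ℝ}
    (hS : ∀ r, Measurable (S r)) (hT : ∀ r, Measurable (T r))
    (h : TendstoZeroInProb P (fun r ω => T r ω - S r ω)) :
    Tendsto (fun r => (∫ ω, Complex.exp (T r ω * Complex.I) ∂(P r))
      - ∫ ω, Complex.exp (S r ω * Complex.I) ∂(P r)) atTop (𝓝 0) := by
  have hint : ∀ (r : ℕ) (Z : Ω r → ℝ), Measurable Z →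
      Integrable (fun ω => Complex.exp (Z ω * Complex.I)) (P r) := fun r Z hZ =>
    (integrable_const (1 : ℝ)).mono' (by fun_prop)
      (ae_of_all _ fun z => (Complex.norm_exp_ofReal_mul_I _).le)
  rw [Metric.tendsto_atTop]
  intro ε hε
  have hev := (ENNReal.tendsto_toReal ENNReal.zero_ne_top).comp (h (ε / 3) (by positivity))
  rw [ENNReal.toReal_zero] at hev
  obtain ⟨N, hN⟩ := (Metric.tendsto_atTop.1 hev) (ε / 6) (by positivity)
  refine ⟨N, fun r hr => ?_⟩
  rw [dist_zero_right]
  have hNr := hN r hr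
  rw [Real.dist_0_eq_abs, Function.comp_apply, abs_of_nonneg ENNReal.toReal_nonneg] at hNr
  set B := {ω | ε / 3 ≤ |T r ω - S r ω|} with hB
  have hBm : MeasurableSet B := measurableSet_le measurable_const ((hT r).sub (hS r)).abs
  rw [← integral_sub (hint r _ (hT r)) (hint r _ (hS r))]
  calc _ ≤ ∫ ω, (ε / 3 + B.indicator (fun _ => (2 : ℝ)) ω) ∂(P r) := by
        refine norm_integral_le_of_norm_le
          ((integrable_const _).add ((integrable_const _).indicator hBm)) (ae_of_all _ fun ω => ?_)
        by_cases hω : ω ∈ B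
        · rw [Set.indicator_of_mem hω]
          refine (norm_sub_le _ _).trans ?_
          rw [Complex.norm_exp_ofReal_mul_I, Complex.norm_exp_ofReal_mul_I]
          linarith
        · rw [Set.indicator_of_notMem hω, add_zero]
          have h1 : Complex.exp (T r ω * Complex.I) - Complex.exp (S r ω * Complex.I)
              = Complex.exp (S r ω * Complex.I)
                * (Complex.exp (Complex.I * (T r ω - S r ω : ℝ)) - 1) := by
            rw [mul_sub, ← Complex.exp_add]
            push_cast
            ring_nf
          rw [h1, norm_mul, Complex.norm_exp_ofReal_mul_I, one_mul]
          refine (Real.norm_exp_I_mul_ofReal_sub_one_le).trans ?_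
          exact (not_le.1 hω).le
    _ = ε / 3 + (P r).real B * 2 := by
        rw [integral_add (integrable_const _) ((integrable_const _).indicator hBm),
          integral_indicator_const _ hBm]
        simp
    _ < ε := by
        have : (P r).real B < ε / 6 := hNr
        linarith

variable {Ω : ℕ → Type*} [∀ r, MeasurableSpace (Ω r)]
  {P : ∀ r, Measure (Ω r)} [∀ r, IsProbabilityMeasure (P r)]
  {F : Measure (ℝ × ℝ)} [IsProbabilityMeasure F]
  {n₁ n₂ m : ℕ → ℕ} {X₁ X₂ : ∀ r, ℕ → Ω r → ℝ} {η l₁ l₂ : ℝ} {f g : ℝ → ℝ}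

/-- A statistic of two overlapping samples that is asymptotically a difference of two centred
sample means, scaled by `√N`, is asymptotically normal. -/
theorem tendstoInDistribution_of_overlapping
    (hOS : ∀ r, IsOverlappingSample (P r) F (n₁ r) (n₂ r) (m r) (X₁ r) (X₂ r))
    (hn₁ : Tendsto n₁ atTop atTop) (hn₂ : Tendsto n₂ atTop atTop)
    (hl₁ : Tendsto (fun r => (m r : ℝ) / n₁ r) atTop (𝓝 l₁))
    (hl₂ : Tendsto (fun r => (m r : ℝ) / n₂ r) atTop (𝓝 l₂))
    (hη : Tendsto (fun r => (n₁ r : ℝ) / (n₁ r + n₂ r)) atTop (𝓝 η))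
    (hf : Measurable f) (hg : Measurable g)
    (hf2 : MemLp f 2 F.fst) (hg2 : MemLp g 2 F.snd)
    (hf0 : ∫ x, f x ∂F.fst = 0) (hg0 : ∫ x, g x ∂F.snd = 0)
    {T : ∀ r, Ω r → ℝ} (hT : ∀ r, Measurable (T r))
    (hlin : TendstoZeroInProb P (fun r ω => T r ω - rootN (n₁ r) (n₂ r) *
      ((n₁ r : ℝ)⁻¹ * ∑ i ∈ Finset.range (n₁ r), f (X₁ r i ω)
        - (n₂ r : ℝ)⁻¹ * ∑ i ∈ Finset.range (n₂ r), g (X₂ r i ω)))) :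
    ∃ V : NNReal, (V : ℝ) = asympVar F η l₁ l₂ f g ∧
      TendstoInDistribution T atTop (fun x : ℝ => x) P (gaussianReal 0 V) := by
  have hX₁ := fun r => (hOS r).measurable₁
  have hX₂ := fun r => (hOS r).measurable₂
  -- the two scores on the common space of pairs
  have hmpf : MeasurePreserving Prod.fst F F.fst := ⟨measurable_fst, rfl⟩
  have hmps : MeasurePreserving Prod.snd F F.snd := ⟨measurable_snd, rfl⟩
  have hfF : MemLp (fun z : ℝ × ℝ => f z.1) 2 F := hf2.comp_measurePreserving hmpf
  have hgF : MemLp (fun z : ℝ × ℝ => g z.2) 2 F := hg2.comp_measurePreserving hmps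
  have hf0F : ∫ z, f z.1 ∂F = 0 := by
    rw [← hf0, Measure.fst, integral_map (by fun_prop) (by fun_prop)]
  have hg0F : ∫ z, g z.2 ∂F = 0 := by
    rw [← hg0, Measure.snd, integral_map (by fun_prop) (by fun_prop)]
  set s₁ := ∫ z, f z.1 ^ 2 ∂F with hs₁
  set s₂ := ∫ z, g z.2 ^ 2 ∂F with hs₂
  set c := ∫ z, f z.1 * g z.2 ∂F with hc
  have hvar₁ : Var[f; F.fst] = s₁ := by
    rw [variance_of_integral_eq_zero hf.aemeasurable hf0, Measure.fst,
      integral_map (by fun_prop) (by fun_prop)]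
  have hvar₂ : Var[g; F.snd] = s₂ := by
    rw [variance_of_integral_eq_zero hg.aemeasurable hg0, Measure.snd,
      integral_map (by fun_prop) (by fun_prop)]
  have hcov : cov[fun z : ℝ × ℝ => f z.1, fun z => g z.2; F] = c := by
    rw [covariance_eq_sub hfF hgF, hf0F]
    simp [hc]
  have hq : ∀ u v : ℝ, ∫ z, (u * f z.1 + v * g z.2) ^ 2 ∂F
      = u ^ 2 * s₁ + v ^ 2 * s₂ + 2 * (u * v) * c := fun u v => by
    have i1 : Integrable (fun z : ℝ × ℝ => u ^ 2 * f z.1 ^ 2) F := hfF.integrable_sq.const_mul _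
    have i2 : Integrable (fun z : ℝ × ℝ => v ^ 2 * g z.2 ^ 2) F := hgF.integrable_sq.const_mul _
    have i3 : Integrable (fun z : ℝ × ℝ => 2 * (u * v) * (f z.1 * g z.2)) F :=
      (hfF.integrable_mul hgF).const_mul _
    have i12 : Integrable (fun z : ℝ × ℝ => u ^ 2 * f z.1 ^ 2 + v ^ 2 * g z.2 ^ 2) F := i1.add i2
    rw [hs₁, hs₂, hc, ← integral_const_mul, ← integral_const_mul, ← integral_const_mul,
      ← integral_add i1 i2, ← integral_add i12 i3]
    congr 1
    funext z
    ring
  -- the coefficients of the two samples and their limits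
  set α : ℕ → ℝ := fun r => rootN (n₁ r) (n₂ r) / n₁ r with hα
  set β : ℕ → ℝ := fun r => rootN (n₁ r) (n₂ r) / n₂ r with hβ
  have hpos : ∀ᶠ r in atTop, 0 < n₁ r ∧ 0 < n₂ r :=
    (hn₁.eventually_gt_atTop 0).and (hn₂.eventually_gt_atTop 0)
  have hα2 : Tendsto (fun r => (n₁ r : ℝ) * α r ^ 2) atTop (𝓝 (1 - η)) :=
    (hη.const_sub 1).congr' (hpos.mono fun r h => (rootN_sq_div_left h.1 h.2).symm)
  have hβ2 : Tendsto (fun r => (n₂ r : ℝ) * β r ^ 2) atTop (𝓝 η) :=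
    hη.congr' (hpos.mono fun r h => (rootN_sq_div_right h.1 h.2).symm)
  have hαβ : Tendsto (fun r => (m r : ℝ) * (α r * β r)) atTop
      (𝓝 (Real.sqrt (η * (1 - η) * l₁ * l₂))) :=
    ((((hη.mul (hη.const_sub 1)).mul hl₁).mul hl₂).sqrt).congr'
      (hpos.mono fun r h => (rootN_div_mul_rootN_div (m r) h.1 h.2).symm)
  have hinv : ∀ k : ℕ → ℕ, Tendsto k atTop atTop → Tendsto (fun r => ((k r : ℝ))⁻¹) atTop (𝓝 0) :=
    fun k hk => tendsto_inv_atTop_zero.comp (tendsto_natCast_atTop_atTop.comp hk)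
  have habs : ∀ (k : ℕ → ℕ) (γ : ℕ → ℝ) (L : ℝ), Tendsto k atTop atTop →
      Tendsto (fun r => (k r : ℝ) * γ r ^ 2) atTop (𝓝 L) → Tendsto γ atTop (𝓝 0) := by
    intro k γ L hk hL
    rw [tendsto_zero_iff_abs_tendsto_zero]
    have h1 := ((hL.mul (hinv k hk)).sqrt)
    rw [mul_zero, Real.sqrt_zero] at h1
    refine h1.congr' ((hk.eventually_gt_atTop 0).mono fun r hr => ?_)
    have : (0 : ℝ) < k r := by exact_mod_cast hr
    rw [mul_comm, ← mul_assoc, inv_mul_cancel₀ this.ne', one_mul, Real.sqrt_sq_eq_abs]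
    rfl
  have hα0 : Tendsto α atTop (𝓝 0) := habs _ _ _ hn₁ hα2
  have hβ0 : Tendsto β atTop (𝓝 0) := habs _ _ _ hn₂ hβ2
  -- the variance of the linear statistic
  have hV : Tendsto (fun r => (n₁ r : ℝ) * α r ^ 2 * s₁ + (n₂ r : ℝ) * β r ^ 2 * s₂
      - 2 * ((m r : ℝ) * (α r * β r)) * c) atTop (𝓝 (asympVar F η l₁ l₂ f g)) := by
    rw [asympVar, hvar₁, hvar₂, hcov]
    exact ((hα2.mul_const s₁).add (hβ2.mul_const s₂)).sub ((hαβ.const_mul 2).mul_const c)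
  have hsplit : ∀ r (u v : ℝ), (m r : ℝ) * (u ^ 2 * s₁ + v ^ 2 * s₂ + 2 * (u * v) * c)
      + ((n₁ r - m r : ℕ) : ℝ) * (u ^ 2 * s₁) + ((n₂ r - m r : ℕ) : ℝ) * (v ^ 2 * s₂)
      = n₁ r * u ^ 2 * s₁ + n₂ r * v ^ 2 * s₂ + 2 * (m r * (u * v)) * c := fun r u v => by
    rw [Nat.cast_sub (hOS r).overlap_le₁, Nat.cast_sub (hOS r).overlap_le₂]
    ring
  have hVnn : 0 ≤ asympVar F η l₁ l₂ f g := by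
    refine ge_of_tendsto' hV fun r => ?_
    have h1 := hsplit r (α r) (-β r)
    have h2 : 0 ≤ ∫ z, (α r * f z.1 + -β r * g z.2) ^ 2 ∂F :=
      integral_nonneg fun z => sq_nonneg _
    rw [hq] at h2
    have h3 : 0 ≤ s₁ := integral_nonneg fun z => sq_nonneg _
    have h4 : 0 ≤ s₂ := integral_nonneg fun z => sq_nonneg _
    have h5 : 0 ≤ (m r : ℝ) * (α r ^ 2 * s₁ + (-β r) ^ 2 * s₂ + 2 * (α r * -β r) * c)
      + ((n₁ r - m r : ℕ) : ℝ) * (α r ^ 2 * s₁) + ((n₂ r - m r : ℕ) : ℝ) * ((-β r) ^ 2 * s₂) := by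
      positivity
    rw [h1] at h5
    linarith
  obtain ⟨δ, hδ, hexp⟩ := exists_charFun_expansion hfF hgF hf0F hg0F
  have hδ0 : ∀ γ : ℕ → ℝ, Tendsto γ atTop (𝓝 0) → Tendsto (fun r => |δ (γ r)|) atTop (𝓝 0) :=
    fun γ hγ => by simpa using (hδ.comp hγ).abs
  obtain ⟨V, hVeq⟩ : ∃ V : NNReal, (V : ℝ) = asympVar F η l₁ l₂ f g := ⟨⟨_, hVnn⟩, rfl⟩
  refine ⟨V, hVeq, ⟨fun r => (hT r).aemeasurable, by fun_prop, ?_⟩⟩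
  refine ProbabilityMeasure.tendsto_iff_tendsto_charFun.2 fun t => ?_
  -- the characteristic function of the linear statistic
  have hlinchar : Tendsto (fun r => ∫ ω, Complex.exp ((t * (rootN (n₁ r) (n₂ r) *
      ((n₁ r : ℝ)⁻¹ * ∑ i ∈ Finset.range (n₁ r), f (X₁ r i ω)
        - (n₂ r : ℝ)⁻¹ * ∑ i ∈ Finset.range (n₂ r), g (X₂ r i ω))) : ℝ) * Complex.I) ∂(P r))
      atTop (𝓝 ((Real.exp (-(t ^ 2 * asympVar F η l₁ l₂ f g / 2)) : ℝ) : ℂ)) := by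
    set u : ℕ → ℝ := fun r => t * α r with hu
    set v : ℕ → ℝ := fun r => -(t * β r) with hv
    have hu0 : Tendsto u atTop (𝓝 0) := by simpa using hα0.const_mul t
    have hv0 : Tendsto v atTop (𝓝 0) := by simpa using (hβ0.const_mul t).neg
    set φ : ℝ → ℝ → ℂ := fun u v =>
      ∫ z, Complex.exp ((u * f z.1 + v * g z.2 : ℝ) * Complex.I) ∂F with hφ
    set ρ : ℝ → ℝ → ℂ := fun u v =>
      ((Real.exp (-((u ^ 2 * s₁ + v ^ 2 * s₂ + 2 * (u * v) * c) / 2)) : ℝ) : ℂ) with hρ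
    have hφ1 : ∀ u v, ‖φ u v‖ ≤ 1 := fun u v => norm_integral_exp_mul_I_le_one _
    have hρ1 : ∀ u v, ‖ρ u v‖ ≤ 1 := fun u v => by
      rw [hρ]
      simp only [Complex.norm_real, Real.norm_eq_abs, Real.abs_exp]
      rw [Real.exp_le_one_iff, ← hq]
      have : 0 ≤ ∫ z, (u * f z.1 + v * g z.2) ^ 2 ∂F := integral_nonneg fun z => sq_nonneg _
      linarith
    have hφρ : ∀ a u v : ℝ, |u| ≤ a → |v| ≤ a → ‖φ u v - ρ u v‖ ≤ a ^ 2 * |δ a| := by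
      intro a u v h1 h2
      have := hexp a u v h1 h2
      rw [hq] at this
      exact this.trans (by gcongr; exact le_abs_self _)
    have hfac : ∀ r, ∫ ω, Complex.exp ((t * (rootN (n₁ r) (n₂ r) *
        ((n₁ r : ℝ)⁻¹ * ∑ i ∈ Finset.range (n₁ r), f (X₁ r i ω)
        - (n₂ r : ℝ)⁻¹ * ∑ i ∈ Finset.range (n₂ r), g (X₂ r i ω))) : ℝ) * Complex.I) ∂(P r)
        = φ (u r) (v r) ^ m r * φ (u r) 0 ^ (n₁ r - m r) * φ 0 (v r) ^ (n₂ r - m r) := by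
      intro r
      have h1 := (hOS r).integral_exp_sum (f := fun x => u r * f x) (g := fun x => v r * g x)
        (by fun_prop) (by fun_prop)
      simp only [hφ, zero_mul, add_zero, zero_add]
      rw [← h1]
      congr 1
      funext ω
      congr 3
      rw [← Finset.mul_sum, ← Finset.mul_sum, hu, hv, hα, hβ]
      ring
    have hexpprod : ∀ r, ρ (u r) (v r) ^ m r * ρ (u r) 0 ^ (n₁ r - m r) * ρ 0 (v r) ^ (n₂ r - m r)
        = ((Real.exp (-(t ^ 2 * ((n₁ r : ℝ) * α r ^ 2 * s₁ + (n₂ r : ℝ) * β r ^ 2 * s₂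
          - 2 * ((m r : ℝ) * (α r * β r)) * c) / 2)) : ℝ) : ℂ) := by
      intro r
      simp only [hρ]
      rw [← Complex.ofReal_pow, ← Complex.ofReal_pow, ← Complex.ofReal_pow, ← Complex.ofReal_mul,
        ← Complex.ofReal_mul, ← Real.exp_nat_mul, ← Real.exp_nat_mul, ← Real.exp_nat_mul,
        ← Real.exp_add, ← Real.exp_add]
      congr 2
      have := hsplit r (u r) (v r)
      simp only [hu, hv] at this ⊢
      linear_combination (-1 / 2) * this
    have hgauss : Tendsto (fun r => ρ (u r) (v r) ^ m r * ρ (u r) 0 ^ (n₁ r - m r)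
        * ρ 0 (v r) ^ (n₂ r - m r)) atTop
        (𝓝 ((Real.exp (-(t ^ 2 * asympVar F η l₁ l₂ f g / 2)) : ℝ) : ℂ)) := by
      simp_rw [hexpprod]
      refine (Complex.continuous_ofReal.tendsto _).comp ((Real.continuous_exp.tendsto _).comp ?_)
      exact ((hV.const_mul (t ^ 2)).div_const 2).neg
    have herr : Tendsto (fun r => φ (u r) (v r) ^ m r * φ (u r) 0 ^ (n₁ r - m r)
        * φ 0 (v r) ^ (n₂ r - m r) - ρ (u r) (v r) ^ m r * ρ (u r) 0 ^ (n₁ r - m r)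
        * ρ 0 (v r) ^ (n₂ r - m r)) atTop (𝓝 0) := by
      have hmax : Tendsto (fun r => max |u r| |v r|) atTop (𝓝 0) := by
        simpa using hu0.abs.max hv0.abs
      have hb : Tendsto (fun r => (t ^ 2 * (n₁ r * α r ^ 2) + t ^ 2 * (n₂ r * β r ^ 2))
          * (|δ (max |u r| |v r|)| + |δ (|u r|)| + |δ (|v r|)|)) atTop (𝓝 0) := by
        have h1 := ((hα2.const_mul (t ^ 2)).add (hβ2.const_mul (t ^ 2))).mul
          (((hδ0 _ hmax).add (hδ0 (fun r => |u r|) (by simpa using hu0.abs))).add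
            (hδ0 (fun r => |v r|) (by simpa using hv0.abs)))
        simpa using h1
      refine squeeze_zero_norm (fun r => ?_) hb
      have hm1 : (m r : ℝ) ≤ n₁ r := by exact_mod_cast (hOS r).overlap_le₁
      have hm2 : (m r : ℝ) ≤ n₂ r := by exact_mod_cast (hOS r).overlap_le₂
      have hpow1 : ∀ (z : ℂ) (k : ℕ), ‖z‖ ≤ 1 → ‖z ^ k‖ ≤ 1 := fun z k hz => by
        rw [norm_pow]; exact pow_le_one₀ (norm_nonneg _) hz
      have hu2 : |u r| ^ 2 = t ^ 2 * α r ^ 2 := by rw [sq_abs, hu]; ring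
      have hv2 : |v r| ^ 2 = t ^ 2 * β r ^ 2 := by rw [sq_abs, hv]; ring
      have hmax2 : max |u r| |v r| ^ 2 ≤ t ^ 2 * α r ^ 2 + t ^ 2 * β r ^ 2 := by
        rw [← hu2, ← hv2]
        rcases max_choice |u r| |v r| with h | h <;> rw [h] <;>
          linarith [sq_nonneg |u r|, sq_nonneg |v r|]
      have e1 := (norm_pow_sub_pow_le_of_norm_le_one (hφ1 (u r) (v r)) (hρ1 (u r) (v r))
        (m r)).trans (mul_le_mul_of_nonneg_left
          (hφρ _ (u r) (v r) (le_max_left _ _) (le_max_right _ _)) (Nat.cast_nonneg _))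
      have e2 := (norm_pow_sub_pow_le_of_norm_le_one (hφ1 (u r) 0) (hρ1 (u r) 0)
        (n₁ r - m r)).trans (mul_le_mul_of_nonneg_left
          (hφρ _ (u r) 0 le_rfl (by simp)) (Nat.cast_nonneg _))
      have e3 := (norm_pow_sub_pow_le_of_norm_le_one (hφ1 0 (v r)) (hρ1 0 (v r))
        (n₂ r - m r)).trans (mul_le_mul_of_nonneg_left
          (hφρ _ 0 (v r) (by simp) le_rfl) (Nat.cast_nonneg _))
      have e12 := norm_mul_sub_mul_le_of_norm_le_one (b := φ (u r) 0 ^ (n₁ r - m r))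
        (c := ρ (u r) (v r) ^ m r) (hpow1 _ (m r) (hφ1 (u r) (v r)))
        (hpow1 _ (n₁ r - m r) (hρ1 (u r) 0))
      have e123 := norm_mul_sub_mul_le_of_norm_le_one
        (a := φ (u r) (v r) ^ m r * φ (u r) 0 ^ (n₁ r - m r))
        (b := φ 0 (v r) ^ (n₂ r - m r))
        (c := ρ (u r) (v r) ^ m r * ρ (u r) 0 ^ (n₁ r - m r))
        (by
          rw [norm_mul]
          exact mul_le_one₀ (hpow1 _ _ (hφ1 _ _)) (norm_nonneg _) (hpow1 _ _ (hφ1 _ _)))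
        (hpow1 _ (n₂ r - m r) (hρ1 0 (v r)))
      have b1 : (m r : ℝ) * (max |u r| |v r| ^ 2 * |δ (max |u r| |v r|)|)
          ≤ (t ^ 2 * (n₁ r * α r ^ 2) + t ^ 2 * (n₂ r * β r ^ 2))
            * |δ (max |u r| |v r|)| := by
        rw [← mul_assoc]
        refine mul_le_mul_of_nonneg_right ?_ (abs_nonneg _)
        calc (m r : ℝ) * max |u r| |v r| ^ 2 ≤ m r * (t ^ 2 * α r ^ 2 + t ^ 2 * β r ^ 2) := by
              gcongr
          _ = t ^ 2 * (m r * α r ^ 2) + t ^ 2 * (m r * β r ^ 2) := by ring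
          _ ≤ _ := by gcongr
      have b2 : ((n₁ r - m r : ℕ) : ℝ) * (|u r| ^ 2 * |δ (|u r|)|)
          ≤ (t ^ 2 * (n₁ r * α r ^ 2) + t ^ 2 * (n₂ r * β r ^ 2)) * |δ (|u r|)| := by
        rw [← mul_assoc, hu2]
        refine mul_le_mul_of_nonneg_right ?_ (abs_nonneg _)
        have : ((n₁ r - m r : ℕ) : ℝ) ≤ n₁ r := by exact_mod_cast Nat.sub_le _ _
        calc ((n₁ r - m r : ℕ) : ℝ) * (t ^ 2 * α r ^ 2) ≤ n₁ r * (t ^ 2 * α r ^ 2) := by gcongr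
          _ = t ^ 2 * (n₁ r * α r ^ 2) := by ring
          _ ≤ _ := le_add_of_nonneg_right (by positivity)
      have b3 : ((n₂ r - m r : ℕ) : ℝ) * (|v r| ^ 2 * |δ (|v r|)|)
          ≤ (t ^ 2 * (n₁ r * α r ^ 2) + t ^ 2 * (n₂ r * β r ^ 2)) * |δ (|v r|)| := by
        rw [← mul_assoc, hv2]
        refine mul_le_mul_of_nonneg_right ?_ (abs_nonneg _)
        have : ((n₂ r - m r : ℕ) : ℝ) ≤ n₂ r := by exact_mod_cast Nat.sub_le _ _
        calc ((n₂ r - m r : ℕ) : ℝ) * (t ^ 2 * β r ^ 2) ≤ n₂ r * (t ^ 2 * β r ^ 2) := by gcongr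
          _ = t ^ 2 * (n₂ r * β r ^ 2) := by ring
          _ ≤ _ := le_add_of_nonneg_left (by positivity)
      linarith
    simp_rw [hfac]
    simpa using herr.add hgauss
  have hpert := TendstoZeroInProb.tendsto_integral_exp_sub
    (S := fun r ω => t * (rootN (n₁ r) (n₂ r) *
      ((n₁ r : ℝ)⁻¹ * ∑ i ∈ Finset.range (n₁ r), f (X₁ r i ω)
        - (n₂ r : ℝ)⁻¹ * ∑ i ∈ Finset.range (n₂ r), g (X₂ r i ω))))
    (T := fun r ω => t * T r ω) (fun r => by fun_prop) (fun r => (hT r).const_mul t)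
    ((hlin.const_mul t).mono (Eventually.of_forall fun r ω => by rw [← mul_sub]))
  have hfin := hpert.add hlinchar
  rw [zero_add] at hfin
  have hlim : charFun ((gaussianReal 0 V).map (fun x : ℝ => x)) t
      = ((Real.exp (-(t ^ 2 * asympVar F η l₁ l₂ f g / 2)) : ℝ) : ℂ) := by
    rw [show (fun x : ℝ => x) = id from rfl, Measure.map_id, charFun_gaussianReal, ← hVeq]
    push_cast
    congr 1
    simp
    ring
  refine hlim ▸ hfin.congr fun r => ?_
  rw [sub_add_cancel]
  change _ = charFun ((P r).map (T r)) t
  rw [charFun_apply_real, integral_map (hT r).aemeasurable (by fun_prop)]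
  congr 1
  funext ω
  push_cast
  ring_nf

end OverlapCLT

/-! ### Sample means of one sample -/

/-- The mean of `f` over the sample `x 0, …, x (n - 1)`. -/
noncomputable def sampleMean (n : ℕ) (x : ℕ → ℝ) (f : ℝ → ℝ) : ℝ :=
  (n : ℝ)⁻¹ * ∑ i ∈ Finset.range n, f (x i)

/-- A sample of size `n` with distribution `G`. Pairwise independence is all that the
one-sample expansions need. -/
structure IsSample {Ω : Type*} [MeasurableSpace Ω] (P : Measure Ω) (G : Measure ℝ) (n : ℕ)
    (X : ℕ → Ω → ℝ) : Prop where
  measurable : ∀ i, Measurable (X i)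
  law : ∀ i < n, P.map (X i) = G
  indep : ∀ i < n, ∀ j < n, i ≠ j → IndepFun (X i) (X j) P

section Extract

variable {Ω : Type*} [MeasurableSpace Ω] {P : Measure Ω} {F : Measure (ℝ × ℝ)}
  {n₁ n₂ m : ℕ} {X₁ X₂ : ℕ → Ω → ℝ}

lemma IsOverlappingSample.swap (h : IsOverlappingSample P F n₁ n₂ m X₁ X₂) :
    IsOverlappingSample P (F.map Prod.swap) n₂ n₁ m X₂ X₁ where
  measurable₁ := h.measurable₂
  measurable₂ := h.measurable₁
  overlap_le₁ := h.overlap_le₂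
  overlap_le₂ := h.overlap_le₁
  pairs_law i hi := by
    have h₁ := h.measurable₁
    have h₂ := h.measurable₂
    rw [← h.pairs_law i hi, Measure.map_map (by fun_prop) (by fun_prop)]
    rfl
  pairs_indep := h.pairs_indep.comp (fun _ => Prod.swap) (fun _ => measurable_swap)
  law₁ i hi := by rw [Measure.fst_map_swap]; exact h.law₂ i hi
  law₂ i hi := by rw [Measure.snd_map_swap]; exact h.law₁ i hi
  unmatched_indep₁ := h.unmatched_indep₂
  unmatched_indep₂ := h.unmatched_indep₁
  unmatched₁_indep_rest := h.unmatched₂_indep_rest.comp measurable_id measurable_swap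
  unmatched₂_indep_rest := h.unmatched₁_indep_rest.comp measurable_id measurable_swap

lemma IsOverlappingSample.isSample_fst (h : IsOverlappingSample P F n₁ n₂ m X₁ X₂) :
    IsSample P F.fst n₁ X₁ where
  measurable := h.measurable₁
  law := h.law₁
  indep := by
    have hrest : ∀ i j, m ≤ i → i < n₁ → j < m → IndepFun (X₁ i) (X₁ j) P := by
      intro i j hi hi' hj
      have hφ : Measurable (fun x : Finset.Ico m n₁ → ℝ => x ⟨i, Finset.mem_Ico.2 ⟨hi, hi'⟩⟩) := by
        fun_prop
      have hψ : Measurable (fun x : (Fin m → ℝ) × (Fin n₂ → ℝ) => x.1 ⟨j, hj⟩) := by fun_prop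
      exact h.unmatched₁_indep_rest.comp hφ hψ
    intro i hi j hj hij
    rcases lt_or_ge i m with him | him <;> rcases lt_or_ge j m with hjm | hjm
    · have h1 := h.pairs_indep.indepFun (i := ⟨i, him⟩) (j := ⟨j, hjm⟩) (by simpa using hij)
      exact h1.comp measurable_fst measurable_fst
    · exact (hrest j i hjm hj him).symm
    · exact hrest i j him hi hjm
    · exact h.unmatched_indep₁.indepFun (i := ⟨i, Finset.mem_Ico.2 ⟨him, hi⟩⟩)
        (j := ⟨j, Finset.mem_Ico.2 ⟨hjm, hj⟩⟩) (by simpa using hij)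

lemma IsOverlappingSample.isSample_snd (h : IsOverlappingSample P F n₁ n₂ m X₁ X₂) :
    IsSample P F.snd n₂ X₂ := by
  have := h.swap.isSample_fst
  rwa [Measure.fst_map_swap] at this

end Extract

lemma integral_abs_sub_mean_le {Ω : Type*} [MeasurableSpace Ω] {P : Measure Ω}
    [IsProbabilityMeasure P] {Z : Ω → ℝ} (hZ : MemLp Z 2 P) :
    ∫ ω, |Z ω - ∫ ω, Z ω ∂P| ∂P ≤ Real.sqrt (Var[Z; P]) := by
  have hc : MemLp (fun ω => Z ω - ∫ ω, Z ω ∂P) 2 P := hZ.sub (memLp_const _)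
  refine Real.le_sqrt_of_sq_le ?_
  have h1 := variance_nonneg (fun ω => |Z ω - ∫ ω, Z ω ∂P|) P
  have hca : MemLp (fun ω => |Z ω - ∫ ω, Z ω ∂P|) 2 P := hc.abs
  rw [variance_eq_sub hca] at h1
  rw [variance_eq_integral hZ.aestronglyMeasurable.aemeasurable]
  simp only [Pi.pow_apply, sq_abs] at h1
  linarith

section OneSample

variable {Ω : Type*} [MeasurableSpace Ω] {P : Measure Ω}
  {G : Measure ℝ} {n : ℕ} {X : ℕ → Ω → ℝ} {f : ℝ → ℝ}

lemma IsSample.memLp_comp {p : ENNReal} (h : IsSample P G n X) (hf : MemLp f p G) {i : ℕ}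
    (hi : i < n) : MemLp (fun ω => f (X i ω)) p P :=
  hf.comp_measurePreserving ⟨h.measurable i, h.law i hi⟩

lemma IsSample.integral_comp (h : IsSample P G n X) (hf : Measurable f) {i : ℕ} (hi : i < n) :
    ∫ ω, f (X i ω) ∂P = ∫ x, f x ∂G := by
  rw [← h.law i hi, integral_map (h.measurable i).aemeasurable hf.aestronglyMeasurable]

lemma IsSample.integrable_sampleMean (h : IsSample P G n X) (hf : Integrable f G) :
    Integrable (fun ω => sampleMean n (fun i => X i ω) f) P := by
  refine Integrable.const_mul (integrable_finsetSum _ fun i hi => ?_) _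
  exact memLp_one_iff_integrable.1
    (h.memLp_comp (memLp_one_iff_integrable.2 hf) (Finset.mem_range.1 hi))

/-- The mean of a square integrable `f` over a sample of size `n` deviates from its expectation by
`O(1/√n)` in mean. -/
lemma IsSample.integral_abs_sampleMean_sub_le [IsProbabilityMeasure P] (h : IsSample P G n X)
    (hn : 0 < n) (hf : Measurable f) (hf2 : MemLp f 2 G) :
    ∫ ω, |sampleMean n (fun i => X i ω) f - ∫ x, f x ∂G| ∂P
      ≤ Real.sqrt (∫ x, f x ^ 2 ∂G) / Real.sqrt n := by
  have hn' : (0 : ℝ) < n := by exact_mod_cast hn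
  have hL : ∀ i ∈ Finset.range n, MemLp (fun ω => f (X i ω)) 2 P := fun i hi =>
    h.memLp_comp hf2 (Finset.mem_range.1 hi)
  set Z : Ω → ℝ := ∑ i ∈ Finset.range n, fun ω => f (X i ω) with hZ
  have hZa : ∀ ω, Z ω = ∑ i ∈ Finset.range n, f (X i ω) := fun ω => by simp [hZ]
  have hZL : MemLp Z 2 P := memLp_finsetSum' _ hL
  have hZv : Var[Z; P] ≤ n * ∫ x, f x ^ 2 ∂G := by
    rw [hZ, IndepFun.variance_sum hL]
    · have : ∀ i ∈ Finset.range n, Var[fun ω => f (X i ω); P] ≤ ∫ x, f x ^ 2 ∂G := fun i hi => by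
        refine (variance_le_expectation_sq (hL i hi).aestronglyMeasurable).trans_eq ?_
        exact h.integral_comp (f := fun x => f x ^ 2) (by fun_prop) (Finset.mem_range.1 hi)
      refine (Finset.sum_le_sum this).trans_eq ?_
      simp
    · intro i hi j hj hij
      exact (h.indep i (by simpa using hi) j (by simpa using hj) hij).comp hf hf
  have hZE : ∫ ω, Z ω ∂P = n * ∫ x, f x ∂G := by
    simp_rw [hZa]
    rw [integral_finsetSum _ fun i hi => (hL i hi).integrable one_le_two,
      Finset.sum_congr rfl fun i hi => h.integral_comp hf (Finset.mem_range.1 hi)]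
    simp
  have hZn : ∀ ω, |sampleMean n (fun i => X i ω) f - ∫ x, f x ∂G|
      = (n : ℝ)⁻¹ * |Z ω - ∫ ω, Z ω ∂P| := fun ω => by
    rw [hZE, hZa, sampleMean]
    rw [← abs_of_pos (inv_pos.2 hn'), ← abs_mul, abs_of_pos (inv_pos.2 hn'), mul_sub,
      inv_mul_cancel_left₀ hn'.ne']
  simp_rw [hZn]
  rw [integral_const_mul]
  calc _ ≤ (n : ℝ)⁻¹ * Real.sqrt (n * ∫ x, f x ^ 2 ∂G) := by
        gcongr
        exact (integral_abs_sub_mean_le hZL).trans (Real.sqrt_le_sqrt hZv)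
    _ = _ := by
        rw [Real.sqrt_mul hn'.le, div_eq_mul_inv]
        have : (n : ℝ)⁻¹ * Real.sqrt n = (Real.sqrt n)⁻¹ := by
          rw [inv_mul_eq_div, Real.sqrt_div_self', one_div]
        rw [← mul_assoc, this, mul_comm]

end OneSample

/-! ### Asymptotically linear estimators -/

section Asymptotic

variable {Ω : ℕ → Type*} [∀ r, MeasurableSpace (Ω r)]
  {P : ∀ r, Measure (Ω r)} [∀ r, IsProbabilityMeasure (P r)] {G : Measure ℝ}
  {n : ℕ → ℕ} {X : ∀ r, ℕ → Ω r → ℝ}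

/-- The estimator `E` of `θ` is asymptotically linear with influence function `ψ`: the function `ψ`
is centred and square integrable, and `√n (E - θ - n⁻¹ ∑ ψ(X i)) → 0` in probability. -/
structure IsAsymptoticallyLinear (P : ∀ r, Measure (Ω r)) (G : Measure ℝ) (n : ℕ → ℕ)
    (X : ∀ r, ℕ → Ω r → ℝ) (E : ∀ r, Ω r → ℝ) (θ : ℝ) (ψ : ℝ → ℝ) : Prop where
  measurable : Measurable ψ
  memLp : MemLp ψ 2 G
  integral_eq_zero : ∫ x, ψ x ∂G = 0
  tendstoZero : TendstoZeroInProb P (fun r ω =>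
    Real.sqrt (n r) * (E r ω - θ - sampleMean (n r) (fun i => X r i ω) ψ))

lemma boundedInProb_sampleMean_sub (hS : ∀ r, IsSample (P r) G (n r) (X r))
    (hn : Tendsto n atTop atTop) {f : ℝ → ℝ} (hf : Measurable f) (hf2 : MemLp f 2 G)
    (hf1 : Integrable f G) :
    BoundedInProb P (fun r ω => Real.sqrt (n r) *
      (sampleMean (n r) (fun i => X r i ω) f - ∫ x, f x ∂G)) := by
  refine boundedInProb_of_integral (c := Real.sqrt (∫ x, f x ^ 2 ∂G)) (fun r =>
    (((hS r).integrable_sampleMean hf1).sub (integrable_const _)).const_mul _) ?_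
  filter_upwards [hn.eventually_gt_atTop 0] with r hr
  have h1 := (hS r).integral_abs_sampleMean_sub_le hr hf hf2
  have hs : 0 < Real.sqrt (n r) := Real.sqrt_pos.2 (by exact_mod_cast hr)
  simp_rw [abs_mul, abs_of_pos hs]
  rw [integral_const_mul]
  rw [le_div_iff₀ hs] at h1
  linarith

lemma tendsto_inv_sqrt_natCast (hn : Tendsto n atTop atTop) :
    Tendsto (fun r => (Real.sqrt (n r))⁻¹) atTop (𝓝 0) :=
  tendsto_inv_atTop_zero.comp
    (Real.tendsto_sqrt_atTop.comp (tendsto_natCast_atTop_atTop.comp hn))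

/-- The weak law of large numbers, for square integrable functions. -/
lemma tendstoZeroInProb_sampleMean_sub [IsProbabilityMeasure G]
    (hS : ∀ r, IsSample (P r) G (n r) (X r))
    (hn : Tendsto n atTop atTop) {f : ℝ → ℝ} (hf : Measurable f) (hf2 : MemLp f 2 G) :
    TendstoZeroInProb P (fun r ω => sampleMean (n r) (fun i => X r i ω) f - ∫ x, f x ∂G) := by
  have hf1 := hf2.integrable one_le_two
  refine tendstoZeroInProb_of_integral
    (c := fun r => Real.sqrt (∫ x, f x ^ 2 ∂G) * (Real.sqrt (n r))⁻¹) (fun r =>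
    (((hS r).integrable_sampleMean hf1).sub (integrable_const _))) ?_ ?_
  · simpa using (tendsto_inv_sqrt_natCast hn).const_mul (Real.sqrt (∫ x, f x ^ 2 ∂G))
  · filter_upwards [hn.eventually_gt_atTop 0] with r hr
    simpa [div_eq_mul_inv] using (hS r).integral_abs_sampleMean_sub_le hr hf hf2

/-- A ratio estimator whose error has a numerator that is, up to `o(1/√n)`, the sample mean of a
centred function `u`, and a denominator that converges to `D`, has influence function `u / D`. -/
lemma isAsymptoticallyLinear_of_ratio [IsProbabilityMeasure G]
    (hS : ∀ r, IsSample (P r) G (n r) (X r))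
    (hn : Tendsto n atTop atTop) {u : ℝ → ℝ} (hu : Measurable u) (hu2 : MemLp u 2 G)
    (hu0 : ∫ x, u x ∂G = 0) {D : ℝ} (hD : D ≠ 0) {E Dh R : ∀ r, Ω r → ℝ} {θ : ℝ}
    (hDh : TendstoZeroInProb P (fun r ω => Dh r ω - D))
    (hR : TendstoZeroInProb P (fun r ω => Real.sqrt (n r) * R r ω))
    (h : ∀ᶠ r in atTop, ∀ ω, Dh r ω ≠ 0 →
      E r ω - θ = (sampleMean (n r) (fun i => X r i ω) u + R r ω) / Dh r ω) :
    IsAsymptoticallyLinear P G n X E θ (fun x => u x / D) := by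
  have hinv := hDh.inv hD
  have hinvb : BoundedInProb P (fun r ω => (Dh r ω)⁻¹) := by
    have := hinv.boundedInProb.add (boundedInProb_const P D⁻¹)
    simpa using this
  have hb := boundedInProb_sampleMean_sub hS hn hu hu2 (hu2.integrable one_le_two)
  simp only [hu0, sub_zero] at hb
  have hψ2 : MemLp (fun x => u x / D) 2 G := by
    simpa only [div_eq_mul_inv] using hu2.mul_const D⁻¹
  refine ⟨hu.div_const D, hψ2, by rw [integral_div, hu0, zero_div], ?_⟩
  refine ((hb.mul_tendstoZero hinv).add (hinvb.mul_tendstoZero hR)).mono_of_event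
    (fun r => {ω | Dh r ω = 0}) (hDh.tendsto_measure_eq_zero hD) ?_
  filter_upwards [h] with r hr ω hω
  rw [hr ω hω]
  have : sampleMean (n r) (fun i => X r i ω) (fun x => u x / D)
      = sampleMean (n r) (fun i => X r i ω) u / D := by
    rw [sampleMean, sampleMean, ← Finset.sum_div, mul_div_assoc]
  rw [this]
  refine le_of_eq (congrArg _ ?_)
  ring

end Asymptotic

/-! ### Conditional and empirical distributions -/

lemma SignPart.measurableSet_region (s : SignPart) : MeasurableSet s.region := by
  cases s
  · exact measurableSet_Ioi
  · exact measurableSet_Iio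
  · exact MeasurableSet.univ

lemma SignPart.integral_law (s : SignPart) (μ : Measure ℝ) (f : ℝ → ℝ) :
    ∫ x, f x ∂(s.law μ) = (μ.real s.region)⁻¹ * ∫ x in s.region, f x ∂μ := by
  rw [SignPart.law, ProbabilityTheory.cond, integral_smul_measure, smul_eq_mul,
    ENNReal.toReal_inv, measureReal_def]

lemma SignPart.isProbabilityMeasure_law (s : SignPart) (μ : Measure ℝ) [IsFiniteMeasure μ]
    (h : μ.real s.region ≠ 0) : IsProbabilityMeasure (s.law μ) :=
  cond_isProbabilityMeasure fun h0 => h (by rw [measureReal_def, h0, ENNReal.toReal_zero])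

lemma SignPart.law_eq_zero (s : SignPart) (μ : Measure ℝ) [IsFiniteMeasure μ]
    (h : μ.real s.region = 0) : s.law μ = 0 :=
  cond_eq_zero_of_meas_eq_zero ((measureReal_eq_zero_iff).1 h)

lemma SignPart.integrable_law (s : SignPart) {μ : Measure ℝ} {f : ℝ → ℝ} (hf : Integrable f μ)
    (h : μ.real s.region ≠ 0) : Integrable f (s.law μ) := by
  refine hf.restrict.smul_measure (ENNReal.inv_ne_top.2 fun h0 => h ?_)
  rw [measureReal_def, h0, ENNReal.toReal_zero]

lemma isProbabilityMeasure_empirical {n : ℕ} (hn : 0 < n) (x : ℕ → ℝ) :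
    IsProbabilityMeasure (empirical n x) := by
  refine ⟨?_⟩
  rw [empirical, Measure.smul_apply, Measure.finsetSum_apply]
  simp only [measure_univ, Finset.sum_const, Finset.card_range, smul_eq_mul, nsmul_eq_mul, mul_one]
  exact ENNReal.inv_mul_cancel (by exact_mod_cast hn.ne') (ENNReal.natCast_ne_top n)

lemma integrable_empirical (n : ℕ) (x : ℕ → ℝ) (f : ℝ → ℝ) : Integrable f (empirical n x) := by
  rcases n.eq_zero_or_pos with rfl | hn
  · simp [empirical]
  · refine Integrable.smul_measure ?_ (ENNReal.inv_ne_top.2 (by exact_mod_cast hn.ne'))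
    exact integrable_finsetSum_measure.2 fun i _ => integrable_dirac (by simp)

lemma integral_empirical (n : ℕ) (x : ℕ → ℝ) (f : ℝ → ℝ) :
    ∫ t, f t ∂(empirical n x) = sampleMean n x f := by
  rw [empirical, integral_smul_measure,
    integral_finsetSum_measure fun i _ => integrable_dirac (by simp)]
  simp [sampleMean]

instance isFiniteMeasure_empirical (n : ℕ) (x : ℕ → ℝ) : IsFiniteMeasure (empirical n x) := by
  rcases n.eq_zero_or_pos with rfl | hn
  · simp only [empirical, Finset.range_zero, Finset.sum_empty, smul_zero]
    infer_instance
  · have := isProbabilityMeasure_empirical hn x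
    infer_instance

lemma setIntegral_empirical (n : ℕ) (x : ℕ → ℝ) (f : ℝ → ℝ) {S : Set ℝ} (hS : MeasurableSet S) :
    ∫ t in S, f t ∂(empirical n x) = sampleMean n x (S.indicator f) := by
  rw [← integral_indicator hS, integral_empirical]

lemma empirical_real_apply (n : ℕ) (x : ℕ → ℝ) {S : Set ℝ} (hS : MeasurableSet S) :
    (empirical n x).real S = sampleMean n x (S.indicator 1) := by
  rw [← integral_empirical, integral_indicator_one hS]

lemma SignPart.mul_integral_law (s : SignPart) {μ : Measure ℝ} [IsFiniteMeasure μ] (f : ℝ → ℝ) :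
    μ.real s.region * ∫ x, f x ∂(s.law μ) = ∫ x in s.region, f x ∂μ := by
  rw [s.integral_law]
  rcases eq_or_ne (μ.real s.region) 0 with h | h
  · rw [h, Measure.restrict_eq_zero.2 ((measureReal_eq_zero_iff).1 h)]
    simp
  · rw [mul_inv_cancel_left₀ h]

lemma cdf_eq_integral (ν : Measure ℝ) [IsProbabilityMeasure ν] (t : ℝ) :
    cdf ν t = ∫ x, (Set.Iic t).indicator 1 x ∂ν := by
  rw [cdf_eq_real, integral_indicator_one measurableSet_Iic]

/-! ### Quantiles -/

section Quantile

variable {ν : Measure ℝ} {p : ℝ}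

lemma quantile_set_nonempty (hp1 : p < 1) : {x : ℝ | p ≤ cdf ν x}.Nonempty :=
  ((tendsto_cdf_atTop ν).eventually_const_le hp1).exists

lemma quantile_set_bddBelow (hp0 : 0 < p) : BddBelow {x : ℝ | p ≤ cdf ν x} := by
  obtain ⟨a, ha⟩ := ((tendsto_cdf_atBot ν).eventually_lt_const hp0).exists
  refine ⟨a, fun x hx => ?_⟩
  by_contra hxa
  exact absurd ((show p ≤ cdf ν x from hx).trans (monotone_cdf ν (not_le.1 hxa).le)) (not_le.2 ha)

/-- The quantile function is the lower adjoint of the distribution function. -/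
lemma quantile_le_iff (hp0 : 0 < p) (hp1 : p < 1) (x : ℝ) : quantile ν p ≤ x ↔ p ≤ cdf ν x := by
  refine ⟨fun h => ?_, fun h => csInf_le (quantile_set_bddBelow hp0) h⟩
  have hright : Tendsto (cdf ν) (𝓝[>] x) (𝓝 (cdf ν x)) :=
    ((cdf ν).right_continuous x).mono Set.Ioi_subset_Ici_self
  refine ge_of_tendsto hright ?_
  filter_upwards [self_mem_nhdsWithin] with y hy
  obtain ⟨z, hz, hzy⟩ := exists_lt_of_csInf_lt (quantile_set_nonempty hp1) (lt_of_le_of_lt h hy)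
  exact (show p ≤ cdf ν z from hz).trans (monotone_cdf ν hzy.le)

lemma lt_quantile_iff (hp0 : 0 < p) (hp1 : p < 1) (x : ℝ) : x < quantile ν p ↔ cdf ν x < p := by
  rw [← not_le, quantile_le_iff hp0 hp1, not_le]

lemma monotoneOn_quantile : MonotoneOn (quantile ν) (Set.Ioo 0 1) := fun _ hu _ hv huv =>
  (quantile_le_iff hu.1 hu.2 _).2 (huv.trans ((quantile_le_iff hv.1 hv.2 _).1 le_rfl))

lemma aemeasurable_quantile :
    AEMeasurable (quantile ν) (volume.restrict (Set.Ioo (0 : ℝ) 1)) :=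
  aemeasurable_restrict_of_monotoneOn measurableSet_Ioo monotoneOn_quantile

/-- The quantile transform: `Q(U)` has distribution `ν` if `U` is uniform on `(0, 1)`. -/
lemma map_quantile (ν : Measure ℝ) [IsProbabilityMeasure ν] :
    (volume.restrict (Set.Ioo (0 : ℝ) 1)).map (quantile ν) = ν := by
  have : IsFiniteMeasure ((volume.restrict (Set.Ioo (0 : ℝ) 1)).map (quantile ν)) := by
    infer_instance
  refine Measure.ext_of_Iic _ _ fun x => ?_
  rw [Measure.map_apply_of_aemeasurable aemeasurable_quantile measurableSet_Iic,
    Measure.restrict_apply₀' measurableSet_Ioo.nullMeasurableSet, ← ofReal_cdf ν x]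
  have h0 := cdf_nonneg ν x
  have h1 := cdf_le_one ν x
  have hset : quantile ν ⁻¹' Set.Iic x ∩ Set.Ioo 0 1 = Set.Ioc 0 (cdf ν x) ∩ Set.Ioo 0 1 := by
    ext u
    simp only [Set.mem_inter_iff, Set.mem_preimage, Set.mem_Iic, Set.mem_Ioo, Set.mem_Ioc]
    constructor
    · rintro ⟨hq, hu⟩
      exact ⟨⟨hu.1, (quantile_le_iff hu.1 hu.2 x).1 hq⟩, hu⟩
    · rintro ⟨hq, hu⟩
      exact ⟨(quantile_le_iff hu.1 hu.2 x).2 hq.2, hu⟩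
  rw [hset]
  refine le_antisymm ((measure_mono Set.inter_subset_left).trans_eq (by simp)) ?_
  have hsub : Set.Ioo 0 (cdf ν x) ⊆ Set.Ioc 0 (cdf ν x) ∩ Set.Ioo 0 1 := fun u hu =>
    ⟨⟨hu.1, hu.2.le⟩, hu.1, hu.2.trans_le h1⟩
  exact (by simp : ENNReal.ofReal (cdf ν x) = volume (Set.Ioo 0 (cdf ν x))).trans_le
    (measure_mono hsub)

/-- The area under the quantile function up to `p` in terms of the expected shortfall below the
`p`-th quantile. -/
lemma cumulQuantile_eq [IsProbabilityMeasure ν] (hν : Integrable (fun x : ℝ => x) ν)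
    (hp0 : 0 < p) (hp1 : p < 1) :
    cumulQuantile ν p = p * quantile ν p - ∫ x, max (quantile ν p - x) 0 ∂ν := by
  set q := quantile ν p with hq
  have hmaxi : Integrable (fun x => max (q - x) 0) ν := ((integrable_const q).sub hν).pos_part
  have hmap := map_quantile ν
  have haem := aemeasurable_quantile (ν := ν)
  have h1 : ∫ x, max (q - x) 0 ∂ν = ∫ u in Set.Ioo (0 : ℝ) 1, max (q - quantile ν u) 0 := by
    conv_lhs => rw [← hmap]
    rw [integral_map haem (by fun_prop)]
  have hi : IntegrableOn (fun u => max (q - quantile ν u) 0) (Set.Ioo (0 : ℝ) 1) := by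
    rw [← hmap] at hmaxi
    exact hmaxi.comp_aemeasurable haem
  have hle : ∀ u ∈ Set.Ioc (0 : ℝ) p, max (q - quantile ν u) 0 = q - quantile ν u := by
    intro u hu
    exact max_eq_left (sub_nonneg.2
      (monotoneOn_quantile ⟨hu.1, hu.2.trans_lt hp1⟩ ⟨hp0, hp1⟩ hu.2))
  have h2 : ∫ u in Set.Ioo (0 : ℝ) 1, max (q - quantile ν u) 0
      = ∫ u in Set.Ioc (0 : ℝ) p, (q - quantile ν u) := by
    rw [← setIntegral_congr_fun measurableSet_Ioc hle]
    refine (setIntegral_eq_of_subset_of_forall_sdiff_eq_zero measurableSet_Ioo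
      (fun u hu => ⟨hu.1, hu.2.trans_lt hp1⟩) fun u hu => ?_)
    have hup : p < u := by
      by_contra h
      exact hu.2 ⟨hu.1.1, not_lt.1 h⟩
    exact max_eq_right (sub_nonpos.2 (monotoneOn_quantile ⟨hp0, hp1⟩ hu.1 hup.le))
  have hi' : IntegrableOn (fun u => q - quantile ν u) (Set.Ioc (0 : ℝ) p) :=
    (hi.mono_set fun u hu => ⟨hu.1, hu.2.trans_lt hp1⟩).congr_fun hle measurableSet_Ioc
  have hc : IntegrableOn (fun _ : ℝ => q) (Set.Ioc (0 : ℝ) p) := by simp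
  have hQ : IntegrableOn (quantile ν) (Set.Ioc (0 : ℝ) p) := by
    have h := hc.sub hi'
    refine h.congr (ae_of_all _ fun u => ?_)
    simp
  rw [h1, h2, integral_sub hc hQ, cumulQuantile, intervalIntegral.integral_of_le hp0.le]
  simp [hp0.le]

lemma integral_max_sub_max [IsProbabilityMeasure ν] (hν : Integrable (fun x : ℝ => x) ν)
    (a b : ℝ) :
    ∫ x, max (b - x) 0 ∂ν - ∫ x, max (a - x) 0 ∂ν = ∫ t in a..b, cdf ν t := by
  have hmaxi : ∀ c : ℝ, Integrable (fun x => max (c - x) 0) ν := fun c =>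
    ((integrable_const c).sub hν).pos_part
  have hmeas : Measurable (fun z : ℝ × ℝ => (Set.Iic z.1).indicator (1 : ℝ → ℝ) z.2) := by
    have : (fun z : ℝ × ℝ => (Set.Iic z.1).indicator (1 : ℝ → ℝ) z.2)
        = {z : ℝ × ℝ | z.2 ≤ z.1}.indicator 1 := by
      funext z
      simp [Set.indicator_apply]
    rw [this]
    exact measurable_one.indicator (measurableSet_le measurable_snd measurable_fst)
  have hpt : ∀ x, ∫ t in a..b, (Set.Iic t).indicator (1 : ℝ → ℝ) x
      = max (b - x) 0 - max (a - x) 0 := by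
    have hcase : ∀ x a b, a ≤ b → ∫ t in a..b, (Set.Iic t).indicator (1 : ℝ → ℝ) x
        = max (b - x) 0 - max (a - x) 0 := by
      intro x a b hab
      rw [intervalIntegral.integral_of_le hab]
      have h1 : (fun t => (Set.Iic t).indicator (1 : ℝ → ℝ) x) = (Set.Ici x).indicator 1 := by
        funext t
        simp [Set.indicator_apply]
      rw [h1, integral_Ioc_eq_integral_Ioo, ← integral_Ico_eq_integral_Ioo,
        integral_indicator_one measurableSet_Ici, measureReal_restrict_apply measurableSet_Ici]
      have h2 : Set.Ici x ∩ Set.Ico a b = Set.Ico (max x a) b := by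
        ext t; simp only [Set.mem_inter_iff, Set.mem_Ici, Set.mem_Ico, max_le_iff]; tauto
      rw [h2, measureReal_def, Real.volume_Ico, ENNReal.toReal_ofReal']
      rcases le_total x a with h | h <;> rcases le_total x b with h' | h' <;>
        (simp [*]; try linarith)
    intro x
    rcases le_total a b with h | h
    · exact hcase x a b h
    · rw [intervalIntegral.integral_symm, hcase x b a h]; ring
  have hfin : IsFiniteMeasure ((volume : Measure ℝ).restrict (Set.uIoc a b)) :=
    ⟨by simp [Set.uIoc]⟩
  simp_rw [cdf_eq_integral]
  rw [intervalIntegral_integral_swap, ← integral_sub (hmaxi b) (hmaxi a)]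
  · simp_rw [hpt]
  · refine (integrable_const (1 : ℝ)).mono' hmeas.aestronglyMeasurable (ae_of_all _ fun z => ?_)
    change |(Set.Iic z.1).indicator (1 : ℝ → ℝ) z.2| ≤ 1
    rw [Set.indicator_apply]
    split_ifs <;> simp

/-- The area under the quantile function of `ν'` is close to its linearisation at the quantile of
`ν`: up to the factor `c'`, the error is at most the integral, over a neighbourhood of that
quantile, of the distance of the two (weighted) distribution functions. Indeed `p - cdf` changes
its sign at the quantile, so between the two quantiles the two functions have opposite signs. -/
lemma abs_cumulQuantile_sub_le {ν' : Measure ℝ} [IsProbabilityMeasure ν']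
    (hν' : Integrable (fun x : ℝ => x) ν') (hp0 : 0 < p) (hp1 : p < 1) {c c' δ : ℝ}
    (hc : 0 ≤ c) (hc' : 0 ≤ c') (hq : |quantile ν' p - quantile ν p| ≤ δ) :
    |c' * (cumulQuantile ν' p
        - (p * quantile ν p - ∫ x, max (quantile ν p - x) 0 ∂ν'))|
      ≤ ∫ t in Set.Icc (quantile ν p - δ) (quantile ν p + δ),
          |c' * (p - cdf ν' t) - c * (p - cdf ν t)| := by
  set q := quantile ν p with hqdef
  set q' := quantile ν' p with hqdef'
  have hmono : ∀ (μ : Measure ℝ) (k a b : ℝ),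
      IntervalIntegrable (fun t => k * (p - cdf μ t)) volume a b := fun μ k a b =>
    ((intervalIntegrable_const).sub (monotone_cdf μ).intervalIntegrable).const_mul k
  have hrep : c' * (cumulQuantile ν' p - (p * q - ∫ x, max (q - x) 0 ∂ν'))
      = ∫ t in q..q', c' * (p - cdf ν' t) := by
    rw [cumulQuantile_eq hν' hp0 hp1, intervalIntegral.integral_const_mul,
      intervalIntegral.integral_sub intervalIntegrable_const
        (monotone_cdf ν').intervalIntegrable, ← integral_max_sub_max hν' q q']
    simp only [intervalIntegral.integral_const, smul_eq_mul, ← hqdef']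
    ring
  rw [hrep]
  have hint : IntegrableOn (fun t => |c' * (p - cdf ν' t) - c * (p - cdf ν t)|)
      (Set.Icc (q - δ) (q + δ)) := by
    rw [integrableOn_Icc_iff_integrableOn_Ioc]
    refine Integrable.abs ?_
    have hδ : q - δ ≤ q + δ := by linarith [abs_nonneg (q' - q)]
    exact (intervalIntegrable_iff_integrableOn_Ioc_of_le hδ).1
      ((hmono ν' c' _ _).sub (hmono ν c _ _))
  have hsub : Set.uIoc q q' ⊆ Set.Icc (q - δ) (q + δ) := by
    rw [abs_le] at hq
    intro t ht
    rw [Set.mem_uIoc] at ht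
    constructor <;> rcases ht with h | h <;> linarith [h.1, h.2]
  have hnorm := intervalIntegral.norm_integral_le_integral_norm_uIoc (μ := volume)
    (f := fun t => c' * (p - cdf ν' t)) (a := q) (b := q')
  rw [Real.norm_eq_abs] at hnorm
  refine hnorm.trans (le_trans ?_ (setIntegral_mono_set hint
    (ae_of_all _ fun t => abs_nonneg _) hsub.eventuallyLE))
  -- the end point `t = max q q'` of the interval is harmless
  refine setIntegral_mono_ae_restrict ((hmono ν' c' q q').def'.norm) (hint.mono_set hsub) ?_
  have hne : ∀ᵐ t ∂(volume.restrict (Set.uIoc q q')), t ≠ max q q' :=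
    ae_restrict_of_ae (by simp [ae_iff])
  filter_upwards [ae_restrict_mem measurableSet_uIoc, hne] with t ht htne
  rw [Set.mem_uIoc] at ht
  simp only [Real.norm_eq_abs]
  rcases ht with ht | ht
  · have h1 : cdf ν' t < p := by
      rw [← lt_quantile_iff hp0 hp1]
      exact lt_of_le_of_ne ht.2 fun h => htne (by rw [h, max_eq_right (ht.1.le.trans ht.2)])
    have h2 : p ≤ cdf ν t := (quantile_le_iff hp0 hp1 t).1 ht.1.le
    have h3 : 0 ≤ c' * (p - cdf ν' t) := mul_nonneg hc' (by linarith)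
    have h4 : 0 ≤ c * (cdf ν t - p) := mul_nonneg hc (by linarith)
    rw [abs_of_nonneg h3, abs_of_nonneg (by linarith)]
    linarith
  · have h1 : cdf ν t < p := by
      rw [← lt_quantile_iff hp0 hp1]
      exact lt_of_le_of_ne ht.2 fun h => htne (by rw [h, max_eq_left (ht.1.le.trans ht.2)])
    have h2 : p ≤ cdf ν' t := (quantile_le_iff hp0 hp1 t).1 ht.1.le
    have h3 : 0 ≤ c' * (cdf ν' t - p) := mul_nonneg hc' (by linarith)
    have h4 : 0 ≤ c * (p - cdf ν t) := mul_nonneg hc (by linarith)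
    rw [abs_of_nonpos (by linarith), abs_of_nonpos (by linarith)]
    linarith

end Quantile

/-! ### Mean absolute differences -/

/-- `E |g(X) - g(Y)|` for independent `X` and `Y` with distributions `α` and `β`. -/
noncomputable def crossAbsDiff (g : ℝ → ℝ) (α β : Measure ℝ) : ℝ :=
  ∫ z : ℝ × ℝ, |g z.1 - g z.2| ∂(α.prod β)

section AbsDiff

variable {α β : Measure ℝ} [IsProbabilityMeasure α] [IsProbabilityMeasure β] {g : ℝ → ℝ}

lemma integrable_abs_sub_prod (hα : Integrable g α) (hβ : Integrable g β) :
    Integrable (fun z : ℝ × ℝ => |g z.1 - g z.2|) (α.prod β) :=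
  ((hα.comp_fst β).sub (hβ.comp_snd α)).abs

lemma crossAbsDiff_eq (hα : Integrable g α) (hβ : Integrable g β) :
    crossAbsDiff g α β = ∫ x, ∫ y, |g x - g y| ∂β ∂α :=
  integral_prod _ (integrable_abs_sub_prod hα hβ)

/-- `E |g(X) - g(Y)|` as an integral over levels `t` of the probability that `t` separates `g(X)`
from `g(Y)`. -/
lemma ofReal_crossAbsDiff (hg : Measurable g) (hα : Integrable g α) (hβ : Integrable g β) :
    ENNReal.ofReal (crossAbsDiff g α β) = ∫⁻ t, ENNReal.ofReal
      (α.real {x | g x ≤ t} * (1 - β.real {x | g x ≤ t})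
        + (1 - α.real {x | g x ≤ t}) * β.real {x | g x ≤ t}) := by
  rw [crossAbsDiff, ofReal_integral_eq_lintegral_ofReal (integrable_abs_sub_prod hα hβ)
    (ae_of_all _ fun z => abs_nonneg _)]
  have hpt : ∀ z : ℝ × ℝ, ENNReal.ofReal |g z.1 - g z.2|
      = ∫⁻ t, (Set.Ico (min (g z.1) (g z.2)) (max (g z.1) (g z.2))).indicator 1 t := fun z => by
    rw [lintegral_indicator_one measurableSet_Ico, Real.volume_Ico, max_sub_min_eq_abs,
      abs_sub_comm]
  simp_rw [hpt]
  rw [lintegral_lintegral_swap]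
  · congr 1
    funext t
    have hA : MeasurableSet {x | g x ≤ t} := measurableSet_le hg measurable_const
    have hset : ∀ z : ℝ × ℝ,
        (Set.Ico (min (g z.1) (g z.2)) (max (g z.1) (g z.2))).indicator (1 : ℝ → ENNReal) t
        = ({x | g x ≤ t} ×ˢ {x | g x ≤ t}ᶜ ∪ {x | g x ≤ t}ᶜ ×ˢ {x | g x ≤ t}).indicator 1 z := by
      intro z
      have : t ∈ Set.Ico (min (g z.1) (g z.2)) (max (g z.1) (g z.2)) ↔
          z ∈ ({x | g x ≤ t} ×ˢ {x | g x ≤ t}ᶜ ∪ {x | g x ≤ t}ᶜ ×ˢ {x | g x ≤ t}) := by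
        simp only [Set.mem_Ico, min_le_iff, lt_max_iff, Set.mem_union, Set.mem_prod,
          Set.mem_ofPred_eq, Set.mem_compl_iff, not_le]
        constructor
        · rintro ⟨h1 | h1, h2 | h2⟩
          · exact absurd h1 (not_le.2 h2)
          · exact Or.inl ⟨h1, h2⟩
          · exact Or.inr ⟨h2, h1⟩
          · exact absurd h1 (not_le.2 h2)
        · rintro (⟨h1, h2⟩ | ⟨h1, h2⟩)
          · exact ⟨Or.inl h1, Or.inr h2⟩
          · exact ⟨Or.inr h2, Or.inl h1⟩
      rw [Set.indicator_apply, Set.indicator_apply]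
      simp only [this, Pi.one_apply]
    simp_rw [hset]
    rw [lintegral_indicator_one ((hA.prod hA.compl).union (hA.compl.prod hA)),
      measure_union _ (hA.compl.prod hA), Measure.prod_prod, Measure.prod_prod,
      ← ofReal_measureReal (μ := α) (s := {x | g x ≤ t}),
      ← ofReal_measureReal (μ := β) (s := {x | g x ≤ t}),
      ← ofReal_measureReal (μ := α) (s := {x | g x ≤ t}ᶜ),
      ← ofReal_measureReal (μ := β) (s := {x | g x ≤ t}ᶜ),
      probReal_compl_eq_one_sub hA, probReal_compl_eq_one_sub hA]
    · have h1 : α.real {x | g x ≤ t} ≤ 1 := measureReal_le_one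
      have h2 : β.real {x | g x ≤ t} ≤ 1 := measureReal_le_one
      rw [← ENNReal.ofReal_mul measureReal_nonneg, ← ENNReal.ofReal_mul (by linarith),
        ENNReal.ofReal_add (mul_nonneg measureReal_nonneg (by linarith))
          (mul_nonneg (by linarith) measureReal_nonneg)]
    · rw [Set.disjoint_left]
      rintro z ⟨h1, _⟩ ⟨h2, _⟩
      exact h2 h1
  · have : (Function.uncurry fun (z : ℝ × ℝ) (t : ℝ) =>
        (Set.Ico (min (g z.1) (g z.2)) (max (g z.1) (g z.2))).indicator (1 : ℝ → ENNReal) t)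
        = {w : (ℝ × ℝ) × ℝ | min (g w.1.1) (g w.1.2) ≤ w.2 ∧
            w.2 < max (g w.1.1) (g w.1.2)}.indicator 1 := by
      funext w
      simp [Function.uncurry, Set.indicator_apply]
    rw [this]
    have m1 : Measurable fun w : (ℝ × ℝ) × ℝ => min (g w.1.1) (g w.1.2) := by fun_prop
    have m2 : Measurable fun w : (ℝ × ℝ) × ℝ => max (g w.1.1) (g w.1.2) := by fun_prop
    exact (measurable_one.indicator ((measurableSet_le m1 measurable_snd).inter
      (measurableSet_lt measurable_snd m2))).aemeasurable

/-- Nonnegativity of the energy distance: for independent `X, X'` with distribution `α` and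
`Y, Y'` with distribution `β`, `E |g(X) - g(X')| + E |g(Y) - g(Y')| ≤ 2 E |g(X) - g(Y)|`. -/
lemma crossAbsDiff_self_add_self_le (hg : Measurable g) (hα : Integrable g α)
    (hβ : Integrable g β) :
    crossAbsDiff g α α + crossAbsDiff g β β ≤ 2 * crossAbsDiff g α β := by
  have hnn : ∀ μ ν : Measure ℝ, 0 ≤ crossAbsDiff g μ ν := fun μ ν =>
    integral_nonneg fun z => abs_nonneg _
  rw [← ENNReal.ofReal_le_ofReal_iff (mul_nonneg zero_le_two (hnn _ _)),
    ENNReal.ofReal_add (hnn _ _) (hnn _ _), two_mul, ENNReal.ofReal_add (hnn _ _) (hnn _ _),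
    ofReal_crossAbsDiff hg hα hα, ofReal_crossAbsDiff hg hβ hβ, ofReal_crossAbsDiff hg hα hβ]
  have hmono : ∀ μ : Measure ℝ, [IsProbabilityMeasure μ] →
      Measurable fun t => μ.real {x | g x ≤ t} := fun μ _ =>
    (show Monotone fun t => μ.real {x | g x ≤ t} from fun s t hst =>
      measureReal_mono fun x hx => le_trans hx hst).measurable
  have hA := hmono α
  have hB := hmono β
  rw [← lintegral_add_left (by fun_prop), ← lintegral_add_left (by fun_prop)]
  refine lintegral_mono fun t => ?_
  have a0 : 0 ≤ α.real {x | g x ≤ t} := measureReal_nonneg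
  have a1 : α.real {x | g x ≤ t} ≤ 1 := measureReal_le_one
  have b0 : 0 ≤ β.real {x | g x ≤ t} := measureReal_nonneg
  have b1 : β.real {x | g x ≤ t} ≤ 1 := measureReal_le_one
  simp only
  generalize α.real {x | g x ≤ t} = a at *
  generalize β.real {x | g x ≤ t} = b at *
  have p1 := mul_nonneg a0 (sub_nonneg.2 a1)
  have p2 := mul_nonneg b0 (sub_nonneg.2 b1)
  have p3 := mul_nonneg a0 (sub_nonneg.2 b1)
  have p4 := mul_nonneg (sub_nonneg.2 a1) b0
  rw [← ENNReal.ofReal_add (by linarith) (by linarith),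
    ← ENNReal.ofReal_add (by linarith) (by linarith)]
  refine ENNReal.ofReal_le_ofReal ?_
  nlinarith [sq_nonneg (a - b)]

/-- The mean absolute difference of a conditional distribution in terms of that of the censored
variable `X 1(X ∈ s)`, which lives under the unconditional distribution. -/
lemma meanAbsDiff_law (s : SignPart) {μ : Measure ℝ} [IsProbabilityMeasure μ]
    (hμ : Integrable (fun x : ℝ => x) μ) :
    μ.real s.region ^ 2 * meanAbsDiff (s.law μ)
      = crossAbsDiff (s.region.indicator id) μ μ
        - 2 * (1 - μ.real s.region) * ∫ x, |s.region.indicator id x| ∂μ := by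
  have hS := s.measurableSet_region
  set S := s.region with hSdef
  set g : ℝ → ℝ := S.indicator id with hg
  have hgi : Integrable g μ := hμ.indicator hS
  have h1 : μ.real S ^ 2 * meanAbsDiff (s.law μ) = ∫ z in S ×ˢ S, |z.1 - z.2| ∂(μ.prod μ) := by
    rcases eq_or_ne (μ S) 0 with h0 | h0
    · have h0' : (μ.prod μ) (S ×ˢ S) = 0 := by rw [Measure.prod_prod, h0, zero_mul]
      rw [Measure.restrict_eq_zero.2 h0', measureReal_def, h0]
      simp
    · have hne : (μ S)⁻¹ ≠ ⊤ := ENNReal.inv_ne_top.2 h0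
      rw [meanAbsDiff, SignPart.law, ProbabilityTheory.cond, ← hSdef]
      have : ((μ S)⁻¹ • μ.restrict S).prod ((μ S)⁻¹ • μ.restrict S)
          = ((μ S)⁻¹ * (μ S)⁻¹) • (μ.prod μ).restrict (S ×ˢ S) := by
        rw [Measure.prod_smul_left, Measure.prod_smul_right, Measure.prod_restrict, smul_smul]
      rw [this, integral_smul_measure, ENNReal.toReal_mul, ENNReal.toReal_inv, ← measureReal_def,
        smul_eq_mul, ← mul_assoc]
      have hr : μ.real S ≠ 0 := by
        rw [measureReal_ne_zero_iff]; exact h0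
      field_simp
  have hci : ∀ c : ℝ, Integrable (Sᶜ.indicator (fun _ => c) : ℝ → ℝ) μ := fun c =>
    (integrable_const c).indicator hS.compl
  have i1 : Integrable (fun z : ℝ × ℝ => |g z.1| * Sᶜ.indicator (fun _ => (1 : ℝ)) z.2)
      (μ.prod μ) := hgi.abs.mul_prod (hci 1)
  have i2 : Integrable (fun z : ℝ × ℝ => Sᶜ.indicator (fun _ => (1 : ℝ)) z.1 * |g z.2|)
      (μ.prod μ) := (hci 1).mul_prod hgi.abs
  have i0 := integrable_abs_sub_prod hgi hgi
  have hcomp : ∫ x, Sᶜ.indicator (fun _ => (1 : ℝ)) x ∂μ = 1 - μ.real S := by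
    rw [integral_indicator_const _ hS.compl, probReal_compl_eq_one_sub hS]
    simp
  rw [h1, ← integral_indicator (hS.prod hS), crossAbsDiff]
  have hpt : ∀ z : ℝ × ℝ, (S ×ˢ S).indicator (fun z : ℝ × ℝ => |z.1 - z.2|) z
      = |g z.1 - g z.2| - |g z.1| * Sᶜ.indicator (fun _ => (1 : ℝ)) z.2
        - Sᶜ.indicator (fun _ => (1 : ℝ)) z.1 * |g z.2| := fun z => by
    by_cases h1 : z.1 ∈ S <;> by_cases h2 : z.2 ∈ S <;>
      simp [hg, h1, h2]
  simp_rw [hpt]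
  have i01 : Integrable (fun z : ℝ × ℝ =>
      |g z.1 - g z.2| - |g z.1| * Sᶜ.indicator (fun _ => (1 : ℝ)) z.2) (μ.prod μ) := i0.sub i1
  rw [integral_sub i01 i2, integral_sub i0 i1, integral_prod_mul (fun x => |g x|)
      (Sᶜ.indicator (fun _ => (1 : ℝ))), integral_prod_mul (Sᶜ.indicator (fun _ => (1 : ℝ)))
      (fun x => |g x|), hcomp]
  ring

end AbsDiff

lemma crossAbsDiff_empirical {n : ℕ} (hn : 0 < n) (x : ℕ → ℝ) {g : ℝ → ℝ}
    {β : Measure ℝ} [IsProbabilityMeasure β] (hβ : Integrable g β) :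
    crossAbsDiff g (empirical n x) β = sampleMean n x (fun a => ∫ b, |g a - g b| ∂β) := by
  have := isProbabilityMeasure_empirical hn x
  rw [crossAbsDiff_eq (integrable_empirical n x g) hβ, integral_empirical]

/-- The kernel `E |x - Y|` in terms of the distribution function and the partial mean. -/
lemma integral_abs_sub_eq {ν : Measure ℝ} [IsProbabilityMeasure ν]
    (hν : Integrable (fun x : ℝ => x) ν) (x : ℝ) :
    ∫ y, |x - y| ∂ν = 2 * x * cdf ν x - 2 * (∫ t in Set.Iic x, t ∂ν) + mean ν - x := by
  have hpt : ∀ y, |x - y| = (Set.Iic x).indicator (fun y => 2 * (x - y)) y + (y - x) := fun y => by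
    by_cases h : y ≤ x
    · rw [Set.indicator_of_mem (Set.mem_Iic.2 h), abs_of_nonneg (sub_nonneg.2 h)]; ring
    · rw [Set.indicator_of_notMem (by simpa using h), abs_of_neg (sub_neg.2 (not_le.1 h))]; ring
  have hc : Integrable (fun _ : ℝ => x) ν := integrable_const x
  have hi : Integrable (fun y => 2 * (x - y)) ν := (hc.sub hν).const_mul 2
  have hd : Integrable (fun y => y - x) ν := hν.sub hc
  simp_rw [hpt]
  rw [integral_add (hi.indicator measurableSet_Iic) hd, integral_indicator measurableSet_Iic,
    integral_const_mul, integral_sub hc.integrableOn hν.integrableOn, integral_sub hν hc,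
    cdf_eq_real, mean]
  simp
  ring

/-! ### Influence functions of conditional functionals -/

/-- A centred function that is `κ (h + c)` on the region and vanishes off it determines the
influence function built from `h`, since `c` is then minus the conditional mean of `h`. -/
lemma fullInfluence_eq_div (s : SignPart) {F : Measure ℝ} [IsProbabilityMeasure F]
    (hπ : F.real s.region ≠ 0) {u h : ℝ → ℝ} {κ c : ℝ} (hκ : κ ≠ 0) (hh : Integrable h (s.law F))
    (hu : ∀ x, u x = s.region.indicator (fun _ => κ) x * (h x + c)) (hu0 : ∫ x, u x ∂F = 0) :
    (fun x => u x / (κ * F.real s.region)) = fullInfluence s F h := by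
  have hS := s.measurableSet_region
  have := s.isProbabilityMeasure_law F hπ
  have h1 : ∫ x, u x ∂F = F.real s.region * (κ * (∫ t, h t ∂(s.law F) + c)) := by
    have e1 : u = s.region.indicator (fun x => κ * (h x + c)) := by
      funext x
      rw [hu]
      by_cases hx : x ∈ s.region <;> simp [hx]
    rw [e1, integral_indicator hS, ← s.mul_integral_law, integral_const_mul,
      integral_add hh (integrable_const c)]
    simp
  have h2 : c = -∫ t, h t ∂(s.law F) := by
    rw [h1] at hu0
    have := (mul_eq_zero.1 ((mul_eq_zero.1 hu0).resolve_left hπ)).resolve_left hκ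
    linarith
  funext x
  rw [fullInfluence, hu, h2, ← sub_eq_add_neg]
  by_cases hx : x ∈ s.region
  · simp only [Set.indicator_of_mem hx]
    field_simp
  · simp [Set.indicator_of_notMem hx]

/-- The variable whose mean normalises an extended Lorenz curve. -/
def SignPart.scale : SignPart → ℝ → ℝ
  | .positive, x => x
  | .negative, x => x
  | .whole, x => |x|

lemma SignPart.measurable_scale (s : SignPart) : Measurable s.scale := by
  cases s
  · exact measurable_id
  · exact measurable_id
  · exact measurable_id.abs

lemma SignPart.abs_scale (s : SignPart) (x : ℝ) : |s.scale x| = |x| := by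
  cases s <;> simp [SignPart.scale]

lemma extLorenz_eq (s : SignPart) (ν : Measure ℝ) (p : ℝ) :
    extLorenz s ν p = cumulQuantile ν p / ∫ x, s.scale x ∂ν := by
  cases s <;> rfl

lemma lorenzW_eq (s : SignPart) (ν : Measure ℝ) (p x : ℝ) :
    lorenzW s ν p x = (-max (quantile ν p - x) 0 - s.scale x * extLorenz s ν p)
      / ∫ x, s.scale x ∂ν := by
  have h : (x - quantile ν p) * (if x ≤ quantile ν p then 1 else 0)
      = -max (quantile ν p - x) 0 := by
    split_ifs with hx
    · rw [max_eq_left (sub_nonneg.2 hx)]; ring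
    · rw [max_eq_right (sub_nonpos.2 (not_le.1 hx).le)]; ring
  cases s
  · rw [lorenzW, h]; rfl
  · rw [lorenzW, h]; rfl
  · rw [lorenzW, h]; rfl

lemma SignPart.setIntegral_abs_pos (s : SignPart) {G : Measure ℝ}
    (hG : Integrable (fun x : ℝ => x) G) (hs : 0 < G (s.region \ {0})) :
    0 < ∫ x in s.region, |x| ∂G := by
  rw [setIntegral_pos_iff_support_of_nonneg_ae (ae_of_all _ fun x => abs_nonneg x)
    hG.abs.integrableOn]
  convert! hs using 2
  ext x
  simp [and_comm]

lemma SignPart.setIntegral_scale_ne_zero (s : SignPart) {G : Measure ℝ}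
    (hG : Integrable (fun x : ℝ => x) G) (hs : 0 < G (s.region \ {0})) :
    ∫ x in s.region, s.scale x ∂G ≠ 0 := by
  have hpos := s.setIntegral_abs_pos hG hs
  cases s
  · have : ∫ x in SignPart.positive.region, SignPart.positive.scale x ∂G
        = ∫ x in SignPart.positive.region, |x| ∂G :=
      setIntegral_congr_fun measurableSet_Ioi fun x hx => (abs_of_pos hx).symm
    rw [this]; exact hpos.ne'
  · have : ∫ x in SignPart.negative.region, SignPart.negative.scale x ∂G
        = ∫ x in SignPart.negative.region, -|x| ∂G :=
      setIntegral_congr_fun measurableSet_Iio fun x hx => by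
        simp only [SignPart.scale]; rw [abs_of_neg hx, neg_neg]
    rw [this, integral_neg]; exact neg_ne_zero.2 hpos.ne'
  · exact hpos.ne'

lemma SignPart.measureReal_pos (s : SignPart) {G : Measure ℝ} [IsFiniteMeasure G]
    (hs : 0 < G (s.region \ {0})) : 0 < G.real s.region := by
  rw [measureReal_def]
  exact ENNReal.toReal_pos (hs.trans_le (measure_mono Set.sdiff_subset)).ne' (measure_ne_top _ _)

/-! ### Extended Lorenz curves -/

/-- The score `1(x ∈ s) (p - 1(x ≤ t))`, whose mean vanishes where the conditional distribution
function takes the value `p`. -/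
noncomputable def quantileScore (s : SignPart) (p t : ℝ) : ℝ → ℝ :=
  s.region.indicator (fun x => p - (Set.Iic t).indicator 1 x)

section QuantileScore

variable (s : SignPart) {p : ℝ}

lemma measurable_quantileScore_prod (p : ℝ) :
    Measurable (fun z : ℝ × ℝ => quantileScore s p z.1 z.2) := by
  have : (fun z : ℝ × ℝ => quantileScore s p z.1 z.2)
      = (Prod.snd ⁻¹' s.region).indicator
        (fun z => p - {z : ℝ × ℝ | z.2 ≤ z.1}.indicator 1 z) := by
    funext z
    by_cases hz : z.2 ∈ s.region <;> simp [quantileScore, Set.indicator_apply, hz]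
  rw [this]
  refine Measurable.indicator ?_ (measurable_snd s.measurableSet_region)
  exact measurable_const.sub
    (measurable_one.indicator (measurableSet_le measurable_snd measurable_fst))

lemma measurable_quantileScore (p t : ℝ) : Measurable (quantileScore s p t) :=
  (measurable_quantileScore_prod s p).comp (measurable_const.prodMk measurable_id)

lemma abs_quantileScore_le (hp0 : 0 < p) (hp1 : p < 1) (t x : ℝ) : |quantileScore s p t x| ≤ 1 := by
  unfold quantileScore
  by_cases hx : x ∈ s.region
  · rw [Set.indicator_of_mem hx, abs_le]
    by_cases ht : x ≤ t <;> simp [ht] <;> constructor <;> linarith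
  · simp [Set.indicator_of_notMem hx]

lemma memLp_quantileScore (hp0 : 0 < p) (hp1 : p < 1) (t : ℝ) (q : ENNReal) (G : Measure ℝ)
    [IsFiniteMeasure G] : MemLp (quantileScore s p t) q G :=
  MemLp.of_bound (measurable_quantileScore s p t).aestronglyMeasurable 1
    (ae_of_all _ fun x => abs_quantileScore_le s hp0 hp1 t x)

lemma integral_quantileScore {μ : Measure ℝ} [IsFiniteMeasure μ] (hμ : μ.real s.region ≠ 0)
    (p t : ℝ) : ∫ x, quantileScore s p t x ∂μ = μ.real s.region * (p - cdf (s.law μ) t) := by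
  have := s.isProbabilityMeasure_law μ hμ
  have hi : Integrable ((Set.Iic t).indicator (1 : ℝ → ℝ)) (s.law μ) :=
    (integrable_const (1 : ℝ)).indicator measurableSet_Iic
  unfold quantileScore
  rw [integral_indicator s.measurableSet_region, ← s.mul_integral_law,
    integral_sub (integrable_const p) hi, cdf_eq_integral]
  simp

end QuantileScore

section LorenzAsymptotics

variable {Ω : ℕ → Type*} [∀ r, MeasurableSpace (Ω r)]
  {P : ∀ r, Measure (Ω r)} [∀ r, IsProbabilityMeasure (P r)] {G : Measure ℝ}
  [IsProbabilityMeasure G] {n : ℕ → ℕ} {X : ∀ r, ℕ → Ω r → ℝ} {s : SignPart} {p : ℝ}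

/-- Consistency of the conditional sample quantile. -/
lemma tendsto_measure_quantile_sub (hS : ∀ r, IsSample (P r) G (n r) (X r))
    (hn : Tendsto n atTop atTop) (hπ : 0 < G.real s.region) (hp0 : 0 < p) (hp1 : p < 1)
    (huniq : ∀ x, quantile (s.law G) p < x → p < cdf (s.law G) x) {δ : ℝ} (hδ : 0 < δ) :
    Tendsto (fun r => P r {ω | ¬ ((empirical (n r) (fun i => X r i ω)).real s.region ≠ 0 ∧
      |quantile (s.law (empirical (n r) (fun i => X r i ω))) p - quantile (s.law G) p| ≤ δ)})
      atTop (𝓝 0) := by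
  set q := quantile (s.law G) p with hq
  -- the mean score has strictly opposite signs at `q - δ` and `q + δ`, hence so has its sample mean
  -- with probability tending to one, which traps the sample quantile between the two points
  have hup : 0 < -∫ x, quantileScore s p (q + δ) x ∂G := by
    rw [integral_quantileScore s hπ.ne', ← mul_neg]
    exact mul_pos hπ (by linarith [huniq (q + δ) (by linarith)])
  have hlo : 0 < ∫ x, quantileScore s p (q - δ) x ∂G := by
    rw [integral_quantileScore s hπ.ne']
    have h := (lt_quantile_iff (ν := s.law G) hp0 hp1 (q - δ)).1 (by linarith)
    exact mul_pos hπ (by linarith)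
  have t1 := tendstoZeroInProb_sampleMean_sub hS hn (measurable_quantileScore s p (q + δ))
    (memLp_quantileScore s hp0 hp1 (q + δ) 2 G)
  have t2 := tendstoZeroInProb_sampleMean_sub hS hn (measurable_quantileScore s p (q - δ))
    (memLp_quantileScore s hp0 hp1 (q - δ) 2 G)
  have t1' : TendstoZeroInProb P (fun r ω =>
      -sampleMean (n r) (fun i => X r i ω) (quantileScore s p (q + δ))
        - -∫ x, quantileScore s p (q + δ) x ∂G) :=
    t1.mono (Eventually.of_forall fun r ω => by rw [← abs_neg]; ring_nf; rfl)
  have hlim := (t1'.tendsto_measure_nonpos hup).add (t2.tendsto_measure_nonpos hlo)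
  rw [add_zero] at hlim
  refine tendsto_of_tendsto_of_tendsto_of_le_of_le tendsto_const_nhds hlim (fun _ => zero_le)
    fun r => (measure_mono fun ω hω => ?_).trans (measure_union_le _ _)
  by_contra hcon
  simp only [Set.mem_union, Set.mem_ofPred_eq, not_or, not_le] at hcon
  refine hω ?_
  obtain ⟨h1, h2⟩ := hcon
  set μ := empirical (n r) (fun i => X r i ω) with hμ
  rw [← integral_empirical] at h1 h2
  have hμπ : μ.real s.region ≠ 0 := by
    intro h0
    have : ∫ x, quantileScore s p (q - δ) x ∂μ = 0 := by
      unfold quantileScore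
      rw [integral_indicator s.measurableSet_region, ← s.mul_integral_law, h0, zero_mul]
    linarith
  have hμpos : 0 < μ.real s.region := lt_of_le_of_ne measureReal_nonneg hμπ.symm
  rw [integral_quantileScore s hμπ] at h1 h2
  rw [← mul_neg] at h1
  have h1' := pos_of_mul_pos_right h1 hμpos.le
  have h2' := pos_of_mul_pos_right h2 hμpos.le
  refine ⟨hμπ, abs_le.2 ⟨?_, ?_⟩⟩
  · linarith [(lt_quantile_iff hp0 hp1 (q - δ)).2 (show cdf (s.law μ) (q - δ) < p by linarith)]
  · linarith [(quantile_le_iff hp0 hp1 (q + δ)).2 (show p ≤ cdf (s.law μ) (q + δ) by linarith)]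

/-- The error in the linearisation of the area under the conditional quantile function is of
smaller order than `1/√n`. -/
lemma tendstoZeroInProb_lorenz_remainder (hS : ∀ r, IsSample (P r) G (n r) (X r))
    (hn : Tendsto n atTop atTop) (hπ : 0 < G.real s.region) (hp0 : 0 < p) (hp1 : p < 1)
    (huniq : ∀ x, quantile (s.law G) p < x → p < cdf (s.law G) x) :
    TendstoZeroInProb P (fun r ω => Real.sqrt (n r) *
      ((empirical (n r) (fun i => X r i ω)).real s.region *
        (cumulQuantile (s.law (empirical (n r) (fun i => X r i ω))) p
          - (p * quantile (s.law G) p - ∫ x, max (quantile (s.law G) p - x) 0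
              ∂(s.law (empirical (n r) (fun i => X r i ω))))))) := by
  set q := quantile (s.law G) p with hq
  have hmono : Measurable fun t => cdf (s.law G) t := (monotone_cdf (s.law G)).measurable
  refine tendstoZeroInProb_of_forall_approx fun ε hε => ?_
  -- the deviation `K` has mean at most `1/√n` and is integrated over an interval of length `2 δ`
  set δ := ε / 2 with hδ
  have hδ0 : 0 < δ := by positivity
  set K : ∀ r, Ω r → ℝ → ℝ := fun r ω t =>
    |sampleMean (n r) (fun i => X r i ω) (quantileScore s p t)
      - G.real s.region * (p - cdf (s.law G) t)| with hK
  have hKm : ∀ r, Measurable (Function.uncurry (K r)) := by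
    intro r
    have hX := (hS r).measurable
    have h1 : Measurable fun z : Ω r × ℝ =>
        sampleMean (n r) (fun i => X r i z.1) (quantileScore s p z.2) := by
      unfold sampleMean
      refine Measurable.const_mul (Finset.measurable_fun_sum _ fun i _ => ?_) _
      exact (measurable_quantileScore_prod s p).comp
        (measurable_snd.prodMk ((hX i).comp measurable_fst))
    have h2 : Measurable fun z : Ω r × ℝ => G.real s.region * (p - cdf (s.law G) z.2) :=
      ((hmono.comp measurable_snd).const_sub p).const_mul _
    exact (h1.sub h2).abs
  have hKb : ∀ r ω t, |K r ω t| ≤ 2 := by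
    intro r ω t
    rw [hK]
    simp only [abs_abs]
    have h1 : |sampleMean (n r) (fun i => X r i ω) (quantileScore s p t)| ≤ 1 := by
      rw [sampleMean, abs_mul, abs_of_nonneg (by positivity)]
      have : |∑ i ∈ Finset.range (n r), quantileScore s p t (X r i ω)| ≤ n r := by
        refine (Finset.abs_sum_le_sum_abs _ _).trans ?_
        refine (Finset.sum_le_sum fun i _ => abs_quantileScore_le s hp0 hp1 t (X r i ω)).trans ?_
        simp
      rcases (n r).eq_zero_or_pos with h0 | h0
      · rw [h0]; simp
      · rw [inv_mul_le_iff₀ (by exact_mod_cast h0), mul_one]; exact this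
    have h2 : |G.real s.region * (p - cdf (s.law G) t)| ≤ 1 := by
      rw [← integral_quantileScore s hπ.ne']
      refine (norm_integral_le_of_norm_le_const (f := quantileScore s p t) (C := 1)
        (ae_of_all _ fun x => abs_quantileScore_le s hp0 hp1 t x)).trans ?_
      simp
    exact (abs_sub _ _).trans (by linarith)
  have hKint : ∀ r, Integrable (Function.uncurry (K r))
      ((P r).prod (volume.restrict (Set.Icc (q - δ) (q + δ)))) := fun r =>
    (integrable_const (2 : ℝ)).mono' (hKm r).aestronglyMeasurable
      (ae_of_all _ fun z => hKb r z.1 z.2)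
  refine ⟨fun r ω => Real.sqrt (n r) * ∫ t in Set.Icc (q - δ) (q + δ), K r ω t,
    fun r => (hKint r).integral_prod_left.const_mul _, ?_, ?_⟩
  · filter_upwards [hn.eventually_gt_atTop 0] with r hr
    have hs : 0 < Real.sqrt (n r) := Real.sqrt_pos.2 (by exact_mod_cast hr)
    have hnn : ∀ ω, 0 ≤ Real.sqrt (n r) * ∫ t in Set.Icc (q - δ) (q + δ), K r ω t := fun ω =>
      mul_nonneg hs.le (integral_nonneg fun t => abs_nonneg _)
    simp_rw [abs_of_nonneg (hnn _)]
    rw [integral_const_mul, integral_integral_swap (hKint r)]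
    have hEK : ∀ t, ∫ ω, K r ω t ∂(P r) ≤ (Real.sqrt (n r))⁻¹ := by
      intro t
      have h1 := (hS r).integral_abs_sampleMean_sub_le hr (measurable_quantileScore s p t)
        (memLp_quantileScore s hp0 hp1 t 2 G)
      rw [integral_quantileScore s hπ.ne'] at h1
      refine h1.trans ?_
      rw [div_eq_mul_inv]
      refine mul_le_of_le_one_left (by positivity) (Real.sqrt_le_one.2 ?_)
      refine (integral_mono (memLp_quantileScore s hp0 hp1 t 2 G).integrable_sq
        (integrable_const 1) fun x => ?_).trans (by simp)
      exact (sq_le_one_iff_abs_le_one _).2 (abs_quantileScore_le s hp0 hp1 t x)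
    have h2 : ∫ t in Set.Icc (q - δ) (q + δ), ∫ ω, K r ω t ∂(P r)
        ≤ ∫ _t in Set.Icc (q - δ) (q + δ), (Real.sqrt (n r))⁻¹ :=
      setIntegral_mono (hKint r).integral_prod_right (by simp) hEK
    rw [setIntegral_const, Real.volume_real_Icc_of_le (by linarith), smul_eq_mul] at h2
    calc _ ≤ Real.sqrt (n r) * ((q + δ - (q - δ)) * (Real.sqrt (n r))⁻¹) := by gcongr
      _ = ε := by rw [hδ]; field_simp; ring
  · refine tendsto_of_tendsto_of_tendsto_of_le_of_le tendsto_const_nhds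
      (tendsto_measure_quantile_sub hS hn hπ hp0 hp1 huniq hδ0) (fun _ => zero_le)
      fun r => measure_mono fun ω hω => ?_
    intro hgood
    rw [Set.mem_ofPred_eq] at hω
    refine absurd hω (not_lt.2 ?_)
    set μ := empirical (n r) (fun i => X r i ω) with hμ
    have := s.isProbabilityMeasure_law μ hgood.1
    rw [abs_mul (Real.sqrt (n r)), abs_mul (Real.sqrt (n r))]
    refine mul_le_mul_of_nonneg_left ?_ (abs_nonneg _)
    have h1 := abs_cumulQuantile_sub_le (ν := s.law G) (ν' := s.law μ)
      (s.integrable_law (integrable_empirical _ _ _) hgood.1) hp0 hp1 (c := G.real s.region)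
      (c' := μ.real s.region) measureReal_nonneg measureReal_nonneg hgood.2
    refine h1.trans (le_trans (le_of_eq ?_) (le_abs_self _))
    refine integral_congr_ae (ae_of_all _ fun t => ?_)
    simp only [hK]
    rw [← integral_empirical, ← hμ, integral_quantileScore s hgood.1]

/-- The sample version of an extended Lorenz ordinate is asymptotically linear. -/
theorem isAsymptoticallyLinear_extLorenz (hS : ∀ r, IsSample (P r) G (n r) (X r))
    (hn : Tendsto n atTop atTop) (hG : MemLp (fun x : ℝ => x) 2 G)
    (hs : 0 < G (s.region \ {0})) (hp0 : 0 < p) (hp1 : p < 1)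
    (huniq : ∀ x, quantile (s.law G) p < x → p < cdf (s.law G) x) :
    IsAsymptoticallyLinear P G n X
      (fun r ω => extLorenz s (s.law (empirical (n r) (fun i => X r i ω))) p)
      (extLorenz s (s.law G) p) (fullInfluence s G (lorenzW s (s.law G) p)) := by
  have hSm := s.measurableSet_region
  have hGi : Integrable (fun x : ℝ => x) G := hG.integrable one_le_two
  have hπ := s.measureReal_pos hs
  have hprob := s.isProbabilityMeasure_law G hπ.ne'
  set q := quantile (s.law G) p with hq
  set T := extLorenz s (s.law G) p with hT
  set κ := ∫ x, s.scale x ∂(s.law G) with hκ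
  have hD : G.real s.region * κ = ∫ x in s.region, s.scale x ∂G := s.mul_integral_law _
  have hD0 : ∫ x in s.region, s.scale x ∂G ≠ 0 := s.setIntegral_scale_ne_zero hGi hs
  have hκ0 : κ ≠ 0 := fun h => hD0 (by rw [← hD, h, mul_zero])
  have hscale2 : MemLp s.scale 2 G :=
    hG.of_le s.measurable_scale.aestronglyMeasurable (ae_of_all _ fun x => by
      rw [Real.norm_eq_abs, s.abs_scale]; rfl)
  have hmax2 : MemLp (fun x => max (q - x) 0) 2 G := ((memLp_const q).sub hG).pos_part
  -- the numerator of the linearised error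
  set f : ℝ → ℝ := fun x => p * q - max (q - x) 0 - T * s.scale x with hf
  have hfm : Measurable f := by
    have := s.measurable_scale
    fun_prop
  have hf2 : MemLp f 2 G := ((memLp_const (p * q)).sub hmax2).sub (hscale2.const_mul T)
  set u : ℝ → ℝ := s.region.indicator f with hu
  -- the weighted mean of `f` under any finite measure
  have hmean : ∀ μ : Measure ℝ, [IsFiniteMeasure μ] → μ.real s.region ≠ 0 →
      Integrable (fun x : ℝ => x) μ → ∫ x, u x ∂μ = μ.real s.region *
        (p * q - ∫ x, max (q - x) 0 ∂(s.law μ) - T * ∫ x, s.scale x ∂(s.law μ)) := by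
    intro μ _ hμ hμi
    have := s.isProbabilityMeasure_law μ hμ
    have hi := s.integrable_law hμi hμ
    have i1 : Integrable (fun x => max (q - x) 0) (s.law μ) :=
      ((integrable_const q).sub hi).pos_part
    have i2 : Integrable s.scale (s.law μ) :=
      hi.mono s.measurable_scale.aestronglyMeasurable (ae_of_all _ fun x => by
        rw [Real.norm_eq_abs, s.abs_scale]; rfl)
    have i3 : Integrable (fun x => p * q - max (q - x) 0) (s.law μ) := (integrable_const _).sub i1
    rw [hu, integral_indicator hSm, ← s.mul_integral_law, hf,
      integral_sub i3 (i2.const_mul T), integral_sub (integrable_const _) i1, integral_const_mul T]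
    simp
  have hu0 : ∫ x, u x ∂G = 0 := by
    rw [hmean G hπ.ne' hGi, ← cumulQuantile_eq (s.integrable_law hGi hπ.ne') hp0 hp1, hT,
      extLorenz_eq, ← hκ, div_mul_cancel₀ _ hκ0, sub_self, mul_zero]
  have hinfl : fullInfluence s G (lorenzW s (s.law G) p)
      = fun x => u x / ∫ x in s.region, s.scale x ∂G := by
    rw [← hD, mul_comm]
    symm
    refine fullInfluence_eq_div s hπ.ne' (c := p * q / κ) hκ0 ?_ (fun x => ?_) hu0
    · have : lorenzW s (s.law G) p = fun x => (-max (q - x) 0 - s.scale x * T) / κ := by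
        funext x; exact lorenzW_eq _ _ _ _
      rw [this]
      exact s.integrable_law ((((hmax2.integrable one_le_two).neg).sub
        ((hscale2.integrable one_le_two).mul_const T)).div_const κ) hπ.ne'
    · rw [lorenzW_eq, ← hκ, ← hT, ← hq, hu]
      by_cases hx : x ∈ s.region
      · simp only [Set.indicator_of_mem hx, hf]
        field_simp
        ring
      · simp [Set.indicator_of_notMem hx]
  rw [hinfl]
  refine isAsymptoticallyLinear_of_ratio hS hn (hfm.indicator hSm) (hf2.indicator hSm) hu0 hD0
    (Dh := fun r ω => sampleMean (n r) (fun i => X r i ω) (s.region.indicator s.scale)) ?_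
    (tendstoZeroInProb_lorenz_remainder hS hn hπ hp0 hp1 huniq)
    (Eventually.of_forall fun r ω hne => ?_)
  · rw [← integral_indicator hSm]
    exact tendstoZeroInProb_sampleMean_sub hS hn (s.measurable_scale.indicator hSm)
      (hscale2.indicator hSm)
  · set μ := empirical (n r) (fun i => X r i ω) with hμ
    have hden : sampleMean (n r) (fun i => X r i ω) (s.region.indicator s.scale)
        = μ.real s.region * ∫ x, s.scale x ∂(s.law μ) := by
      rw [← setIntegral_empirical _ _ _ hSm, ← hμ, ← s.mul_integral_law]
    rw [hden] at hne ⊢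
    have hμ0 : μ.real s.region ≠ 0 := left_ne_zero_of_mul hne
    have hm0 : ∫ x, s.scale x ∂(s.law μ) ≠ 0 := right_ne_zero_of_mul hne
    rw [← integral_empirical, ← hμ, hmean μ hμ0 (integrable_empirical _ _ _), extLorenz_eq]
    field_simp
    ring

end LorenzAsymptotics

/-! ### Extended Gini indices -/

lemma SignPart.integral_law_congr (s : SignPart) (μ : Measure ℝ) {f g : ℝ → ℝ}
    (h : ∀ x ∈ s.region, f x = g x) : ∫ x, f x ∂(s.law μ) = ∫ x, g x ∂(s.law μ) :=
  integral_congr_ae (ae_cond_of_forall_mem s.measurableSet_region h)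

lemma mean_law_positive (μ : Measure ℝ) :
    mean (SignPart.positive.law μ) = ∫ x, |x| ∂(SignPart.positive.law μ) :=
  SignPart.positive.integral_law_congr μ fun _ hx => (abs_of_pos hx).symm

lemma abs_mean_law_negative (μ : Measure ℝ) :
    |mean (SignPart.negative.law μ)| = ∫ x, |x| ∂(SignPart.negative.law μ) := by
  have h : mean (SignPart.negative.law μ) = ∫ x, -|x| ∂(SignPart.negative.law μ) :=
    SignPart.negative.integral_law_congr μ fun x hx => by rw [abs_of_neg hx, neg_neg]
  rw [h, integral_neg, abs_neg, abs_of_nonneg (integral_nonneg fun x => abs_nonneg x)]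

lemma extGini_law_eq (s : SignPart) (μ : Measure ℝ) :
    extGini s (s.law μ) = meanAbsDiff (s.law μ) / (2 * ∫ x, |x| ∂(s.law μ)) := by
  cases s
  · rw [extGini, mean_law_positive]
  · rw [extGini, abs_mean_law_negative]
  · rfl

lemma giniK_law_eq (s : SignPart) (μ : Measure ℝ) {x : ℝ} (hx : x ∈ s.region) :
    giniK s (s.law μ) x = (2 * x * cdf (s.law μ) x - 2 * (∫ t in Set.Iic x, t ∂(s.law μ))
      - extGini s (s.law μ) * |x| - x) / ∫ x, |x| ∂(s.law μ) := by
  cases s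
  · rw [giniK, mean_law_positive, abs_of_pos (show 0 < x from hx)]
    ring
  · rw [giniK, abs_mean_law_negative, abs_of_neg (show x < 0 from hx)]
    ring
  · rfl

section EnergyRemainder

variable {Ω : Type*} [MeasurableSpace Ω] {P : Measure Ω} [IsProbabilityMeasure P]
  {G : Measure ℝ} {n : ℕ} {X : ℕ → Ω → ℝ} {g : ℝ → ℝ}

lemma measurable_integral_abs_sub [IsProbabilityMeasure G] (hg : Measurable g) :
    Measurable fun x => ∫ y, |g x - g y| ∂G := by
  have h : StronglyMeasurable (Function.uncurry fun x y : ℝ => |g x - g y|) := by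
    refine Measurable.stronglyMeasurable ?_
    have : Measurable fun z : ℝ × ℝ => |g z.1 - g z.2| := by fun_prop
    exact this
  exact h.integral_prod_right.measurable

lemma integral_abs_sub_le [IsProbabilityMeasure G] (hg : Integrable g G) (x : ℝ) :
    |∫ y, |g x - g y| ∂G| ≤ |g x| + ∫ y, |g y| ∂G := by
  rw [abs_of_nonneg (integral_nonneg fun y => abs_nonneg _)]
  refine (integral_mono (((integrable_const _).sub hg).abs)
    ((integrable_const |g x|).add hg.abs) fun y => abs_sub _ _).trans_eq ?_
  rw [integral_add' (integrable_const _) hg.abs]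
  simp

lemma memLp_integral_abs_sub [IsProbabilityMeasure G] (hg : Measurable g) (hg2 : MemLp g 2 G) :
    MemLp (fun x => ∫ y, |g x - g y| ∂G) 2 G :=
  (hg2.abs.add (memLp_const (∫ y, |g y| ∂G))).mono
    (measurable_integral_abs_sub hg).aestronglyMeasurable (ae_of_all _ fun x => by
      refine (integral_abs_sub_le (hg2.integrable one_le_two) x).trans ?_
      exact le_abs_self _)

lemma IsSample.integral_abs_sub (h : IsSample P G n X) (hg : Measurable g) {i j : ℕ} (hi : i < n)
    (hj : j < n) (hij : i ≠ j) : ∫ ω, |g (X i ω) - g (X j ω)| ∂P = crossAbsDiff g G G := by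
  have h1 := h.measurable i
  have h2 := h.measurable j
  have hm : P.map (fun ω => (X i ω, X j ω)) = G.prod G := by
    rw [(indepFun_iff_map_prod_eq_prod_map_map h1.aemeasurable h2.aemeasurable).1
      (h.indep i hi j hj hij), h.law i hi, h.law j hj]
  rw [crossAbsDiff, ← hm, integral_map (by fun_prop) (by fun_prop)]

/-- The Hoeffding remainder of the mean absolute difference of a sample of size `n` has mean
absolute value at most `θ / n`: its sign is that of minus an energy distance, so that only its
expectation has to be computed. -/
lemma IsSample.integral_abs_energy_remainder [IsProbabilityMeasure G] (h : IsSample P G n X)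
    (hn : 0 < n) (hg : Measurable g) (hgi : Integrable g G) :
    Integrable (fun ω => crossAbsDiff g (empirical n (fun i => X i ω))
        (empirical n (fun i => X i ω))
      - 2 * sampleMean n (fun i => X i ω) (fun x => ∫ y, |g x - g y| ∂G)
      + crossAbsDiff g G G) P ∧
    ∫ ω, |crossAbsDiff g (empirical n (fun i => X i ω)) (empirical n (fun i => X i ω))
      - 2 * sampleMean n (fun i => X i ω) (fun x => ∫ y, |g x - g y| ∂G)
      + crossAbsDiff g G G| ∂P ≤ crossAbsDiff g G G / n := by
  have hn' : (0 : ℝ) < n := by exact_mod_cast hn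
  set θ := crossAbsDiff g G G with hθ
  set h1 : ℝ → ℝ := fun x => ∫ y, |g x - g y| ∂G with hh1
  have hMform : ∀ ω, crossAbsDiff g (empirical n (fun i => X i ω)) (empirical n (fun i => X i ω))
      = (n : ℝ)⁻¹ * ∑ i ∈ Finset.range n, (n : ℝ)⁻¹ * ∑ j ∈ Finset.range n,
        |g (X i ω) - g (X j ω)| := fun ω => by
    have := isProbabilityMeasure_empirical hn (fun i => X i ω)
    rw [crossAbsDiff_empirical hn _ (integrable_empirical n _ g), sampleMean]
    simp_rw [integral_empirical, sampleMean]
  have hgX : ∀ i < n, Integrable (fun ω => g (X i ω)) P := fun i hi =>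
    memLp_one_iff_integrable.1 (h.memLp_comp (memLp_one_iff_integrable.2 hgi) hi)
  have hij : ∀ i ∈ Finset.range n, ∀ j ∈ Finset.range n,
      Integrable (fun ω => |g (X i ω) - g (X j ω)|) P := fun i hi j hj =>
    ((hgX i (Finset.mem_range.1 hi)).sub (hgX j (Finset.mem_range.1 hj))).abs
  have hMi : Integrable (fun ω => crossAbsDiff g (empirical n (fun i => X i ω))
      (empirical n (fun i => X i ω))) P := by
    simp_rw [hMform]
    exact (integrable_finsetSum _ fun i hi =>
      (integrable_finsetSum _ fun j hj => hij i hi j hj).const_mul _).const_mul _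
  have hME : ∫ ω, crossAbsDiff g (empirical n (fun i => X i ω))
      (empirical n (fun i => X i ω)) ∂P = θ - θ / n := by
    simp_rw [hMform]
    rw [integral_const_mul, integral_finsetSum _ fun i hi =>
      (integrable_finsetSum _ fun j hj => hij i hi j hj).const_mul _]
    -- the `n` diagonal terms vanish and the others have mean `θ`
    have hrow : ∀ i ∈ Finset.range n, ∫ ω, (n : ℝ)⁻¹ * ∑ j ∈ Finset.range n,
        |g (X i ω) - g (X j ω)| ∂P = (n : ℝ)⁻¹ * ((n - 1) * θ) := by
      intro i hi
      rw [integral_const_mul, integral_finsetSum _ fun j hj => hij i hi j hj,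
        ← Finset.add_sum_erase _ _ hi]
      have : ∀ j ∈ (Finset.range n).erase i, ∫ ω, |g (X i ω) - g (X j ω)| ∂P = θ := fun j hj =>
        h.integral_abs_sub hg (Finset.mem_range.1 hi)
          (Finset.mem_range.1 (Finset.mem_of_mem_erase hj)) (Finset.ne_of_mem_erase hj).symm
      rw [Finset.sum_congr rfl this, Finset.sum_const, Finset.card_erase_of_mem hi,
        Finset.card_range, nsmul_eq_mul, Nat.cast_sub hn]
      simp
    rw [Finset.sum_congr rfl hrow, Finset.sum_const, Finset.card_range, nsmul_eq_mul]
    field_simp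
  have hh1i : Integrable h1 G := by
    refine (hgi.abs.add (integrable_const (∫ y, |g y| ∂G))).mono'
      (measurable_integral_abs_sub hg).aestronglyMeasurable (ae_of_all _ fun x => ?_)
    exact integral_abs_sub_le hgi x
  have hh1E : ∫ ω, sampleMean n (fun i => X i ω) h1 ∂P = θ := by
    unfold sampleMean
    have hi : ∀ i ∈ Finset.range n, Integrable (fun ω => h1 (X i ω)) P := fun i hi =>
      memLp_one_iff_integrable.1
        (h.memLp_comp (memLp_one_iff_integrable.2 hh1i) (Finset.mem_range.1 hi))
    rw [integral_const_mul, integral_finsetSum _ hi, Finset.sum_congr rfl fun i hi =>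
      h.integral_comp (measurable_integral_abs_sub hg) (Finset.mem_range.1 hi), hθ,
      crossAbsDiff_eq hgi hgi]
    simp only [Finset.sum_const, Finset.card_range, nsmul_eq_mul]
    rw [inv_mul_cancel_left₀ hn'.ne']
  have hh1S : Integrable (fun ω => 2 * sampleMean n (fun i => X i ω) h1) P :=
    (h.integrable_sampleMean hh1i).const_mul 2
  have hdiff : Integrable (fun ω => crossAbsDiff g (empirical n (fun i => X i ω))
      (empirical n (fun i => X i ω)) - 2 * sampleMean n (fun i => X i ω) h1) P := hMi.sub hh1S
  refine ⟨hdiff.add (integrable_const θ), ?_⟩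
  have hneg : ∀ ω, |crossAbsDiff g (empirical n (fun i => X i ω)) (empirical n (fun i => X i ω))
      - 2 * sampleMean n (fun i => X i ω) h1 + θ|
      = -(crossAbsDiff g (empirical n (fun i => X i ω)) (empirical n (fun i => X i ω))
        - 2 * sampleMean n (fun i => X i ω) h1 + θ) := fun ω => by
    have := isProbabilityMeasure_empirical hn (fun i => X i ω)
    have he := crossAbsDiff_self_add_self_le hg (integrable_empirical n (fun i => X i ω) g) hgi
    rw [crossAbsDiff_empirical hn (fun i => X i ω) hgi] at he
    exact abs_of_nonpos (by linarith)
  simp_rw [hneg]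
  rw [integral_neg, integral_add hdiff (integrable_const θ), integral_sub hMi hh1S, hME,
    integral_const_mul, hh1E]
  simp
  linarith

end EnergyRemainder

section GiniAsymptotics

variable {Ω : ℕ → Type*} [∀ r, MeasurableSpace (Ω r)]
  {P : ∀ r, Measure (Ω r)} [∀ r, IsProbabilityMeasure (P r)] {G : Measure ℝ}
  [IsProbabilityMeasure G] {n : ℕ → ℕ} {X : ∀ r, ℕ → Ω r → ℝ} {s : SignPart}

/-- The Hoeffding remainder of the sample mean absolute difference is of smaller order than
`1/√n`. -/
lemma tendstoZeroInProb_energy_remainder (hS : ∀ r, IsSample (P r) G (n r) (X r))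
    (hn : Tendsto n atTop atTop) {g : ℝ → ℝ} (hg : Measurable g) (hgi : Integrable g G) :
    TendstoZeroInProb P (fun r ω => Real.sqrt (n r) *
      (crossAbsDiff g (empirical (n r) (fun i => X r i ω)) (empirical (n r) (fun i => X r i ω))
      - 2 * sampleMean (n r) (fun i => X r i ω) (fun x => ∫ y, |g x - g y| ∂G)
      + crossAbsDiff g G G)) := by
  refine tendstoZeroInProb_of_forall_approx fun ε hε => ?_
  -- the moment bound holds for nonempty samples only; finitely many `r` are exempt
  refine ⟨fun r ω => if 0 < n r then Real.sqrt (n r) *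
      (crossAbsDiff g (empirical (n r) (fun i => X r i ω)) (empirical (n r) (fun i => X r i ω))
      - 2 * sampleMean (n r) (fun i => X r i ω) (fun x => ∫ y, |g x - g y| ∂G)
      + crossAbsDiff g G G) else 0, fun r => ?_, ?_, ?_⟩
  · by_cases h0 : 0 < n r
    · simp only [h0, if_true]
      exact ((hS r).integral_abs_energy_remainder h0 hg hgi).1.const_mul _
    · simp [h0]
  · have hlim := (tendsto_inv_sqrt_natCast hn).const_mul (crossAbsDiff g G G)
    rw [mul_zero] at hlim
    filter_upwards [hn.eventually_gt_atTop 0, hlim.eventually_le_const hε] with r hr hle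
    simp only [hr, if_true]
    have hr' : (0 : ℝ) < n r := by exact_mod_cast hr
    have hs : 0 < Real.sqrt (n r) := Real.sqrt_pos.2 hr'
    simp_rw [abs_mul, abs_of_pos hs]
    rw [integral_const_mul]
    refine (mul_le_mul_of_nonneg_left
      ((hS r).integral_abs_energy_remainder hr hg hgi).2 hs.le).trans (le_trans (le_of_eq ?_) hle)
    rw [← Real.sqrt_div_self]
    ring
  · refine tendsto_const_nhds.congr' ?_
    filter_upwards [hn.eventually_gt_atTop 0] with r hr
    simp [hr]

/-- The sample version of an extended Gini index is asymptotically linear. -/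
theorem isAsymptoticallyLinear_extGini (hS : ∀ r, IsSample (P r) G (n r) (X r))
    (hn : Tendsto n atTop atTop) (hG : MemLp (fun x : ℝ => x) 2 G)
    (hs : 0 < G (s.region \ {0})) :
    IsAsymptoticallyLinear P G n X
      (fun r ω => extGini s (s.law (empirical (n r) (fun i => X r i ω))))
      (extGini s (s.law G)) (fullInfluence s G (giniK s (s.law G))) := by
  have hSm := s.measurableSet_region
  have hGi : Integrable (fun x : ℝ => x) G := hG.integrable one_le_two
  have hπ := s.measureReal_pos hs
  have hprob := s.isProbabilityMeasure_law G hπ.ne'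
  set g : ℝ → ℝ := s.region.indicator id with hg
  have hgm : Measurable g := measurable_id.indicator hSm
  have hg2 : MemLp g 2 G := hG.indicator hSm
  have hgi : Integrable g G := hg2.integrable one_le_two
  have hgabs : (fun x => |g x|) = s.region.indicator (fun x => |x|) := by
    funext x
    by_cases hx : x ∈ s.region <;> simp [hg, hx]
  set w : ℝ → ℝ := s.region.indicator 1 with hw
  have hwm : Measurable w := measurable_one.indicator hSm
  have hw2 : MemLp w 2 G := (memLp_const (1 : ℝ)).indicator hSm
  set h1 : ℝ → ℝ := fun x => ∫ y, |g x - g y| ∂G with hh1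
  have hh1m : Measurable h1 := measurable_integral_abs_sub hgm
  have hh12 : MemLp h1 2 G := memLp_integral_abs_sub hgm hg2
  set π := G.real s.region with hπdef
  set B := ∫ x, |g x| ∂G with hB
  set θ := crossAbsDiff g G G with hθ
  set I := extGini s (s.law G) with hI
  have hBS : B = ∫ x in s.region, |x| ∂G := by rw [hB, hgabs, integral_indicator hSm]
  have hB0 : 0 < B := by rw [hBS]; exact s.setIntegral_abs_pos hGi hs
  have hBlaw : π * ∫ x, |x| ∂(s.law G) = B := by rw [hBS, s.mul_integral_law]
  have hwE : ∫ x, w x ∂G = π := integral_indicator_one hSm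
  have hlaw0 : ∫ x, |x| ∂(s.law G) ≠ 0 := fun h0 => hB0.ne' (by rw [← hBlaw, h0, mul_zero])
  -- the defining equation of the Gini index, in terms of the censored variable
  have hgini : ∀ μ : Measure ℝ, [IsProbabilityMeasure μ] → Integrable (fun x : ℝ => x) μ →
      μ.real s.region * ∫ x, |g x| ∂μ ≠ 0 →
      extGini s (s.law μ) * (2 * (μ.real s.region * ∫ x, |g x| ∂μ))
        = crossAbsDiff g μ μ - 2 * (1 - μ.real s.region) * ∫ x, |g x| ∂μ := by
    intro μ _ hμ hne
    have e1 := meanAbsDiff_law s hμ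
    have e2 : μ.real s.region * ∫ x, |x| ∂(s.law μ) = ∫ x, |g x| ∂μ := by
      rw [hgabs, integral_indicator hSm, s.mul_integral_law]
    rw [← e1, extGini_law_eq, ← e2]
    rw [← e2] at hne
    have hne' : ∫ x, |x| ∂(s.law μ) ≠ 0 := right_ne_zero_of_mul (right_ne_zero_of_mul hne)
    field_simp
  have hIeq : I * (2 * (π * B)) = θ - 2 * (1 - π) * B :=
    hgini G hGi (mul_ne_zero hπ.ne' hB0.ne')
  -- the numerator of the linearised error
  -- obtained by linearising `hgini` in its three functionals about `θ`, `B` and `π`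
  set u : ℝ → ℝ := fun x => 2 * h1 x - θ - 2 * |g x|
    + 2 * (1 - I) * (π * |g x| + B * w x - π * B) with hu
  have hum : Measurable u := by fun_prop
  have hu2 : MemLp u 2 G :=
    (((hh12.const_mul 2).sub (memLp_const θ)).sub (hg2.abs.const_mul 2)).add
      ((((hg2.abs.const_mul π).add (hw2.const_mul B)).sub (memLp_const (π * B))).const_mul
        (2 * (1 - I)))
  have hmean : ∀ μ : Measure ℝ, [IsProbabilityMeasure μ] → Integrable h1 μ → Integrable g μ →
      Integrable w μ → ∫ x, u x ∂μ = 2 * (∫ x, h1 x ∂μ) - θ - 2 * (∫ x, |g x| ∂μ)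
        + 2 * (1 - I) * (π * (∫ x, |g x| ∂μ) + B * (∫ x, w x ∂μ) - π * B) := by
    intro μ _ i1 i2 i3
    have a1 : Integrable (fun x => 2 * h1 x) μ := i1.const_mul 2
    have a2 : Integrable (fun x => 2 * h1 x - θ) μ := a1.sub (integrable_const θ)
    have a3 : Integrable (fun x => 2 * |g x|) μ := i2.abs.const_mul 2
    have a4 : Integrable (fun x => 2 * h1 x - θ - 2 * |g x|) μ := a2.sub a3
    have b1 : Integrable (fun x => π * |g x|) μ := i2.abs.const_mul π
    have b2 : Integrable (fun x => B * w x) μ := i3.const_mul B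
    have b3 : Integrable (fun x => π * |g x| + B * w x) μ := b1.add b2
    have b4 : Integrable (fun x => π * |g x| + B * w x - π * B) μ := b3.sub (integrable_const _)
    rw [hu, integral_add a4 (b4.const_mul _), integral_sub a2 a3,
      integral_sub a1 (integrable_const _), integral_const_mul (2 * (1 - I)),
      integral_sub b3 (integrable_const _), integral_add b1 b2]
    simp only [integral_const_mul, integral_const, probReal_univ, one_smul]
  have hh1E : ∫ x, h1 x ∂G = θ := (crossAbsDiff_eq hgi hgi).symm
  have hu0 : ∫ x, u x ∂G = 0 := by
    rw [hmean G (hh12.integrable one_le_two) hgi (hw2.integrable one_le_two), hh1E, hwE, ← hB]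
    linear_combination (-1) * hIeq
  have hinfl : fullInfluence s G (giniK s (s.law G)) = fun x => u x / (2 * B * π) := by
    symm
    have hlawi := s.integrable_law hGi hπ.ne'
    have hKeq : ∀ x ∈ s.region, giniK s (s.law G) x
        = (∫ y, |x - y| ∂(s.law G) - mean (s.law G) - I * |x|) / ∫ x, |x| ∂(s.law G) := by
      intro x hx
      rw [giniK_law_eq s G hx, integral_abs_sub_eq hlawi, ← hI]
      ring
    refine fullInfluence_eq_div s hπ.ne'
      (c := (-θ + 2 * (1 - I) * (1 - π) * B + 2 * π * mean (s.law G)) / (2 * B))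
      (by positivity) ?_ (fun x => ?_) hu0
    · have hKi : Integrable (fun x => (∫ y, |x - y| ∂(s.law G) - mean (s.law G) - I * |x|)
          / ∫ x, |x| ∂(s.law G)) (s.law G) := by
        refine ((Integrable.sub ?_ (integrable_const _)).sub (hlawi.abs.const_mul I)).div_const _
        refine (hlawi.abs.add (integrable_const (∫ y, |y| ∂(s.law G)))).mono'
          (measurable_integral_abs_sub measurable_id).aestronglyMeasurable
          (ae_of_all _ fun x => integral_abs_sub_le hlawi x)
      exact hKi.congr (ae_cond_of_forall_mem hSm fun x hx => (hKeq x hx).symm)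
    · by_cases hx : x ∈ s.region
      · have hh1x : h1 x = π * ∫ y, |x - y| ∂(s.law G) + (1 - π) * |x| := by
          have hpt : ∀ y, |g x - g y| = s.region.indicator (fun y => |x - y|) y
              + s.regionᶜ.indicator (fun _ => |x|) y := fun y => by
            by_cases hy : y ∈ s.region <;> simp [hg, hx, hy]
          have i1 : Integrable (fun y => |x - y|) G := ((integrable_const x).sub hGi).abs
          simp only [hh1, hpt]
          rw [integral_add (i1.indicator hSm) ((integrable_const _).indicator hSm.compl),
            integral_indicator hSm, integral_indicator_const _ hSm.compl, s.mul_integral_law,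
            probReal_compl_eq_one_sub hSm, smul_eq_mul]
        have hgx : g x = x := by simp [hg, hx]
        have hwx : w x = 1 := by simp [hw, hx]
        rw [Set.indicator_of_mem hx, hKeq x hx, hu]
        simp only [hh1x, hgx, hwx]
        rw [← hBlaw]
        field_simp
        ring
      · have hgx : g x = 0 := by simp [hg, hx]
        have hwx : w x = 0 := by simp [hw, hx]
        have hh1x : h1 x = B := by simp [hh1, hgx, hB]
        rw [Set.indicator_of_notMem hx, zero_mul, hu]
        simp only [hgx, hwx, hh1x, abs_zero]
        linear_combination hIeq
  rw [hinfl]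
  have hπhat := tendstoZeroInProb_sampleMean_sub hS hn hwm hw2
  rw [hwE] at hπhat
  have hBhat := tendstoZeroInProb_sampleMean_sub hS hn (measurable_norm.comp hgm) hg2.norm
  have hBhatb := boundedInProb_sampleMean_sub hS hn (measurable_norm.comp hgm) hg2.norm hgi.norm
  simp only [Function.comp_def, Real.norm_eq_abs, ← hB] at hBhat hBhatb
  refine isAsymptoticallyLinear_of_ratio hS hn hum hu2 hu0 (by positivity)
    (Dh := fun r ω => 2 * sampleMean (n r) (fun i => X r i ω) (fun x => |g x|)
      * sampleMean (n r) (fun i => X r i ω) w)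
    (R := fun r ω => (crossAbsDiff g (empirical (n r) (fun i => X r i ω))
        (empirical (n r) (fun i => X r i ω))
      - 2 * sampleMean (n r) (fun i => X r i ω) h1 + θ)
      + 2 * (1 - I) * ((sampleMean (n r) (fun i => X r i ω) w - π)
        * (sampleMean (n r) (fun i => X r i ω) (fun x => |g x|) - B))) ?_ ?_ ?_
  · have e1 := (hπhat.const_mul (2 * B)).add ((hBhat.const_mul (2 * π)).add
      ((hBhat.boundedInProb.mul_tendstoZero hπhat).const_mul 2))
    refine e1.mono (Eventually.of_forall fun r ω => le_of_eq (congrArg _ ?_))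
    ring
  · have e1 := (tendstoZeroInProb_energy_remainder hS hn hgm hgi).add
      ((hBhatb.mul_tendstoZero hπhat).const_mul (2 * (1 - I)))
    refine e1.mono (Eventually.of_forall fun r ω => le_of_eq (congrArg _ ?_))
    ring
  · filter_upwards [hn.eventually_gt_atTop 0] with r hr ω hne
    have := isProbabilityMeasure_empirical hr (fun i => X r i ω)
    set μ := empirical (n r) (fun i => X r i ω) with hμ
    have hint : ∀ f : ℝ → ℝ, Integrable f μ := integrable_empirical _ _
    have hwμ : ∫ x, w x ∂μ = μ.real s.region := integral_indicator_one hSm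
    simp only [← integral_empirical, ← hμ] at hne ⊢
    rw [hwμ] at hne ⊢
    have hne' : μ.real s.region * ∫ x, |g x| ∂μ ≠ 0 := by
      intro h0
      refine hne ?_
      linear_combination 2 * h0
    have hI' := hgini μ (hint _) hne'
    rw [eq_div_iff hne, hmean μ (hint _) (hint _) (hint _), hwμ]
    linear_combination hI'

end GiniAsymptotics

/-! ### Measurability of the estimators -/

section Measurability

variable {Ω : Type*} [MeasurableSpace Ω] {X : ℕ → Ω → ℝ}

lemma measurable_sampleMean (hX : ∀ i, Measurable (X i)) (n : ℕ) {f : ℝ → ℝ} (hf : Measurable f) :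
    Measurable (fun ω => sampleMean n (fun i => X i ω) f) := by
  unfold sampleMean
  fun_prop

lemma measurable_empirical_region (hX : ∀ i, Measurable (X i)) (n : ℕ) (s : SignPart) :
    Measurable (fun ω => (empirical n (fun i => X i ω)).real s.region) := by
  simp_rw [fun ω => empirical_real_apply n (fun i => X i ω) s.measurableSet_region]
  exact measurable_sampleMean hX n (measurable_one.indicator s.measurableSet_region)

/-- A functional of the conditional empirical distribution is measurable if it is on the event that
the sample has values in the given part; off that event the conditional distribution is zero. -/
lemma measurable_law_empirical (hX : ∀ i, Measurable (X i)) (n : ℕ) (s : SignPart)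
    (Φ : Measure ℝ → ℝ) {Ψ : Ω → ℝ} (hΨ : Measurable Ψ)
    (h : ∀ ω, (empirical n (fun i => X i ω)).real s.region ≠ 0 →
      Φ (s.law (empirical n (fun i => X i ω))) = Ψ ω) :
    Measurable (fun ω => Φ (s.law (empirical n (fun i => X i ω)))) := by
  classical
  have heq : (fun ω => Φ (s.law (empirical n (fun i => X i ω))))
      = fun ω => if (empirical n (fun i => X i ω)).real s.region = 0 then Φ 0 else Ψ ω := by
    funext ω
    split_ifs with h0
    · rw [s.law_eq_zero _ h0]
    · exact h ω h0
  rw [heq]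
  exact Measurable.ite (measurable_empirical_region hX n s (measurableSet_singleton 0))
    measurable_const hΨ

lemma measurable_integral_law_empirical (hX : ∀ i, Measurable (X i)) (n : ℕ) (s : SignPart)
    {f : Ω → ℝ → ℝ} (hf : Measurable (Function.uncurry f)) :
    Measurable (fun ω => ∫ x, f ω x ∂(s.law (empirical n (fun i => X i ω)))) := by
  simp_rw [s.integral_law, fun ω => setIntegral_empirical n (fun i => X i ω) (f ω)
    s.measurableSet_region]
  refine (measurable_empirical_region hX n s).inv.mul ?_
  unfold sampleMean
  refine Measurable.const_mul (Finset.measurable_fun_sum _ fun i _ => ?_) _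
  have h1 : (fun ω => s.region.indicator (f ω) (X i ω))
      = (X i ⁻¹' s.region).indicator (fun ω => f ω (X i ω)) := by
    funext ω
    by_cases hx : X i ω ∈ s.region <;> simp [hx]
  rw [h1]
  exact (hf.comp (measurable_id.prodMk (hX i))).indicator (hX i s.measurableSet_region)

lemma measurable_quantile_empirical (hX : ∀ i, Measurable (X i)) (n : ℕ) (s : SignPart) {p : ℝ}
    (hp0 : 0 < p) (hp1 : p < 1) :
    Measurable (fun ω => quantile (s.law (empirical n (fun i => X i ω))) p) := by
  classical
  refine measurable_of_Iic fun x => ?_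
  have h1 : (fun ω => quantile (s.law (empirical n (fun i => X i ω))) p) ⁻¹' Set.Iic x
      = {ω | p ≤ cdf (s.law (empirical n (fun i => X i ω))) x} := by
    ext ω
    simp [quantile_le_iff hp0 hp1]
  rw [h1]
  refine measurableSet_le measurable_const ?_
  refine measurable_law_empirical hX n s (fun ν => cdf ν x)
    (Ψ := fun ω => ∫ y, (Set.Iic x).indicator 1 y ∂(s.law (empirical n (fun i => X i ω))))
    (measurable_integral_law_empirical hX n s
      ((measurable_one.indicator measurableSet_Iic).comp measurable_snd)) fun ω hω => ?_
  have := s.isProbabilityMeasure_law _ hω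
  rw [cdf_eq_integral]

lemma measurable_extLorenz_empirical (hX : ∀ i, Measurable (X i)) (n : ℕ) (s : SignPart) {p : ℝ}
    (hp0 : 0 < p) (hp1 : p < 1) :
    Measurable (fun ω => extLorenz s (s.law (empirical n (fun i => X i ω))) p) := by
  have hq := measurable_quantile_empirical hX n s hp0 hp1
  refine measurable_law_empirical hX n s (fun ν => extLorenz s ν p)
    (Ψ := fun ω => (p * quantile (s.law (empirical n (fun i => X i ω))) p
      - ∫ x, max (quantile (s.law (empirical n (fun i => X i ω))) p - x) 0
          ∂(s.law (empirical n (fun i => X i ω))))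
      / ∫ x, s.scale x ∂(s.law (empirical n (fun i => X i ω)))) ?_ fun ω hω => ?_
  · refine ((hq.const_mul p).sub ?_).div ?_
    · exact measurable_integral_law_empirical hX n s
        (((hq.comp measurable_fst).sub measurable_snd).max measurable_const)
    · exact measurable_integral_law_empirical hX n s (s.measurable_scale.comp measurable_snd)
  · have := s.isProbabilityMeasure_law _ hω
    rw [extLorenz_eq, cumulQuantile_eq (s.integrable_law (integrable_empirical _ _ _) hω) hp0 hp1]

lemma measurable_extGini_empirical (hX : ∀ i, Measurable (X i)) (n : ℕ) (s : SignPart) :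
    Measurable (fun ω => extGini s (s.law (empirical n (fun i => X i ω)))) := by
  refine measurable_law_empirical hX n s (extGini s)
    (Ψ := fun ω => (∫ x, ∫ y, |x - y| ∂(s.law (empirical n (fun i => X i ω)))
        ∂(s.law (empirical n (fun i => X i ω))))
      / (2 * ∫ x, |x| ∂(s.law (empirical n (fun i => X i ω))))) ?_ fun ω hω => ?_
  · have habs : Measurable fun z : (Ω × ℝ) × ℝ => |z.1.2 - z.2| := by fun_prop
    have hinner : Measurable (Function.uncurry fun (ω : Ω) (x : ℝ) =>
        ∫ y, |x - y| ∂(s.law (empirical n (fun i => X i ω)))) :=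
      measurable_integral_law_empirical (X := fun i (z : Ω × ℝ) => X i z.1)
        (fun i => (hX i).comp measurable_fst) n s (f := fun z y => |z.2 - y|) habs
    refine (measurable_integral_law_empirical hX n s hinner).div (Measurable.const_mul ?_ 2)
    exact measurable_integral_law_empirical hX n s (measurable_snd.abs)
  · have := s.isProbabilityMeasure_law _ hω
    have hi := s.integrable_law (integrable_empirical n (fun i => X i ω) id) hω
    rw [extGini_law_eq]
    congr 1
    exact crossAbsDiff_eq (g := id) hi hi

end Measurability

/-! ### Differences of two asymptotically linear estimators -/

section Difference

/-- If a part of the line has probability one, the influence function of a functional of the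
conditional distribution differs from its uncentred version by a constant, almost everywhere. -/
lemma fullInfluence_ae_eq (s : SignPart) {F : Measure ℝ} [IsProbabilityMeasure F]
    (h1 : F s.region = 1) (h : ℝ → ℝ) :
    h =ᵐ[F] fun x => fullInfluence s F h x + ∫ t, h t ∂(s.law F) := by
  have hae : ∀ᵐ x ∂F, x ∈ s.region := (prob_compl_eq_zero_iff s.measurableSet_region).2 h1
  filter_upwards [hae] with x hx
  simp [fullInfluence, hx, measureReal_def, h1]

/-- The asymptotic variance does not depend on the centring of the influence functions. -/
lemma asympVar_fullInfluence {F : Measure (ℝ × ℝ)} [IsProbabilityMeasure F] {s : SignPart}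
    (hs₁ : F.fst s.region = 1) (hs₂ : F.snd s.region = 1) {h₁ h₂ : ℝ → ℝ}
    (hψ₁ : MemLp (fullInfluence s F.fst h₁) 2 F.fst)
    (hψ₂ : MemLp (fullInfluence s F.snd h₂) 2 F.snd) (η l₁ l₂ : ℝ) :
    asympVar F η l₁ l₂ (fullInfluence s F.fst h₁) (fullInfluence s F.snd h₂)
      = asympVar F η l₁ l₂ h₁ h₂ := by
  have e₁ := fullInfluence_ae_eq s hs₁ h₁
  have e₂ := fullInfluence_ae_eq s hs₂ h₂
  have hmp₁ : MeasurePreserving Prod.fst F F.fst := ⟨measurable_fst, rfl⟩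
  have hmp₂ : MeasurePreserving Prod.snd F F.snd := ⟨measurable_snd, rfl⟩
  have e₁' : (fun z : ℝ × ℝ => h₁ z.1) =ᵐ[F] fun z =>
      fullInfluence s F.fst h₁ z.1 + ∫ t, h₁ t ∂(s.law F.fst) :=
    hmp₁.quasiMeasurePreserving.ae_eq_comp e₁
  have e₂' : (fun z : ℝ × ℝ => h₂ z.2) =ᵐ[F] fun z =>
      fullInfluence s F.snd h₂ z.2 + ∫ t, h₂ t ∂(s.law F.snd) :=
    hmp₂.quasiMeasurePreserving.ae_eq_comp e₂
  have i₁ : Integrable (fun z : ℝ × ℝ => fullInfluence s F.fst h₁ z.1) F :=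
    (hψ₁.comp_measurePreserving hmp₁).integrable one_le_two
  have i₂ : Integrable (fun z : ℝ × ℝ => fullInfluence s F.snd h₂ z.2) F :=
    (hψ₂.comp_measurePreserving hmp₂).integrable one_le_two
  have hcov : cov[fun z : ℝ × ℝ => h₁ z.1, fun z => h₂ z.2; F]
      = cov[fun z => fullInfluence s F.fst h₁ z.1, fun z => fullInfluence s F.snd h₂ z.2; F] := by
    rw [← covariance_add_const_left i₁ (∫ t, h₁ t ∂(s.law F.fst)),
      ← covariance_add_const_right i₂ (∫ t, h₂ t ∂(s.law F.snd))]
    unfold covariance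
    rw [integral_congr_ae e₁', integral_congr_ae e₂']
    refine integral_congr_ae ?_
    filter_upwards [e₁', e₂'] with z hz₁ hz₂
    rw [hz₁, hz₂]
  rw [asympVar, asympVar, hcov, variance_congr e₁, variance_congr e₂,
    variance_add_const hψ₁.aestronglyMeasurable, variance_add_const hψ₂.aestronglyMeasurable]

lemma abs_rootN_mul_le_left {a b : ℕ} (x : ℝ) :
    |rootN a b * x| ≤ |Real.sqrt a * x| := by
  rw [abs_mul, abs_mul, rootN, abs_of_nonneg (Real.sqrt_nonneg _),
    abs_of_nonneg (Real.sqrt_nonneg _)]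
  refine mul_le_mul_of_nonneg_right (Real.sqrt_le_sqrt ?_) (abs_nonneg _)
  exact div_le_of_le_mul₀ (by positivity) (by positivity)
    (mul_le_mul_of_nonneg_left (by simp) (Nat.cast_nonneg _))

lemma abs_rootN_mul_le_right {a b : ℕ} (x : ℝ) :
    |rootN a b * x| ≤ |Real.sqrt b * x| := by
  have : rootN a b = rootN b a := by rw [rootN, rootN, mul_comm, add_comm]
  rw [this]
  exact abs_rootN_mul_le_left x

variable {Ω : ℕ → Type*} [∀ r, MeasurableSpace (Ω r)]
  {P : ∀ r, Measure (Ω r)} [∀ r, IsProbabilityMeasure (P r)]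
  {F : Measure (ℝ × ℝ)} [IsProbabilityMeasure F]
  {n₁ n₂ m : ℕ → ℕ} {X₁ X₂ : ∀ r, ℕ → Ω r → ℝ} {η l₁ l₂ : ℝ}

/-- The difference of two asymptotically linear estimators from overlapping samples is
asymptotically normal. -/
theorem tendstoInDistribution_sub_of_isAsymptoticallyLinear
    (hOS : ∀ r, IsOverlappingSample (P r) F (n₁ r) (n₂ r) (m r) (X₁ r) (X₂ r))
    (hn₁ : Tendsto n₁ atTop atTop) (hn₂ : Tendsto n₂ atTop atTop)
    (hl₁ : Tendsto (fun r => (m r : ℝ) / n₁ r) atTop (𝓝 l₁))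
    (hl₂ : Tendsto (fun r => (m r : ℝ) / n₂ r) atTop (𝓝 l₂))
    (hη : Tendsto (fun r => (n₁ r : ℝ) / (n₁ r + n₂ r)) atTop (𝓝 η))
    {s : SignPart} {h₁ h₂ : ℝ → ℝ} {E₁ E₂ : ∀ r, Ω r → ℝ} {θ₁ θ₂ : ℝ}
    (hE₁ : ∀ r, Measurable (E₁ r)) (hE₂ : ∀ r, Measurable (E₂ r))
    (hA₁ : IsAsymptoticallyLinear P F.fst n₁ X₁ E₁ θ₁ (fullInfluence s F.fst h₁))
    (hA₂ : IsAsymptoticallyLinear P F.snd n₂ X₂ E₂ θ₂ (fullInfluence s F.snd h₂)) :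
    ∃ V : NNReal,
      (V : ℝ) = asympVar F η l₁ l₂ (fullInfluence s F.fst h₁) (fullInfluence s F.snd h₂) ∧
      (F.fst s.region = 1 → F.snd s.region = 1 → (V : ℝ) = asympVar F η l₁ l₂ h₁ h₂) ∧
      TendstoInDistribution
        (fun r ω => rootN (n₁ r) (n₂ r) * ((E₁ r ω - E₂ r ω) - (θ₁ - θ₂)))
        atTop (fun x : ℝ => x) P (gaussianReal 0 V) := by
  obtain ⟨V, hV, hT⟩ := tendstoInDistribution_of_overlapping hOS hn₁ hn₂ hl₁ hl₂ hη
    hA₁.measurable hA₂.measurable hA₁.memLp hA₂.memLp hA₁.integral_eq_zero hA₂.integral_eq_zero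
    (T := fun r ω => rootN (n₁ r) (n₂ r) * ((E₁ r ω - E₂ r ω) - (θ₁ - θ₂)))
    (fun r => (((hE₁ r).sub (hE₂ r)).sub measurable_const).const_mul _) (by
      have t₁ := hA₁.tendstoZero.mono (Y := fun r ω => rootN (n₁ r) (n₂ r) *
        (E₁ r ω - θ₁ - sampleMean (n₁ r) (fun i => X₁ r i ω) (fullInfluence s F.fst h₁)))
        (Eventually.of_forall fun r ω => abs_rootN_mul_le_left _)
      have t₂ := hA₂.tendstoZero.mono (Y := fun r ω => -(rootN (n₁ r) (n₂ r) *
        (E₂ r ω - θ₂ - sampleMean (n₂ r) (fun i => X₂ r i ω) (fullInfluence s F.snd h₂))))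
        (Eventually.of_forall fun r ω => by rw [abs_neg]; exact abs_rootN_mul_le_right _)
      refine (t₁.add t₂).mono (Eventually.of_forall fun r ω => le_of_eq (congrArg _ ?_))
      simp only [sampleMean]
      ring)
  exact ⟨V, hV, fun hs₁ hs₂ => hV.trans
    (asympVar_fullInfluence hs₁ hs₂ hA₁.memLp hA₂.memLp η l₁ l₂), hT⟩

end Difference

theorem mainTheorem5
    {Ω : ℕ → Type*} [∀ r, MeasurableSpace (Ω r)]
    (P : ∀ r, Measure (Ω r)) [∀ r, IsProbabilityMeasure (P r)]
    (F : Measure (ℝ × ℝ)) [IsProbabilityMeasure F]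
    (n₁ n₂ m : ℕ → ℕ) (X₁ X₂ : ∀ r, ℕ → Ω r → ℝ)
    (hOS : ∀ r, IsOverlappingSample (P r) F (n₁ r) (n₂ r) (m r) (X₁ r) (X₂ r))
    (hn₁ : Tendsto n₁ atTop atTop) (hn₂ : Tendsto n₂ atTop atTop)
    (η l₁ l₂ : ℝ)
    (hl₁ : Tendsto (fun r => (m r : ℝ) / n₁ r) atTop (𝓝 l₁))
    (hl₂ : Tendsto (fun r => (m r : ℝ) / n₂ r) atTop (𝓝 l₂))
    (hη : Tendsto (fun r => (n₁ r : ℝ) / (n₁ r + n₂ r)) atTop (𝓝 η))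
    (hvar₁ : MemLp (fun z : ℝ × ℝ => z.1) 2 F)
    (hvar₂ : MemLp (fun z : ℝ × ℝ => z.2) 2 F)
    (s : SignPart)
    (hs₁ : 0 < F.fst (s.region \ {0})) (hs₂ : 0 < F.snd (s.region \ {0})) :
    -- extended Lorenz curve ordinates
    (∀ p : ℝ, 0 < p → p < 1 →
      DifferentiableAt ℝ (cdf (s.law F.fst)) (quantile (s.law F.fst) p) →
      DifferentiableAt ℝ (cdf (s.law F.snd)) (quantile (s.law F.snd) p) →
      (∀ x, quantile (s.law F.fst) p < x → p < cdf (s.law F.fst) x) →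
      (∀ x, quantile (s.law F.snd) p < x → p < cdf (s.law F.snd) x) →
      ∃ V : NNReal,
        (V : ℝ) = asympVar F η l₁ l₂
          (fullInfluence s F.fst (lorenzW s (s.law F.fst) p))
          (fullInfluence s F.snd (lorenzW s (s.law F.snd) p)) ∧
        (F.fst s.region = 1 → F.snd s.region = 1 →
          (V : ℝ) = asympVar F η l₁ l₂
            (lorenzW s (s.law F.fst) p) (lorenzW s (s.law F.snd) p)) ∧
        TendstoInDistribution
          (fun r ω => rootN (n₁ r) (n₂ r) *
            ((extLorenz s (s.law (empirical (n₁ r) (fun i => X₁ r i ω))) p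
                - extLorenz s (s.law (empirical (n₂ r) (fun i => X₂ r i ω))) p)
              - (extLorenz s (s.law F.fst) p - extLorenz s (s.law F.snd) p)))
          atTop (fun x : ℝ => x) P (gaussianReal 0 V)) ∧
    -- extended Gini indices
    ((∀ x : ℝ, x ≠ 0 → ContinuousAt (cdf F.fst) x) →
      (∀ x : ℝ, x ≠ 0 → ContinuousAt (cdf F.snd) x) →
      ∃ V : NNReal,
        (V : ℝ) = asympVar F η l₁ l₂
          (fullInfluence s F.fst (giniK s (s.law F.fst)))
          (fullInfluence s F.snd (giniK s (s.law F.snd))) ∧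
        (F.fst s.region = 1 → F.snd s.region = 1 →
          (V : ℝ) = asympVar F η l₁ l₂
            (giniK s (s.law F.fst)) (giniK s (s.law F.snd))) ∧
        TendstoInDistribution
          (fun r ω => rootN (n₁ r) (n₂ r) *
            ((extGini s (s.law (empirical (n₁ r) (fun i => X₁ r i ω)))
                - extGini s (s.law (empirical (n₂ r) (fun i => X₂ r i ω))))
              - (extGini s (s.law F.fst) - extGini s (s.law F.snd))))
          atTop (fun x : ℝ => x) P (gaussianReal 0 V)) := by
  have hG₁ : MemLp (fun x : ℝ => x) 2 F.fst :=
    (memLp_map_measure_iff (by fun_prop) (by fun_prop)).2 hvar₁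
  have hG₂ : MemLp (fun x : ℝ => x) 2 F.snd :=
    (memLp_map_measure_iff (by fun_prop) (by fun_prop)).2 hvar₂
  have hS₁ := fun r => (hOS r).isSample_fst
  have hS₂ := fun r => (hOS r).isSample_snd
  refine ⟨fun p hp0 hp1 _ _ hu₁ hu₂ => ?_, fun _ _ => ?_⟩
  · exact tendstoInDistribution_sub_of_isAsymptoticallyLinear hOS hn₁ hn₂ hl₁ hl₂ hη
      (fun r => measurable_extLorenz_empirical (hOS r).measurable₁ _ s hp0 hp1)
      (fun r => measurable_extLorenz_empirical (hOS r).measurable₂ _ s hp0 hp1)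
      (isAsymptoticallyLinear_extLorenz hS₁ hn₁ hG₁ hs₁ hp0 hp1 hu₁)
      (isAsymptoticallyLinear_extLorenz hS₂ hn₂ hG₂ hs₂ hp0 hp1 hu₂)
  · exact tendstoInDistribution_sub_of_isAsymptoticallyLinear hOS hn₁ hn₂ hl₁ hl₂ hη
      (fun r => measurable_extGini_empirical (hOS r).measurable₁ _ s)
      (fun r => measurable_extGini_empirical (hOS r).measurable₂ _ s)
      (isAsymptoticallyLinear_extGini hS₁ hn₁ hG₁ hs₁)
      (isAsymptoticallyLinear_extGini hS₂ hn₂ hG₂ hs₂)
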